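/- **Setting.** Let $\mathcal X\subset\mathbb R^d$ be compact and convex, $\varepsilon>0$, $c(x,y)=\|x-y\|^2$, $k_c=e^{-c/\varepsilon}$, and $V\in C(\mathcal X)$. Let $\mathcal H_c$ be the reproducing kernel Hilbert space of $k_c$ and $H_c[\nu](y)=\int k_c(x,y)\,d\nu(x)$. For $\mu\in\mathcal P(\mathcal X)$ let $f_\mu\in C(\mathcal X)$ be the unique solution of $f_\mu(y)=-\varepsilon\log\int e^{(f_\mu(x)-c(x,y))/\varepsilon}\,d\mu(x)$, let $B(\mu)=e^{-f_\mu/\varepsilon}\in\mathcal H_c$, $k_\mu(x,y)=e^{(f_\mu(x)+f_\mu(y)-c(x,y))/\varepsilon}$, $K_\mu[\phi](y)=\int k_\mu(x,y)\phi(x)\,d\mu(x)$, let $\mathcal H_\mu$ be the reproducing kernel Hilbert space of $k_\mu$, and let $H_\mu:\mathcal H_\mu^*\to\mathcal H_\mu$ be the Riesz map. For $\sigma\in\mathcal H_\mu^*$ with $\langle\sigma,1\rangle=0$ let $\mathbf g_\mu(\sigma,\sigma)=\frac\varepsilon2\langle\sigma,(\mathrm{Id}-K_\mu^2)^{-1}H_\mu[\sigma]\rangle$,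 the inverse being taken modulo constants, and let $$\mathsf d_S(\mu_0,\mu_1)^2=\inf\int_0^1\mathbf g_{\mu_t}(\dot\mu_t,\dot\mu_t)\,dt$$ over curves $(\mu_t)_{t\in[0,1]}$ in $\mathcal P(\mathcal X)$ from $\mu_0$ to $\mu_1$ with $(B(\mu_t))_t\in H^1([0,1];\mathcal H_c)$. Here $\dot\mu_t\in\mathcal H_{\mu_t}^*$ is given by $\langle\dot\mu_t,\phi\rangle=\frac{d}{dt}\langle\mu_t,\phi\rangle$, where $\phi\in\mathcal H_{\mu_t}$ is kept fixed when differentiating, and satisfies $\langle\dot\mu_t,1\rangle=0$. Let $P\mu=\{p\in C(\mathcal X):p\le0,\ p=0\text{ on }\operatorname{supp}\mu\}$. A curve $(y_t)_{t\in I}$ in a metric space is $p$-absolutely continuous on an interval $I$ if there is $m\in L^p(I)$ with $\mathsf d(y_s,y_t)\le\int_s^t m$ for all $s\le t$ in $I$, and locally so if this holds on every compact subinterval of $I$. A *Sinkhorn potential flow* of $V$ starting from $\bar\mu_0$ is a curve $(\mu_t)_{t\ge0}$ in $\mathcal P(\mathcal X)$, locally $2$-absolutely continuous for $\mathsf d_S$,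 with $\mu_0=\bar\mu_0$ and, for a.e. $t$, $$\tfrac\varepsilon2(\mathrm{Id}-K_{\mu_t}^2)^{-1}H_{\mu_t}[\dot\mu_t]+V+P\mu_t\ni0\quad\text{in }C(\mathcal X)/\mathbb R.$$ For $b\in H_c[\mathcal M_+(\mathcal X)]$ put $Wb=\frac2\varepsilon\bigl(Vb-H_c[V\,H_c^{-1}[b]]\bigr)$ and $\tilde Pb=P(H_c^{-1}[b])$. Finally, $\partial V(x)=\{v\in\mathbb R^d: V(y)\ge V(x)+\langle v,y-x\rangle\ \forall y\in\mathcal X\}$, and a gradient flow of $V$ starting at $\bar x_0\in\mathcal X$ is a locally ($1$-)absolutely continuous curve $(x_t)_{t\ge0}$ in $\mathcal X$ with $x_0=\bar x_0$ and $\dot x_t\in-\partial V(x_t)$ for a.e. $t$. **Proposition (flow of a Dirac mass).** Let $(x_t)_{t\ge0}$ be a curve in $\mathcal X$, $\mu_t=\delta_{x_t}$ and $b_t=B(\mu_t)$. 1. For every $p\in[1,\infty]$, if $(x_t)_{t\ge0}$ is $p$-absolutely continuous on $[0,\infty)$ (respectively, locally), then so is $(b_t)_{t\ge0}$ in $\mathcal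 H_c$. 2. At any $t\ge0$ at which $\dot x_t$ and $\dot b_t$ exist (one-sided derivatives if $t=0$; $\dot b_t$ in the norm of $\mathcal H_c$), $$\dot b_t+Wb_t+\tilde Pb_t\ni0\ \text{ in }C(\mathcal X)\quad\Longleftrightarrow\quad\dot x_t\in-\partial V(x_t).$$ 3. If $V$ is convex, then for every $\bar x_0\in\mathcal X$ there is a unique gradient flow $(x_t)_{t\ge0}$ of $V$ starting at $\bar x_0$, and $(\delta_{x_t})_{t\ge0}$ is the unique Sinkhorn potential flow of $V$ starting at $\delta_{\bar x_0}$. -/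

import Mathlib

open MeasureTheory Set
open scoped ENNReal

noncomputable section

namespace SinkhornFlow

/-! ### Absolutely continuous curves -/

/-- `y` is `p`-absolutely continuous on the interval `I` for the (extended) distance `dist`:
there is `m ∈ L^p(I)` with `dist (y s) (y t) ≤ ∫_s^t m` for all `s ≤ t` in `I`. -/
def IsAC {Y : Type*} (p : ℝ≥0∞) (dist : Y → Y → ℝ≥0∞) (y : ℝ → Y) (I : Set ℝ) : Prop :=
  ∃ m : ℝ → ℝ, MemLp m p (volume.restrict I) ∧
    ∀ s ∈ I, ∀ t ∈ I, s ≤ t → dist (y s) (y t) ≤ ENNReal.ofReal (∫ r in s..t, m r)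

/-- Local `p`-absolute continuity: `p`-absolute continuity on every compact subinterval of `I`. -/
def IsACLoc {Y : Type*} (p : ℝ≥0∞) (dist : Y → Y → ℝ≥0∞) (y : ℝ → Y) (I : Set ℝ) : Prop :=
  ∀ a b : ℝ, Icc a b ⊆ I → IsAC p dist y (Icc a b)

/-- The Sobolev space `H¹([0,1]; H)` (continuous representatives): `b` has a weak derivative
`v ∈ L²([0,1]; H)`, i.e. `b` is a primitive of `v`. -/
def IsH1 {H : Type*} [NormedAddCommGroup H] [InnerProductSpace ℝ H] (b : ℝ → H) : Prop :=
  ∃ v : ℝ → H, MemLp v 2 (volume.restrict (Icc (0 : ℝ) 1)) ∧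
    ∀ t ∈ Icc (0 : ℝ) 1, b t = b 0 + ∫ s in (0 : ℝ)..t, v s

/-! ### Positive definite kernels

A real kernel is seen as a matrix with values in `ℝ →L[ℝ] ℝ`, as in Mathlib's theory of
reproducing kernel Hilbert spaces. -/

/-- The operator-valued matrix `(x, y) ↦ k(x, y) • id` of a real kernel `k`. -/
def kernelMatrix {X : Type*} (k : X → X → ℝ) : Matrix X X (ℝ →L[ℝ] ℝ) :=
  Matrix.of fun x y => k x y • ContinuousLinearMap.id ℝ ℝ

section PosSemidef

variable {E : Type*} [NormedAddCommGroup E] [InnerProductSpace ℝ E]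

theorem inner_posSemidef (K : Set E) :
    (Matrix.of fun x y : K => inner ℝ (x : E) (y : E)).PosSemidef := by
  refine ⟨?_, fun w => ?_⟩
  · ext x y
    simp [real_inner_comm]
  · have h : (w.sum fun i xi => w.sum fun j xj => star xi *
        (Matrix.of fun x y : K => inner ℝ (x : E) (y : E)) i j * xj)
        = inner ℝ (w.sum fun i xi => xi • (i : E)) (w.sum fun i xi => xi • (i : E)) := by
      simp only [Finsupp.sum, sum_inner, inner_sum, Matrix.of_apply, real_inner_smul_left,
        real_inner_smul_right, star_trivial]
      refine Finset.sum_congr rfl fun i _ => ?_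
      refine Finset.sum_congr rfl fun j _ => ?_
      rw [real_inner_comm]
      ring
    rw [h]
    exact real_inner_self_nonneg

theorem inner_pow_posSemidef (K : Set E) (n : ℕ) :
    (Matrix.of fun x y : K => (inner ℝ (x : E) (y : E)) ^ n).PosSemidef := by
  induction n with
  | zero =>
    refine ⟨?_, fun w => ?_⟩
    · ext x y; simp
    · have h : (w.sum fun i xi => w.sum fun j xj => star xi *
          (Matrix.of fun x y : K => (inner ℝ (x : E) (y : E)) ^ 0) i j * xj)
          = (w.sum fun _ xi => xi) ^ 2 := by
        simp only [Finsupp.sum, Matrix.of_apply, pow_zero, mul_one, star_trivial, sq,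
          Finset.sum_mul_sum]
      rw [h]
      positivity
  | succ n ih =>
    have h := ih.hadamard (inner_posSemidef K)
    have e : (Matrix.of fun x y : K => (inner ℝ (x : E) (y : E)) ^ (n + 1)) =
        Matrix.hadamard (Matrix.of fun x y : K => (inner ℝ (x : E) (y : E)) ^ n)
          (Matrix.of fun x y : K => inner ℝ (x : E) (y : E)) := by
      ext x y; simp [pow_succ]
    rw [e]; exact h

theorem gibbs_nonneg (K : Set E) (ε : ℝ) (hε : 0 < ε) (f : K → ℝ) (s : Finset K) (w : K → ℝ) :
    0 ≤ ∑ x ∈ s, ∑ y ∈ s, w x * w y *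
      Real.exp ((f x + f y - ‖(x : E) - y‖ ^ 2) / ε) := by
  set g : K → ℝ := fun x => w x * Real.exp ((f x - ‖(x : E)‖ ^ 2) / ε) with hg
  have h1 : ∀ x y : K, HasSum (fun n : ℕ => g x * g y *
      ((2 / ε) ^ n / n.factorial * (inner ℝ (x : E) (y : E)) ^ n))
      (w x * w y * Real.exp ((f x + f y - ‖(x : E) - y‖ ^ 2) / ε)) := by
    intro x y
    have h2 := (NormedSpace.expSeries_div_hasSum_exp (2 / ε * inner ℝ (x : E) (y : E))).mul_left
      (g x * g y)
    rw [← Real.exp_eq_exp_ℝ] at h2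
    have h3 : w x * w y * Real.exp ((f x + f y - ‖(x : E) - y‖ ^ 2) / ε) =
        g x * g y * Real.exp (2 / ε * inner ℝ (x : E) (y : E)) := by
      have : (f x + f y - (‖(x : E)‖ ^ 2 - 2 * inner ℝ (x : E) (y : E) + ‖(y : E)‖ ^ 2)) / ε =
        (f x - ‖(x : E)‖ ^ 2) / ε + (f y - ‖(y : E)‖ ^ 2) / ε
          + 2 / ε * inner ℝ (x : E) (y : E) := by ring
      rw [norm_sub_sq_real, hg, this, Real.exp_add, Real.exp_add]
      ring
    rw [h3]
    refine h2.congr_fun fun n => ?_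
    rw [mul_pow]; ring
  have h3 := hasSum_sum (s := s) fun x _ => hasSum_sum (s := s) fun y _ => h1 x y
  refine h3.nonneg fun n => ?_
  classical
  have h4 := (inner_pow_posSemidef K n).2 (Finsupp.indicator s fun x _ => g x)
  have h5 : ((Finsupp.indicator s fun x _ => g x).sum fun i xi =>
      (Finsupp.indicator s fun x _ => g x).sum fun j xj => star xi *
        (Matrix.of fun x y : K => (inner ℝ (x : E) (y : E)) ^ n) i j * xj) =
      ∑ x ∈ s, ∑ y ∈ s, g x * (inner ℝ (x : E) (y : E)) ^ n * g y := by
    rw [Finsupp.sum_of_support_subset _ (Finsupp.support_indicator_subset _ _) _ (by simp)]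
    refine Finset.sum_congr rfl fun x hx => ?_
    rw [Finsupp.sum_of_support_subset _ (Finsupp.support_indicator_subset _ _) _ (by simp)]
    refine Finset.sum_congr rfl fun y hy => ?_
    simp [hx, hy]
  rw [h5] at h4
  have h6 : ∑ x ∈ s, ∑ y ∈ s, g x * g y *
      ((2 / ε) ^ n / n.factorial * (inner ℝ (x : E) (y : E)) ^ n) =
      (2 / ε) ^ n / n.factorial *
        ∑ x ∈ s, ∑ y ∈ s, g x * (inner ℝ (x : E) (y : E)) ^ n * g y := by
    simp only [Finset.mul_sum]
    refine Finset.sum_congr rfl fun i _ => Finset.sum_congr rfl fun j _ => by ring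
  rw [h6]
  positivity

theorem gibbs_posSemidef (K : Set E) (ε : ℝ) (hε : 0 < ε) (f : K → ℝ) :
    (kernelMatrix fun x y : K =>
      Real.exp ((f x + f y - ‖(x : E) - y‖ ^ 2) / ε)).PosSemidef := by
  have key := (RKHS.posSemidef_tfae (𝕜 := ℝ) (V := ℝ) (K := kernelMatrix fun x y : K =>
      Real.exp ((f x + f y - ‖(x : E) - y‖ ^ 2) / ε))).out 0 2
  refine key.mpr ⟨?_, fun w => ?_⟩
  · refine Matrix.IsHermitian.ext fun x y => ?_
    simp only [kernelMatrix, Matrix.of_apply, star_smul, star_trivial]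
    rw [norm_sub_rev, add_comm (f x)]
    congr 1
    exact IsSelfAdjoint.star_eq (IsSelfAdjoint.one (ℝ →L[ℝ] ℝ))
  · have h := gibbs_nonneg K ε hε f w.support w
    convert h using 1
    simp only [Finsupp.sum, kernelMatrix, Matrix.of_apply, RCLike.re_to_real]
    refine Finset.sum_congr rfl fun x _ => Finset.sum_congr rfl fun y _ => ?_
    rw [norm_sub_rev, add_comm (f x)]
    simp [mul_comm, mul_left_comm]

end PosSemidef

/-! ### Entropic optimal transport on `K ⊆ ℝ^d` with the quadratic cost -/

section Main

variable {d : ℕ} {K : Set (EuclideanSpace ℝ (Fin d))} (ε : ℝ)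

/-- The quadratic cost `c(x, y) = ‖x - y‖²`. -/
def cost (x y : K) : ℝ := ‖(x : EuclideanSpace ℝ (Fin d)) - y‖ ^ 2

/-- The Sinkhorn map `T_ε(f, μ)(y) = -ε log ∫ exp ((f(x) - c(x, y)) / ε) dμ(x)`. -/
def sinkhornMap (f : K → ℝ) (μ : ProbabilityMeasure K) (y : K) : ℝ :=
  -ε * Real.log (∫ x, Real.exp ((f x - cost x y) / ε) ∂(μ : Measure K))

/-- The self-transport Schrödinger potential `f_μ`: the (unique) continuous solution of
`f = T_ε(f, μ)`. -/
def schrodingerPotential (μ : ProbabilityMeasure K) : C(K, ℝ) :=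
  Classical.epsilon fun f : C(K, ℝ) => ∀ y, f y = sinkhornMap ε f μ y

/-- The kernel `k_c = exp (-c / ε)`. -/
def kc (x y : K) : ℝ := Real.exp (-cost x y / ε)

/-- The self-transport kernel `k_μ = exp ((f_μ ⊕ f_μ - c) / ε)`. -/
def kself (μ : ProbabilityMeasure K) (x y : K) : ℝ :=
  Real.exp ((schrodingerPotential ε μ x + schrodingerPotential ε μ y - cost x y) / ε)

instance fact_kc [hε : Fact (0 < ε)] : Fact (kernelMatrix (kc (K := K) ε)).PosSemidef := by
  refine ⟨?_⟩
  have h := gibbs_posSemidef K ε hε.out (fun _ => 0)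
  simp only [add_zero, zero_sub] at h
  exact h

instance fact_kself [hε : Fact (0 < ε)] (μ : ProbabilityMeasure K) :
    Fact (kernelMatrix (kself ε μ)).PosSemidef :=
  ⟨gibbs_posSemidef K ε hε.out (schrodingerPotential ε μ)⟩

variable (K) in
/-- The reproducing kernel Hilbert space `H_c` of the kernel `k_c`. -/
abbrev Hc [Fact (0 < ε)] : Type := RKHS.OfKernel (kernelMatrix (kc (K := K) ε))

/-- The reproducing kernel Hilbert space `H_μ` of the kernel `k_μ`. -/
abbrev Hself [Fact (0 < ε)] (μ : ProbabilityMeasure K) : Type :=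
  RKHS.OfKernel (kernelMatrix (kself ε μ))

/-- The embedding `B(μ) = exp (-f_μ / ε)`, as the (unique) element of `H_c` given by this
function. -/
def embB [Fact (0 < ε)] (μ : ProbabilityMeasure K) : Hc K ε :=
  Classical.epsilon fun b : Hc K ε => ∀ y, b y = Real.exp (-schrodingerPotential ε μ y / ε)

/-! ### The metric tensor and the Riemannian distance -/

/-- The operator `K_μ[φ](y) = ∫ k_μ(x, y) φ(x) dμ(x)`. -/
def Kop (μ : ProbabilityMeasure K) (φ : K → ℝ) (y : K) : ℝ :=
  ∫ x, kself ε μ x y * φ x ∂(μ : Measure K)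

/-- `φ = (Id - K_μ²)⁻¹ ψ` as an identity modulo constant functions. -/
def IsInvIdSubKSq (μ : ProbabilityMeasure K) (φ ψ : K → ℝ) : Prop :=
  ∃ a : ℝ, ∀ y, φ y - Kop ε μ (Kop ε μ φ) y = ψ y + a

/-- The Riesz representative `H_μ[σ] ∈ H_μ` of a linear form `σ ∈ H_μ^*`. -/
def riesz [Fact (0 < ε)] {μ : ProbabilityMeasure K} (σ : StrongDual ℝ (Hself ε μ)) : Hself ε μ :=
  (InnerProductSpace.toDual ℝ (Hself ε μ)).symm σ

/-- The metric tensor `g_μ(σ, σ) = (ε / 2) ⟨σ, (Id - K_μ²)⁻¹ H_μ[σ]⟩` for `σ ∈ H_μ^*` with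
`⟨σ, 1⟩ = 0`. The function `φ = (Id - K_μ²)⁻¹ H_μ[σ]` is determined up to an additive constant, on
which the value does not depend: the infimum runs over a single value. -/
def metricTensor [Fact (0 < ε)] (μ : ProbabilityMeasure K) (σ : StrongDual ℝ (Hself ε μ)) :
    ℝ≥0∞ :=
  ⨅ (φ : Hself ε μ) (_ : IsInvIdSubKSq ε μ φ (riesz ε σ)), ENNReal.ofReal (ε / 2 * σ φ)

/-- `σ` is the derivative at time `t ∈ I` of the curve `μ : I → P(K)`, as an element of the tangent
space `{σ ∈ H_{μ_t}^* : ⟨σ, 1⟩ = 0}` (weak-* differentiability in `H_{μ_t}^*`). -/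
def IsVelocity [Fact (0 < ε)] (I : Set ℝ) (μ : ℝ → ProbabilityMeasure K) (t : ℝ)
    (σ : StrongDual ℝ (Hself ε (μ t))) : Prop :=
  (∀ φ : Hself ε (μ t), (∀ y, φ y = 1) → σ φ = 0) ∧
    ∀ φ : Hself ε (μ t), HasDerivWithinAt (fun s => ∫ y, φ y ∂(μ s : Measure K)) (σ φ) I t

/-- The Riemannian distance `d_S`: the infimum of `∫₀¹ g_{μ_t}(μ̇_t, μ̇_t) dt` over the curves from
`μ₀` to `μ₁` whose image by `B` is in `H¹([0,1]; H_c)` is the square of `d_S(μ₀, μ₁)`. -/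
def dS [Fact (0 < ε)] (μ₀ μ₁ : ProbabilityMeasure K) : ℝ≥0∞ :=
  (sInf {r : ℝ≥0∞ | ∃ (μ : ℝ → ProbabilityMeasure K) (σ : ∀ t, StrongDual ℝ (Hself ε (μ t))),
    μ 0 = μ₀ ∧ μ 1 = μ₁ ∧ IsH1 (fun t => embB ε (μ t)) ∧
    (∀ᵐ t ∂(volume.restrict (Icc (0 : ℝ) 1)), IsVelocity ε (Icc 0 1) μ t (σ t)) ∧
    r = ∫⁻ t in Icc (0 : ℝ) 1, metricTensor ε (μ t) (σ t)}) ^ (1 / 2 : ℝ)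

/-! ### The Sinkhorn potential flow -/

/-- The admissible pressures `Pμ = {p ∈ C(K) : p ≤ 0 and p = 0 on supp μ}`. -/
def pressures (μ : Measure K) : Set C(K, ℝ) :=
  {p | (∀ y, p y ≤ 0) ∧ ∀ y ∈ μ.support, p y = 0}

/-- `(μ_t)_{t ≥ 0}` is a Sinkhorn potential flow of `V` starting from `μ₀`: it is locally
`2`-absolutely continuous for `d_S`, and for a.e. `t ≥ 0`
`(ε / 2) (Id - K_{μ_t}²)⁻¹ H_{μ_t}[μ̇_t] + V + Pμ_t ∋ 0` in `C(K) / ℝ`. -/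
structure IsSinkhornPotentialFlow [Fact (0 < ε)] (V : C(K, ℝ)) (μ₀ : ProbabilityMeasure K)
    (μ : ℝ → ProbabilityMeasure K) : Prop where
  ac : IsACLoc 2 (dS ε) μ (Ici 0)
  init : μ 0 = μ₀
  inclusion : ∀ᵐ t ∂(volume.restrict (Ici (0 : ℝ))),
    ∃ σ : StrongDual ℝ (Hself ε (μ t)), IsVelocity ε (Ici 0) μ t σ ∧
      ∃ φ : C(K, ℝ), IsInvIdSubKSq ε (μ t) φ (riesz ε σ) ∧
        ∃ p ∈ pressures (μ t : Measure K), ∃ a : ℝ, ∀ y, ε / 2 * φ y + V y + p y = a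

/-! ### The flow in the variable `b` -/

/-- `H_c⁻¹` on `H_c[M₊(K)]`: the (unique) finite non-negative measure `ν` with `H_c[ν] = b`, i.e.
`b(y) = ∫ k_c(x, y) dν(x)`. -/
def HcInv (b : K → ℝ) : FiniteMeasure K :=
  Classical.epsilon fun ν : FiniteMeasure K => ∀ y, b y = ∫ x, kc ε x y ∂(ν : Measure K)

/-- `V^* b = H_c[V H_c⁻¹[b]]`. -/
def Vstar (V : C(K, ℝ)) (b : K → ℝ) (y : K) : ℝ :=
  ∫ x, kc ε x y * V x ∂(HcInv ε b : Measure K)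

/-- `W b = (2 / ε) (V b - V^* b)`, for `b ∈ H_c[M₊(K)]`. -/
def Wop (V : C(K, ℝ)) (b : K → ℝ) (y : K) : ℝ :=
  2 / ε * (V y * b y - Vstar ε V b y)

/-- `P̃ b = {p ∈ C(K) : p ≤ 0 and p = 0 on supp H_c⁻¹[b]}`, for `b ∈ H_c[M₊(K)]`. -/
def Ptilde (b : K → ℝ) : Set C(K, ℝ) := pressures (HcInv ε b : Measure K)

/-! ### Convexity, subdifferential and gradient flow of a potential on `K` -/

/-- Convexity of a function on the convex set `K`. -/
def IsConvexFun (V : C(K, ℝ)) : Prop :=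
  ∀ (x y z : K) (a b : ℝ), 0 ≤ a → 0 ≤ b → a + b = 1 →
    (z : EuclideanSpace ℝ (Fin d)) = a • (x : EuclideanSpace ℝ (Fin d)) + b • ↑y →
    V z ≤ a * V x + b * V y

/-- The subdifferential `∂V(x)` in the sense of convex analysis (`V` being `+∞` outside `K`). -/
def subdifferential (V : C(K, ℝ)) (x : K) : Set (EuclideanSpace ℝ (Fin d)) :=
  {v | ∀ y : K, V x + inner ℝ v ((y : EuclideanSpace ℝ (Fin d)) - x) ≤ V y}

/-- `(x_t)_{t ≥ 0}` is a gradient flow of `V` starting at `x₀`: it is locally absolutely continuous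
with `ẋ_t ∈ -∂V(x_t)` for a.e. `t ≥ 0`. -/
structure IsGradientFlow (V : C(K, ℝ)) (x₀ : K) (x : ℝ → K) : Prop where
  ac : IsACLoc 1 edist x (Ici 0)
  init : x 0 = x₀
  inclusion : ∀ᵐ t ∂(volume.restrict (Ici (0 : ℝ))), ∃ v : EuclideanSpace ℝ (Fin d),
    HasDerivWithinAt (fun s => (x s : EuclideanSpace ℝ (Fin d))) v (Ici 0) t ∧
      -v ∈ subdifferential V (x t)

end Main

end SinkhornFlow

end

open SinkhornFlow

/-! For a Dirac mass everything is explicit. The Schrödinger equation forces `embB ε δ_x` to be the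
kernel section k_c(x, ·), k_{δ_x}(y, z) is exp((2/ε)⟨y - x, z - x⟩), and K_{δ_x} is evaluation at x,
so Id - K² is the identity modulo constants. The map x ↦ k_c(x, ·) is √(2/ε)-Lipschitz into H_c,
which gives the first claim. A nonnegative measure with kernel mean k_c(x, ·) must be δ_x
(`eq_dirac_of_integral_kc_eq`), so every term of the inclusion for b except the pressure contains
the positive factor (2/ε) k_c(x_t, y). The pressure then exists exactly when V(y) - V(x_t) + ⟨ẋ_t, y
- x_t⟩ ≥ 0 for all y (`inclusion_iff`).

For convex V, implicit Euler steps converge to a curve satisfying an evolution variational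
inequality (`exists_evi`). Its dissipation estimate makes the curve locally 2-absolutely continuous,
and differentiating the inequality gives the subgradient inclusion; monotonicity of ∂V gives
uniqueness. Segments bound d_S between Dirac masses by the Euclidean distance, so the curve of Dirac
masses is a Sinkhorn flow.

Uniqueness among all Sinkhorn flows compares an arbitrary flow μ with the gradient flow x through
E(t) = B(μ_t)(x_t) = ⟨B(μ_t), k_c(x_t, ·)⟩. Both vectors have norm one, so E = 1 forces them to
coincide, and then μ_t = δ_{x_t} (`eq_diracProba_of_bfun_eq`). As E(0) = 1, it suffices that E does
not decrease.

Absolute continuity of E comes from the Lipschitz bound of B for d_S (`edist_embB_le`). For the sign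
of E', a limit w of difference quotients of b = B(μ) solves (Id + K_μ)[w/b] = H_μ[μ̇]
(`IsVelocity.add_Kop_eq_riesz`), hence w/b = φ - K_μ φ with φ from the flow inclusion. The sign of
the pressure bounds w(x) below by (2/ε)∫ρ(y)(V(y) - V(x)) dμ(y), where ρ = k_c(·, x)/b. The motion
of x contributes at least (2/ε)∫ρ(y)⟨ẋ, y - x⟩ dμ(y). The sum is nonnegative because -ẋ is a
subgradient (`deriv_embB_apply_nonneg`). -/

namespace SinkhornFlow

open Filter Topology

/-! ### Real-valued reproducing kernel Hilbert spaces -/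

section Kernel

variable {X : Type*} {k : X → X → ℝ} [Fact (kernelMatrix k).PosSemidef]

/-- The kernel section `k(x, ·)` as an element of the reproducing kernel Hilbert space. -/
noncomputable def sec (k : X → X → ℝ) [Fact (kernelMatrix k).PosSemidef] (x : X) :
    RKHS.OfKernel (kernelMatrix k) :=
  RKHS.kerFun _ x (1 : ℝ)

theorem inner_sec (f : RKHS.OfKernel (kernelMatrix k)) (x : X) : inner ℝ f (sec k x) = f x := by
  simp [sec]

theorem sec_inner (f : RKHS.OfKernel (kernelMatrix k)) (x : X) : inner ℝ (sec k x) f = f x := by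
  rw [real_inner_comm, inner_sec]

theorem sec_apply (x y : X) : sec k x y = k y x := by
  rw [sec, RKHS.kerFun_apply, RKHS.OfKernel.kernel_ofKernel]
  simp [kernelMatrix]

theorem inner_sec_sec (x y : X) : inner ℝ (sec k x) (sec k y) = k y x := by
  rw [inner_sec, sec_apply]

theorem kernel_symm (k : X → X → ℝ) [Fact (kernelMatrix k).PosSemidef] (x y : X) :
    k x y = k y x := by
  rw [← inner_sec_sec (k := k), real_inner_comm, inner_sec_sec]

theorem abs_apply_le (f : RKHS.OfKernel (kernelMatrix k)) (x : X) :
    |f x| ≤ ‖f‖ * ‖sec k x‖ := by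
  rw [← inner_sec]; exact abs_real_inner_le_norm _ _

theorem abs_apply_sub_le (f : RKHS.OfKernel (kernelMatrix k)) (x y : X) :
    |f x - f y| ≤ ‖f‖ * ‖sec k x - sec k y‖ := by
  rw [← inner_sec, ← inner_sec, ← inner_sub_right]; exact abs_real_inner_le_norm _ _

theorem norm_sec_sub_sq (x y : X) : ‖sec k x - sec k y‖ ^ 2 = k x x - 2 * k x y + k y y := by
  rw [norm_sub_sq_real, ← real_inner_self_eq_norm_sq, ← real_inner_self_eq_norm_sq,
    inner_sec_sec, inner_sec_sec, inner_sec_sec, kernel_symm k y x]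

theorem norm_sec_sq (x : X) : ‖sec k x‖ ^ 2 = k x x := by
  rw [← real_inner_self_eq_norm_sq, inner_sec_sec]

/-- A function orthogonal to every section vanishes at every point. -/
theorem span_sec_dense :
    (Submodule.span ℝ (range (sec k))).topologicalClosure = ⊤ := by
  rw [Submodule.topologicalClosure_eq_top_iff, Submodule.eq_bot_iff]
  intro f hf
  refine RKHS.ext fun x => ?_
  have h := (Submodule.mem_orthogonal _ _).1 hf (sec k x) (Submodule.subset_span ⟨x, rfl⟩)
  rw [sec_inner] at h
  simpa using h

variable [TopologicalSpace X]

theorem continuous_sec (hk : Continuous fun p : X × X => k p.1 p.2) : Continuous (sec k) := by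
  rw [continuous_iff_continuousAt]
  intro x
  rw [ContinuousAt, tendsto_iff_norm_sub_tendsto_zero]
  have h : Tendsto (fun y => k y y - 2 * k y x + k x x) (𝓝 x) (𝓝 (k x x - 2 * k x x + k x x)) := by
    have h1 : Continuous fun y => k y y - 2 * k y x + k x x := by
      have a := hk.comp (continuous_id.prodMk continuous_id : Continuous fun y : X => (y, y))
      have b := hk.comp (continuous_id.prodMk continuous_const : Continuous fun y : X => (y, x))
      exact (a.sub (continuous_const.mul b)).add continuous_const
    exact h1.tendsto x
  have h2 := h.sqrt
  rw [show k x x - 2 * k x x + k x x = 0 by ring, Real.sqrt_zero] at h2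
  refine h2.congr fun y => ?_
  rw [← norm_sec_sub_sq, Real.sqrt_sq (norm_nonneg _)]

theorem continuous_apply (hk : Continuous fun p : X × X => k p.1 p.2)
    (f : RKHS.OfKernel (kernelMatrix k)) : Continuous fun x => f x := by
  simp_rw [← inner_sec]
  exact continuous_const.inner (continuous_sec hk)

variable [CompactSpace X] [MeasurableSpace X] [BorelSpace X] [SecondCountableTopology X]

theorem integrable_of_continuous {F : Type*} [NormedAddCommGroup F] (ρ : Measure X)
    [IsFiniteMeasure ρ] {g : X → F} (hg : Continuous g) : Integrable g ρ := by
  obtain ⟨C, hC⟩ := isCompact_univ.exists_bound_of_continuousOn hg.continuousOn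
  exact Integrable.of_bound hg.aestronglyMeasurable C
    (ae_of_all _ fun x => hC x (mem_univ x))

/-- The element `∫ g(x) k(x, ·) dρ(x)` of the reproducing kernel Hilbert space. -/
noncomputable def kernelMean (k : X → X → ℝ) [Fact (kernelMatrix k).PosSemidef] (ρ : Measure X)
    (g : X → ℝ) : RKHS.OfKernel (kernelMatrix k) :=
  ∫ x, g x • sec k x ∂ρ

theorem inner_kernelMean (hk : Continuous fun p : X × X => k p.1 p.2) (ρ : Measure X)
    [IsFiniteMeasure ρ] {g : X → ℝ} (hg : Continuous g) (f : RKHS.OfKernel (kernelMatrix k)) :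
    inner ℝ f (kernelMean k ρ g) = ∫ x, g x * f x ∂ρ := by
  rw [kernelMean, ← integral_inner
    (show Integrable (fun x => g x • sec k x) ρ from
      integrable_of_continuous ρ (hg.smul (continuous_sec hk)))]
  simp_rw [inner_smul_right, inner_sec]

theorem kernelMean_apply (hk : Continuous fun p : X × X => k p.1 p.2) (ρ : Measure X)
    [IsFiniteMeasure ρ] {g : X → ℝ} (hg : Continuous g) (y : X) :
    kernelMean k ρ g y = ∫ x, k x y * g x ∂ρ := by
  rw [← sec_inner, inner_kernelMean hk ρ hg]
  simp_rw [sec_apply, mul_comm]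

/-- The double integral is the squared norm of the kernel mean of `g`. This positivity of the
integral operator makes Id + K_μ injective. -/
theorem integral_integral_kernel_nonneg (hk : Continuous fun p : X × X => k p.1 p.2)
    (ρ : Measure X) [IsFiniteMeasure ρ] {g : X → ℝ} (hg : Continuous g) :
    0 ≤ ∫ y, g y * ∫ x, k x y * g x ∂ρ ∂ρ := by
  simp_rw [← kernelMean_apply hk ρ hg]
  rw [← inner_kernelMean hk ρ hg]
  exact real_inner_self_nonneg

end Kernel

/-- If `h = b φ` with kernels related by `k'(x, y) b(x) b(y) = k(x, y)`, the norm of `h` in the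
space of `k` is at most that of `φ` in the space of `k'`. -/
theorem norm_le_of_eq_mul {X : Type*} {k k' : X → X → ℝ} [Fact (kernelMatrix k).PosSemidef]
    [Fact (kernelMatrix k').PosSemidef] (b : X → ℝ) (hb : ∀ x y, k x y = b x * b y * k' x y)
    (h : RKHS.OfKernel (kernelMatrix k)) (φ : RKHS.OfKernel (kernelMatrix k'))
    (hφ : ∀ x, h x = b x * φ x) : ‖h‖ ≤ ‖φ‖ := by
  -- Replacing `sec k i` by `b i • sec k' i` preserves Gram matrices and turns pairings with `h`
  -- into pairings with `φ`; density of the span then allows testing `h` against itself.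
  have key : ∀ g ∈ Submodule.span ℝ (range (sec k)), inner ℝ h g ≤ ‖φ‖ * ‖g‖ := by
    intro g hg
    obtain ⟨c, rfl⟩ := (Finsupp.mem_span_range_iff_exists_finsupp).1 hg
    have h1 : inner ℝ h (c.sum fun i a => a • sec k i)
        = inner ℝ φ (c.sum fun i a => a • b i • sec k' i) := by
      simp only [Finsupp.sum, inner_sum, inner_smul_right, inner_sec, hφ]
    have h2 : ‖c.sum fun i a => a • sec k i‖ = ‖c.sum fun i a => a • b i • sec k' i‖ := by
      rw [← sq_eq_sq₀ (norm_nonneg _) (norm_nonneg _), ← real_inner_self_eq_norm_sq,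
        ← real_inner_self_eq_norm_sq]
      simp only [Finsupp.sum, inner_sum, sum_inner, inner_smul_right, inner_smul_left,
        inner_sec_sec, hb, RCLike.conj_to_real]
      refine Finset.sum_congr rfl fun i _ => ?_
      simp only [Finset.mul_sum]
      refine Finset.sum_congr rfl fun j _ => by ring
    rw [h1, h2]
    exact real_inner_le_norm _ _
  have h3 : h ∈ (Submodule.span ℝ (range (sec k))).topologicalClosure := by
    rw [span_sec_dense]; trivial
  have h4 : inner ℝ h h ≤ ‖φ‖ * ‖h‖ := by
    have h5 : closure (Submodule.span ℝ (range (sec k)) : Set (RKHS.OfKernel (kernelMatrix k)))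
        ⊆ {g | inner ℝ h g ≤ ‖φ‖ * ‖g‖} :=
      closure_minimal key (isClosed_le (by fun_prop) (by fun_prop))
    exact h5 h3
  rw [real_inner_self_eq_norm_sq, sq] at h4
  by_contra! hlt
  nlinarith [norm_nonneg φ]

/-! ### Bounded equi-Lipschitz families and a fixed point -/

section LipschitzBall

variable {X : Type*} [PseudoMetricSpace X]

/-- Arzelà–Ascoli. It serves twice: for approximate Schrödinger potentials and for difference
quotients of B(μ), which are bounded in H_c and hence equi-Lipschitz. -/
theorem isCompact_lipschitzBall (M L : ℝ) :
    IsCompact {f : C(X, ℝ) | (∀ x, |f x| ≤ M) ∧ ∀ x y, |f x - f y| ≤ L * dist x y} := by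
  set S := {f : C(X, ℝ) | (∀ x, |f x| ≤ M) ∧ ∀ x y, |f x - f y| ≤ L * dist x y} with hS
  have hL : ∀ x y : X, L * dist x y ≤ max L 0 * dist x y := fun x y =>
    mul_le_mul_of_nonneg_right (le_max_left _ _) dist_nonneg
  have himg : (ContinuousMap.toFun '' S : Set (X → ℝ)) =
      {f : X → ℝ | (∀ x, |f x| ≤ M) ∧ ∀ x y, |f x - f y| ≤ L * dist x y} := by
    ext f
    constructor
    · rintro ⟨g, hg, rfl⟩; exact hg
    · rintro hf
      have hc : LipschitzWith (max L 0).toNNReal f :=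
        LipschitzWith.of_dist_le_mul fun x y => by
          rw [Real.dist_eq, Real.coe_toNNReal _ (le_max_right _ _)]
          exact (hf.2 x y).trans (hL x y)
      exact ⟨⟨f, hc.continuous⟩, hf, rfl⟩
  refine ArzelaAscoli.isCompact_of_equicontinuous S ?_ ?_
  · rw [himg]
    have hcpt : IsCompact (Set.univ.pi fun _ : X => Icc (-M) M) :=
      isCompact_univ_pi fun _ => isCompact_Icc
    refine hcpt.of_isClosed_subset ?_ fun f hf x _ => abs_le.1 (hf.1 x)
    simp only [ofPred_and, ofPred_forall]
    refine IsClosed.inter ?_ ?_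
    · exact isClosed_iInter fun x => isClosed_le (by fun_prop) (by fun_prop)
    · exact isClosed_iInter fun x => isClosed_iInter fun y => isClosed_le (by fun_prop) (by fun_prop)
  · refine Metric.equicontinuous_of_continuity_modulus (fun r => max L 0 * r) ?_ _ ?_
    · have : Continuous fun r : ℝ => max L 0 * r := by fun_prop
      simpa using this.tendsto 0
    · intro x y f
      rw [Real.dist_eq]
      exact (f.2.2 x y).trans (hL x y)

end LipschitzBall

/-! ### Stability of the log-integral-exp functional -/

section LogIntegral

variable {X : Type*} [TopologicalSpace X] [CompactSpace X] [MeasurableSpace X] [BorelSpace X]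
  [SecondCountableTopology X] (μ : Measure X) [IsProbabilityMeasure μ]

theorem integral_exp_pos_of_continuous {g : X → ℝ} (hg : Continuous g) : 0 < ∫ x, Real.exp (g x) ∂μ :=
  MeasureTheory.integral_exp_pos (integrable_of_continuous μ (Real.continuous_exp.comp hg))

/-- The functional is monotone and commutes with adding constants, hence it is 1-Lipschitz for the
supremum norm. -/
theorem log_integral_exp_le {g h : X → ℝ} (hg : Continuous g) (hh : Continuous h) {δ : ℝ}
    (hgh : ∀ x, g x ≤ h x + δ) :
    Real.log (∫ x, Real.exp (g x) ∂μ) ≤ Real.log (∫ x, Real.exp (h x) ∂μ) + δ := by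
  have hp := integral_exp_pos_of_continuous μ hg
  have hp' := integral_exp_pos_of_continuous μ hh
  have h1 : ∫ x, Real.exp (g x) ∂μ ≤ (∫ x, Real.exp (h x) ∂μ) * Real.exp δ := by
    rw [← integral_mul_const]
    refine integral_mono (integrable_of_continuous μ (Real.continuous_exp.comp hg))
      ((integrable_of_continuous μ (Real.continuous_exp.comp hh)).mul_const _) fun x => ?_
    rw [← Real.exp_add]
    exact Real.exp_le_exp.2 (hgh x)
  have h2 := Real.log_le_log hp h1
  rwa [Real.log_mul hp'.ne' (Real.exp_pos _).ne', Real.log_exp] at h2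

theorem abs_log_integral_exp_sub_le {g h : X → ℝ} (hg : Continuous g) (hh : Continuous h) {δ : ℝ}
    (hgh : ∀ x, |g x - h x| ≤ δ) :
    |Real.log (∫ x, Real.exp (g x) ∂μ) - Real.log (∫ x, Real.exp (h x) ∂μ)| ≤ δ := by
  have h1 := log_integral_exp_le μ hg hh (δ := δ) fun x => by linarith [(abs_le.1 (hgh x)).2]
  have h2 := log_integral_exp_le μ hh hg (δ := δ) fun x => by linarith [(abs_le.1 (hgh x)).1]
  rw [abs_le]; constructor <;> linarith

end LogIntegral

section FixedPoint

variable {X : Type*} [MetricSpace X] [CompactSpace X] [MeasurableSpace X] [BorelSpace X]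

/-- A nonlinear equation of Schrödinger type: `β(y) = log ∫ exp (-c(x, y) - β(x)) dμ(x)`
has a continuous solution for a Lipschitz cost. -/
theorem exists_fixedPoint_log_integral_exp (μ : Measure X) [IsProbabilityMeasure μ]
    (c : X → X → ℝ) (hc : ∀ y, Continuous fun x => c x y) (L D : ℝ)
    (hL : ∀ x y y', |c x y - c x y'| ≤ L * dist y y') (hD : ∀ x y, |c x y| ≤ D) :
    ∃ β : C(X, ℝ), ∀ y, β y = Real.log (∫ x, Real.exp (-c x y - β x) ∂μ) := by
  have : Nonempty X := μ.nonempty_of_neZero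
  obtain ⟨x₀⟩ := ‹Nonempty X›
  have hcont : ∀ (β : C(X, ℝ)) y, Continuous fun x => -c x y - β x := fun β y =>
    (hc y).neg.sub β.continuous
  have hLip : ∀ (β : C(X, ℝ)) y y',
      |Real.log (∫ x, Real.exp (-c x y - β x) ∂μ) - Real.log (∫ x, Real.exp (-c x y' - β x) ∂μ)|
        ≤ L * dist y y' := fun β y y' =>
    abs_log_integral_exp_sub_le μ (hcont β y) (hcont β y') fun x => by
      rw [show -c x y - β x - (-c x y' - β x) = -(c x y - c x y') by ring, abs_neg]
      exact hL x y y'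
  have hL0 : ∀ y y' : X, L * dist y y' ≤ max L 0 * dist y y' := fun x y =>
    mul_le_mul_of_nonneg_right (le_max_left _ _) dist_nonneg
  let T : C(X, ℝ) → C(X, ℝ) := fun β =>
    ⟨fun y => Real.log (∫ x, Real.exp (-c x y - β x) ∂μ),
      (LipschitzWith.of_dist_le_mul (K := (max L 0).toNNReal) fun y y' => by
        rw [Real.dist_eq, Real.coe_toNNReal _ (le_max_right _ _)]
        exact (hLip β y y').trans (hL0 y y')).continuous⟩
  have hTapp : ∀ β y, T β y = Real.log (∫ x, Real.exp (-c x y - β x) ∂μ) := fun β y => rfl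
  have hT : ∀ β β', dist (T β) (T β') ≤ dist β β' := by
    intro β β'
    rw [ContinuousMap.dist_le dist_nonneg]
    intro y
    rw [Real.dist_eq]
    refine abs_log_integral_exp_sub_le μ (hcont β y) (hcont β' y) fun x => ?_
    rw [show -c x y - β x - (-c x y - β' x) = -(β x - β' x) by ring, abs_neg, ← Real.dist_eq]
    exact ContinuousMap.dist_apply_le_dist x
  have hTc : Continuous T := (LipschitzWith.of_dist_le_mul (K := 1) (by simpa using hT)).continuous
  set O : ℝ := max L 0 * Metric.diam (univ : Set X) with hO
  have hdiam : ∀ y y' : X, max L 0 * dist y y' ≤ O := fun y y' =>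
    mul_le_mul_of_nonneg_left (Metric.dist_le_diam_of_mem isCompact_univ.isBounded trivial trivial)
      (le_max_right _ _)
  -- `T` is merely nonexpansive. Damping by a factor in [1/2, 1) makes it a contraction, and a limit
  -- of the damped fixed points is a fixed point of `T`.
  have happrox : ∀ n : ℕ, ∃ β : C(X, ℝ), β = (1 - 1 / ((n : ℝ) + 2)) • T β := by
    intro n
    have hn : (0 : ℝ) < n + 2 := by positivity
    have h1 : (1 : ℝ) / (n + 2) ≤ 1 := by rw [div_le_one hn]; linarith [(n : ℕ).cast_nonneg (α := ℝ)]
    have h2 : (0 : ℝ) < 1 / (n + 2) := by positivity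
    have hcon : ContractingWith (1 - 1 / ((n : ℝ) + 2)).toNNReal
        fun β => (1 - 1 / ((n : ℝ) + 2)) • T β := by
      refine ⟨?_, LipschitzWith.of_dist_le_mul fun β β' => ?_⟩
      · rw [Real.toNNReal_lt_one]; linarith
      · rw [Real.coe_toNNReal _ (by linarith), dist_eq_norm, ← smul_sub, norm_smul,
          Real.norm_of_nonneg (by linarith), ← dist_eq_norm]
        exact mul_le_mul_of_nonneg_left (hT β β') (by linarith)
    exact ⟨hcon.fixedPoint, hcon.fixedPoint_isFixedPt.symm⟩
  choose β hβ using happrox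
  have hln : ∀ n : ℕ, 0 ≤ 1 - 1 / ((n : ℝ) + 2) ∧ 1 - 1 / ((n : ℝ) + 2) ≤ 1 := by
    intro n
    have hn : (0 : ℝ) < n + 2 := by positivity
    have h1 : (1 : ℝ) / (n + 2) ≤ 1 := by rw [div_le_one hn]; linarith [(n : ℕ).cast_nonneg (α := ℝ)]
    have h2 : (0 : ℝ) < 1 / (n + 2) := by positivity
    constructor <;> linarith
  have hβy : ∀ n y, β n y = (1 - 1 / ((n : ℝ) + 2)) * T (β n) y := fun n y => by
    conv_lhs => rw [hβ n]
    rfl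
  have hβL : ∀ n y y', |β n y - β n y'| ≤ max L 0 * dist y y' := by
    intro n y y'
    rw [hβy n y, hβy n y', ← mul_sub, abs_mul, abs_of_nonneg (hln n).1]
    calc _ ≤ 1 * |T (β n) y - T (β n) y'| := mul_le_mul_of_nonneg_right (hln n).2 (abs_nonneg _)
      _ ≤ _ := by rw [one_mul]; exact (hLip _ y y').trans (hL0 y y')
  -- Since T(β + a) = Tβ - a, the sum Tβ + β does not see constants and is controlled by the cost
  -- and the oscillation of β alone.
  have hTb : ∀ n y, |T (β n) y + β n y| ≤ D + O := by
    intro n y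
    have h := abs_log_integral_exp_sub_le μ (hcont (β n) y)
      (continuous_const : Continuous fun _ : X => -β n y) (δ := D + O) fun x => by
        rw [show -c x y - β n x - -β n y = -(c x y) + (β n y - β n x) by ring]
        refine (abs_add_le _ _).trans (add_le_add (by rw [abs_neg]; exact hD x y) ?_)
        exact (hβL n y x).trans (hdiam y x)
    simpa [hTapp] using h
  -- `β n` is a nonnegative multiple of `T (β n)`, so the two have the same sign and |β n| ≤ |T (β
  -- n) + β n|.
  have hβM : ∀ n y, |β n y| ≤ D + O := by
    intro n y
    obtain ⟨h0, h1⟩ := hln n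
    have h2 := abs_le.1 (hTb n y)
    have h3 := hβy n y
    set l := 1 - 1 / ((n : ℝ) + 2)
    have hDO : 0 ≤ D + O := (abs_nonneg _).trans (hTb n y)
    rw [abs_le]
    constructor <;> nlinarith
  have hmem : ∀ n, β n ∈ {f : C(X, ℝ) | (∀ x, |f x| ≤ D + O) ∧
      ∀ x y, |f x - f y| ≤ max L 0 * dist x y} := fun n => ⟨hβM n, hβL n⟩
  obtain ⟨b, -, φ, hφ, hb⟩ := (isCompact_lipschitzBall (D + O) (max L 0)).tendsto_subseq hmem
  have hTb' : ∀ n y, |T (β n) y| ≤ 2 * (D + O) := by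
    intro n y
    have h2 := abs_le.1 (hTb n y)
    have h3 := abs_le.1 (hβM n y)
    rw [abs_le]; constructor <;> linarith
  refine ⟨b, fun y => ?_⟩
  rw [← hTapp]
  have e1 : Tendsto (fun n => β (φ n) y) atTop (𝓝 (b y)) :=
    ((continuous_eval_const y).tendsto b).comp hb
  have e2 : Tendsto (fun n => T (β (φ n)) y) atTop (𝓝 (T b y)) :=
    (((continuous_eval_const y).comp hTc).tendsto b).comp hb
  have e3 : Tendsto (fun n : ℕ => 1 - 1 / ((φ n : ℝ) + 2)) atTop (𝓝 (1 - 0)) := by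
    refine Tendsto.const_sub _ ?_
    have h4 : Tendsto (fun n : ℕ => ((φ n : ℕ) : ℝ) + 2) atTop atTop :=
      tendsto_atTop_add_const_right _ _ (tendsto_natCast_atTop_atTop.comp hφ.tendsto_atTop)
    simpa [Pi.inv_def] using h4.inv_tendsto_atTop
  have e4 := e3.mul e2
  rw [sub_zero, one_mul] at e4
  exact tendsto_nhds_unique e1 (e4.congr fun n => (hβy _ _).symm)

end FixedPoint

/-! ### The self-transport potential -/

section Potential

variable {d : ℕ} {K : Set (EuclideanSpace ℝ (Fin d))}

theorem continuous_cost : Continuous fun p : K × K => cost p.1 p.2 := by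
  unfold cost; fun_prop

theorem cost_nonneg (x y : K) : 0 ≤ cost x y := by unfold cost; positivity

theorem cost_comm (x y : K) : cost x y = cost y x := by unfold cost; rw [norm_sub_rev]

theorem cost_self (x : K) : cost x x = 0 := by simp [cost]

theorem cost_eq_dist (x y : K) : cost x y = dist x y ^ 2 := by
  rw [cost, Subtype.dist_eq, dist_eq_norm]

theorem abs_cost_sub_le [CompactSpace K] (x y y' : K) :
    |cost x y - cost x y'| ≤ 2 * Metric.diam (univ : Set K) * dist y y' := by
  have h : ∀ a b : K, dist a b ≤ Metric.diam (univ : Set K) := fun a b =>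
    Metric.dist_le_diam_of_mem isCompact_univ.isBounded trivial trivial
  rw [cost_eq_dist, cost_eq_dist, sq_sub_sq, abs_mul]
  refine mul_le_mul ?_ ?_ (abs_nonneg _)
    (mul_nonneg two_pos.le Metric.diam_nonneg)
  swap
  · rw [dist_comm x y, dist_comm x y']; exact abs_dist_sub_le y y' x
  rw [abs_of_nonneg (by positivity)]
  linarith [h x y, h x y']

theorem continuous_kc (ε : ℝ) : Continuous fun p : K × K => kc ε p.1 p.2 :=
  Real.continuous_exp.comp (continuous_cost.neg.div_const ε)

theorem continuous_kc_left (ε : ℝ) (y : K) : Continuous fun x => kc ε x y := by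
  unfold kc cost; fun_prop

theorem kc_pos (ε : ℝ) (x y : K) : 0 < kc ε x y := Real.exp_pos _

theorem kc_self (ε : ℝ) (x : K) : kc ε x x = 1 := by simp [kc, cost_self]

theorem kc_comm (ε : ℝ) (x y : K) : kc ε x y = kc ε y x := by rw [kc, kc, cost_comm]

theorem continuous_kself (ε : ℝ) (μ : ProbabilityMeasure K) :
    Continuous fun p : K × K => kself ε μ p.1 p.2 := by
  have := continuous_cost (K := K)
  unfold kself
  fun_prop

variable [CompactSpace K] (ε : ℝ) [hε : Fact (0 < ε)]

/-- The substitution f = -εβ reduces to the cost c/ε, which is Lipschitz on a bounded set. Existence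
guarantees that the `Classical.epsilon` in `schrodingerPotential` selects a genuine solution. -/
theorem exists_schrodingerPotential (μ : ProbabilityMeasure K) :
    ∃ f : C(K, ℝ), ∀ y, f y = sinkhornMap ε f μ y := by
  have hc : Continuous fun p : K × K => cost p.1 p.2 := continuous_cost
  obtain ⟨β, hβ⟩ := exists_fixedPoint_log_integral_exp (μ : Measure K)
    (fun x y => cost x y / ε) (fun y => (hc.comp (continuous_id.prodMk continuous_const)).div_const ε)
    (2 * Metric.diam (univ : Set K) / ε) (Metric.diam (univ : Set K) ^ 2 / ε)
    (fun x y y' => by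
      rw [← sub_div, abs_div, abs_of_pos hε.out, div_mul_eq_mul_div]
      exact div_le_div_of_nonneg_right (abs_cost_sub_le x y y') hε.out.le)
    (fun x y => by
      rw [abs_of_nonneg (div_nonneg (cost_nonneg x y) hε.out.le), cost_eq_dist]
      refine div_le_div_of_nonneg_right (pow_le_pow_left₀ dist_nonneg ?_ 2) hε.out.le
      exact Metric.dist_le_diam_of_mem isCompact_univ.isBounded trivial trivial)
  refine ⟨(-ε) • β, fun y => ?_⟩
  have h : ∀ x, ((((-ε) • β : C(K, ℝ)) x - cost x y) / ε) = -(cost x y / ε) - β x := fun x => by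
    have := hε.out.ne'
    simp only [ContinuousMap.smul_apply, smul_eq_mul]
    field_simp
    ring
  simp only [sinkhornMap, h]
  rw [← hβ y]
  simp

/-- The function `b_μ = exp (-f_μ / ε)`. -/
noncomputable def bfun (μ : ProbabilityMeasure K) (y : K) : ℝ :=
  Real.exp (-schrodingerPotential ε μ y / ε)

variable (μ : ProbabilityMeasure K)

omit [CompactSpace K] hε in
theorem bfun_pos (y : K) : 0 < bfun ε μ y := Real.exp_pos _

omit [CompactSpace K] hε in
theorem continuous_bfun : Continuous (bfun ε μ) := by
  unfold bfun; fun_prop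

omit [CompactSpace K] hε in
theorem continuous_inv_bfun : Continuous fun x => (bfun ε μ x)⁻¹ :=
  (continuous_bfun ε μ).inv₀ fun x => (bfun_pos ε μ x).ne'

omit [CompactSpace K] hε in
theorem kself_eq (x y : K) : kself ε μ x y = kc ε x y * (bfun ε μ x)⁻¹ * (bfun ε μ y)⁻¹ := by
  rw [kself, kc, bfun, bfun, ← Real.exp_neg, ← Real.exp_neg, ← Real.exp_add, ← Real.exp_add]
  congr 1; ring

omit [CompactSpace K] hε in
theorem kc_eq (x y : K) : kc ε x y = bfun ε μ x * bfun ε μ y * kself ε μ x y := by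
  have h1 := (bfun_pos ε μ x).ne'
  have h2 := (bfun_pos ε μ y).ne'
  rw [kself_eq]; field_simp

/-- The Schrödinger equation exponentiated: b is the kernel mean of the measure b⁻¹μ. Later
arguments use the potential through this form. -/
theorem bfun_eq_integral (y : K) :
    bfun ε μ y = ∫ x, kc ε x y * (bfun ε μ x)⁻¹ ∂(μ : Measure K) := by
  have h := Classical.epsilon_spec (exists_schrodingerPotential ε μ) y
  change schrodingerPotential ε μ y = sinkhornMap ε (schrodingerPotential ε μ) μ y at h
  have hc : Continuous fun p : K × K => cost p.1 p.2 := continuous_cost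
  have hc' : Continuous fun x : K => (schrodingerPotential ε μ x - cost x y) / ε :=
    ((schrodingerPotential ε μ).continuous.sub
      (hc.comp (continuous_id.prodMk continuous_const))).div_const ε
  have hpos := integral_exp_pos_of_continuous (μ : Measure K) hc'
  rw [bfun, h, sinkhornMap]
  rw [show -(-ε * Real.log (∫ x, Real.exp ((schrodingerPotential ε μ x - cost x y) / ε) ∂(μ : Measure K))) / ε
    = Real.log (∫ x, Real.exp ((schrodingerPotential ε μ x - cost x y) / ε) ∂(μ : Measure K)) by
      have := hε.out.ne'
      field_simp, Real.exp_log hpos]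
  refine integral_congr_ae (ae_of_all _ fun x => ?_)
  simp only [kc, bfun]
  rw [← Real.exp_neg, ← Real.exp_add]
  congr 1; ring

theorem embB_apply (y : K) : embB ε μ y = bfun ε μ y := by
  refine Classical.epsilon_spec (p := fun b : Hc K ε => ∀ y, b y =
    Real.exp (-schrodingerPotential ε μ y / ε)) ⟨kernelMean (kc ε) (μ : Measure K)
      (fun x => (bfun ε μ x)⁻¹), fun y => ?_⟩ y
  rw [kernelMean_apply (continuous_kc ε) _ (continuous_inv_bfun ε μ), ← bfun_eq_integral]
  rfl

theorem embB_eq : embB ε μ = kernelMean (kc ε) (μ : Measure K) (fun x => (bfun ε μ x)⁻¹) := by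
  refine RKHS.ext fun y => ?_
  rw [kernelMean_apply (continuous_kc ε) _ (continuous_inv_bfun ε μ), ← bfun_eq_integral,
    embB_apply]

/-- By the reproducing property ‖b‖² = ⟨b, H_c[b⁻¹μ]⟩ = ∫ b⁻¹ b dμ = 1, so B takes its values in the
unit sphere. -/
theorem norm_embB : ‖embB ε μ‖ = 1 := by
  have h : inner ℝ (embB ε μ) (embB ε μ) = 1 := by
    nth_rewrite 2 [embB_eq]
    rw [inner_kernelMean (continuous_kc ε) _ (continuous_inv_bfun ε μ)]
    simp_rw [embB_apply]
    have : ∀ x, (bfun ε μ x)⁻¹ * bfun ε μ x = 1 := fun x => inv_mul_cancel₀ (bfun_pos ε μ x).ne'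
    simp [this]
  rw [real_inner_self_eq_norm_sq] at h
  exact (pow_eq_one_iff_of_nonneg (norm_nonneg _) two_ne_zero).1 h

theorem integral_kself (y : K) : ∫ x, kself ε μ x y ∂(μ : Measure K) = 1 := by
  simp_rw [kself_eq]
  rw [integral_mul_const, ← bfun_eq_integral, mul_inv_cancel₀ (bfun_pos ε μ y).ne']

/-! ### The operator `K_μ` -/

theorem Kop_eq_kernelMean {φ : K → ℝ} (hφ : Continuous φ) (y : K) :
    kernelMean (kself ε μ) (μ : Measure K) φ y = Kop ε μ φ y :=
  kernelMean_apply (continuous_kself ε μ) _ hφ y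

theorem continuous_Kop {φ : K → ℝ} (hφ : Continuous φ) : Continuous (Kop ε μ φ) := by
  have h : (fun y => kernelMean (kself ε μ) (μ : Measure K) φ y) = Kop ε μ φ :=
    funext fun y => Kop_eq_kernelMean ε μ hφ y
  rw [← h]
  exact continuous_apply (continuous_kself ε μ) _

omit hε in
theorem integrable_kself_mul {φ : K → ℝ} (hφ : Continuous φ) (y : K) :
    Integrable (fun x => kself ε μ x y * φ x) (μ : Measure K) :=
  integrable_of_continuous _ (((continuous_kself ε μ).comp
    (continuous_id.prodMk continuous_const)).mul hφ)

omit hε in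
theorem Kop_sub {φ ψ : K → ℝ} (hφ : Continuous φ) (hψ : Continuous ψ) (y : K) :
    Kop ε μ (fun x => φ x - ψ x) y = Kop ε μ φ y - Kop ε μ ψ y := by
  simp only [Kop, mul_sub]
  exact integral_sub (integrable_kself_mul ε μ hφ y) (integrable_kself_mul ε μ hψ y)

omit hε in
theorem Kop_add {φ ψ : K → ℝ} (hφ : Continuous φ) (hψ : Continuous ψ) (y : K) :
    Kop ε μ (fun x => φ x + ψ x) y = Kop ε μ φ y + Kop ε μ ψ y := by
  simp only [Kop, mul_add]
  exact integral_add (integrable_kself_mul ε μ hφ y) (integrable_kself_mul ε μ hψ y)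

omit [CompactSpace K] hε in
theorem Kop_const_mul (c : ℝ) (φ : K → ℝ) (y : K) :
    Kop ε μ (fun x => c * φ x) y = c * Kop ε μ φ y := by
  simp only [Kop, ← integral_const_mul]
  congr 1; ext x; ring

theorem Kop_const (c : ℝ) (y : K) : Kop ε μ (fun _ => c) y = c := by
  rw [Kop, integral_mul_const, integral_kself, one_mul]

/-- The constant function `1` as an element of `H_μ`. -/
noncomputable def oneSelf : Hself ε μ := kernelMean (kself ε μ) (μ : Measure K) fun _ => 1

theorem oneSelf_apply (y : K) : oneSelf ε μ y = 1 := by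
  rw [oneSelf, Kop_eq_kernelMean ε μ continuous_const, Kop_const]

theorem inner_oneSelf (φ : Hself ε μ) : inner ℝ φ (oneSelf ε μ) = ∫ y, φ y ∂(μ : Measure K) := by
  rw [oneSelf, inner_kernelMean (continuous_kself ε μ) _ continuous_const]
  simp

/-- K_μ is symmetric and fixes constants, so it preserves the μ-mean. -/
theorem integral_Kop {φ : K → ℝ} (hφ : Continuous φ) :
    ∫ y, Kop ε μ φ y ∂(μ : Measure K) = ∫ y, φ y ∂(μ : Measure K) := by
  have h := inner_oneSelf ε μ (kernelMean (kself ε μ) (μ : Measure K) φ)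
  simp_rw [Kop_eq_kernelMean ε μ hφ] at h
  rw [← h, real_inner_comm, inner_kernelMean (continuous_kself ε μ) _ hφ]
  simp [oneSelf_apply]

/-- `K_μ` is a contraction of `L²(μ)`. -/
theorem integral_mul_Kop_le {φ : K → ℝ} (hφ : Continuous φ) :
    ∫ y, φ y * Kop ε μ φ y ∂(μ : Measure K) ≤ ∫ y, φ y ^ 2 ∂(μ : Measure K) := by
  have hKc := continuous_Kop ε μ hφ
  have hsq : Continuous fun y => φ y ^ 2 := hφ.pow 2
  have hKsq := continuous_Kop ε μ hsq
  -- As k_μ(·, y) dμ is a probability measure, this is the nonnegativity of ∫ k_μ(x, y)(φ(x) -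
  -- φ(y))² dμ(x).
  have h1 : ∀ y, φ y * Kop ε μ φ y ≤ (φ y ^ 2 + Kop ε μ (fun x => φ x ^ 2) y) / 2 := by
    intro y
    have h2 : ∫ x, kself ε μ x y * (φ x - φ y) ^ 2 ∂(μ : Measure K) =
        Kop ε μ (fun x => φ x ^ 2) y - 2 * φ y * Kop ε μ φ y + φ y ^ 2 := by
      rw [show φ y ^ 2 = Kop ε μ (fun _ => φ y ^ 2) y from (Kop_const ε μ _ y).symm,
        ← Kop_const_mul, ← Kop_sub ε μ hsq (by fun_prop), ← Kop_add ε μ (by fun_prop) (by fun_prop)]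
      rw [Kop]
      congr 1; ext x; ring
    have h3 : 0 ≤ ∫ x, kself ε μ x y * (φ x - φ y) ^ 2 ∂(μ : Measure K) :=
      integral_nonneg fun x => mul_nonneg (Real.exp_pos _).le (sq_nonneg _)
    linarith
  calc ∫ y, φ y * Kop ε μ φ y ∂(μ : Measure K)
      ≤ ∫ y, (φ y ^ 2 + Kop ε μ (fun x => φ x ^ 2) y) / 2 ∂(μ : Measure K) :=
        integral_mono (integrable_of_continuous _ (hφ.mul hKc))
          (integrable_of_continuous _ ((hsq.add hKsq).div_const 2)) h1
    _ = ∫ y, φ y ^ 2 ∂(μ : Measure K) := by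
        rw [integral_div, integral_add (integrable_of_continuous _ hsq)
          (integrable_of_continuous _ hKsq), integral_Kop ε μ hsq]
        ring

/-- `Id + K_μ` is injective on continuous functions. -/
theorem eq_zero_of_add_Kop_eq_zero {φ : K → ℝ} (hφ : Continuous φ)
    (h : ∀ y, φ y + Kop ε μ φ y = 0) (y : K) : φ y = 0 := by
  have hKc := continuous_Kop ε μ hφ
  have h1 : ∫ y, φ y ^ 2 ∂(μ : Measure K) = 0 := by
    have h2 : ∫ y, φ y * Kop ε μ φ y ∂(μ : Measure K) = -∫ y, φ y ^ 2 ∂(μ : Measure K) := by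
      rw [← integral_neg]
      refine integral_congr_ae (ae_of_all _ fun y => ?_)
      simp only
      rw [show Kop ε μ φ y = -φ y by linarith [h y]]; ring
    have h3 : 0 ≤ ∫ y, φ y * Kop ε μ φ y ∂(μ : Measure K) :=
      integral_integral_kernel_nonneg (continuous_kself ε μ) (μ : Measure K) hφ
    have h4 : 0 ≤ ∫ y, φ y ^ 2 ∂(μ : Measure K) := integral_nonneg fun y => sq_nonneg _
    linarith
  have h2 : ∀ᵐ y ∂(μ : Measure K), φ y ^ 2 = 0 := by
    have := (integral_eq_zero_iff_of_nonneg (fun y => sq_nonneg (φ y))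
      (integrable_of_continuous (μ : Measure K) (hφ.pow 2))).1 h1
    exact this
  -- So far `φ` vanishes only μ-a.e.; K_μ sees no more than that, and the equation φ = -K_μ φ
  -- extends the vanishing to every point.
  have h3 : Kop ε μ φ y = 0 := by
    rw [Kop]
    refine integral_eq_zero_of_ae ?_
    filter_upwards [h2] with x hx
    simp [pow_eq_zero_iff] at hx
    simp [hx]
  linarith [h y]

end Potential

/-! ### Universality of the Gaussian kernel on a compact convex set -/

section Universality

theorem exp_continuousMap_apply {X : Type*} [TopologicalSpace X] [CompactSpace X] (f : C(X, ℝ))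
    (x : X) : NormedSpace.exp f x = Real.exp (f x) := by
  rw [NormedSpace.exp_continuousMap_eq, Real.exp_eq_exp_ℝ]
  rfl

/-- A closed subspace of `C(X)` that contains `exp (u + s v)` for `s ∈ [0, 1]` contains
it for all real `s`. -/
theorem exp_add_smul_mem {X : Type*} [TopologicalSpace X] [CompactSpace X]
    (M : Submodule ℝ C(X, ℝ)) (hM : IsClosed (M : Set C(X, ℝ))) (u v : C(X, ℝ))
    (h : ∀ s ∈ Icc (0 : ℝ) 1, NormedSpace.exp (u + s • v) ∈ M) (s : ℝ) :
    NormedSpace.exp (u + s • v) ∈ M := by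
  by_contra hs
  obtain ⟨l, c, hl1, hl2⟩ := geometric_hahn_banach_closed_point M.convex hM hs
  have hlM : ∀ f ∈ M, l f = 0 := by
    intro f hf
    by_contra hne
    have h1 := hl1 _ (M.smul_mem ((c + 1) / l f) hf)
    rw [map_smul, smul_eq_mul, div_mul_cancel₀ _ hne] at h1
    linarith
  have hl3 : 0 < c := by simpa using hl1 0 M.zero_mem
  -- The separating functional kills `M`, so this real-analytic function vanishes near 1/2 and
  -- therefore everywhere, including at the excluded `s`.
  have hF : AnalyticOnNhd ℝ (fun r : ℝ => l (NormedSpace.exp (u + r • v))) univ := by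
    intro r _
    have h1 : AnalyticAt ℝ (fun r : ℝ => u + r • v) r :=
      analyticAt_const.add (analyticAt_id.smul analyticAt_const)
    exact (l.analyticAt _).comp
      (AnalyticAt.fun_comp (NormedSpace.exp_analytic (𝕂 := ℝ) (u + r • v)) h1)
  have h2 := hF.eqOn_zero_of_preconnected_of_eventuallyEq_zero isPreconnected_univ
    (mem_univ (1 / 2 : ℝ)) (by
      filter_upwards [Icc_mem_nhds (show (0 : ℝ) < 1 / 2 by norm_num)
        (show (1 / 2 : ℝ) < 1 by norm_num)] with r hr
      exact hlM _ (h r hr))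
  have h3 : l (NormedSpace.exp (u + s • v)) = 0 := h2 (mem_univ s)
  linarith

variable {E : Type*} [NormedAddCommGroup E] [InnerProductSpace ℝ E] {K : Set E}

/-- The linear function `x ↦ ⟨y, x⟩` on `K`. -/
def linC (K : Set E) (y : E) : C(K, ℝ) := ⟨fun x => inner ℝ y (x : E), by fun_prop⟩

theorem linC_add (y z : E) : linC K (y + z) = linC K y + linC K z := by
  ext x; simp [linC, inner_add_left]

theorem linC_smul (s : ℝ) (y : E) : linC K (s • y) = s • linC K y := by
  ext x; simp [linC, inner_smul_left]

/-- Stone–Weierstrass needs an algebra, but exponents restricted to `K` are not closed under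
addition. Analytic continuation along segments enlarges the admissible exponents to x₀ plus all
differences of elements of the cone over K - x₀; no interior point of `K` is required. -/
theorem eq_top_of_exp_linC_mem [CompactSpace K] (hconv : Convex ℝ K) (hne : K.Nonempty) {α : ℝ}
    (hα : α ≠ 0) (M : Submodule ℝ C(K, ℝ)) (hM : IsClosed (M : Set C(K, ℝ)))
    (h : ∀ y ∈ K, NormedSpace.exp (α • linC K y) ∈ M) : M = ⊤ := by
  obtain ⟨x₀, hx₀⟩ := hne
  have hline : ∀ p q : E, (∀ s ∈ Icc (0 : ℝ) 1,
      NormedSpace.exp (α • linC K (p + s • q)) ∈ M) → ∀ s : ℝ,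
      NormedSpace.exp (α • linC K (p + s • q)) ∈ M := by
    intro p q hpq s
    have e : ∀ s : ℝ, α • linC K (p + s • q) = α • linC K p + s • (α • linC K q) := fun s => by
      rw [linC_add, linC_smul, smul_add, smul_comm]
    rw [e]
    exact exp_add_smul_mem M hM _ _ (fun r hr => by rw [← e]; exact hpq r hr) s
  have hray : ∀ y ∈ K, ∀ s : ℝ, NormedSpace.exp (α • linC K (x₀ + s • (y - x₀))) ∈ M := by
    intro y hy
    refine hline x₀ (y - x₀) fun s hs => h _ ?_
    have := hconv hx₀ hy (sub_nonneg.2 hs.2) hs.1 (by ring)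
    convert this using 1
    module
  set C : Set E := {p | ∃ s : ℝ, 0 ≤ s ∧ ∃ y ∈ K, p = s • (y - x₀)} with hC
  have hCadd : ∀ p ∈ C, ∀ q ∈ C, p + q ∈ C := by
    rintro p ⟨s, hs, y, hy, rfl⟩ q ⟨r, hr, z, hz, rfl⟩
    rcases (add_nonneg hs hr).eq_or_lt with h0 | h0
    · refine ⟨0, le_rfl, x₀, hx₀, ?_⟩
      have h1 : s = 0 := by linarith
      have h2 : r = 0 := by linarith
      simp [h1, h2]
    · refine ⟨s + r, h0.le, (s / (s + r)) • y + (r / (s + r)) • z,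
        hconv hy hz (by positivity) (by positivity) (by field_simp), ?_⟩
      have e1 : s = (s + r) * (s / (s + r)) := by field_simp
      have e2 : r = (s + r) * (r / (s + r)) := by field_simp
      have e3 : (s + r) * (s / (s + r)) + (s + r) * (r / (s + r)) = s + r := by rw [← e1, ← e2]
      calc s • (y - x₀) + r • (z - x₀) = s • y + r • z - (s + r) • x₀ := by module
        _ = ((s + r) * (s / (s + r))) • y + ((s + r) * (r / (s + r))) • z - (s + r) • x₀ := by
          rw [← e1, ← e2]
        _ = _ := by module
  have hCsmul : ∀ p ∈ C, ∀ r : ℝ, 0 ≤ r → r • p ∈ C := by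
    rintro p ⟨s, hs, y, hy, rfl⟩ r hr
    exact ⟨r * s, mul_nonneg hr hs, y, hy, by rw [smul_smul]⟩
  have hCM : ∀ p ∈ C, NormedSpace.exp (α • linC K (x₀ + p)) ∈ M := by
    rintro p ⟨s, -, y, hy, rfl⟩; exact hray y hy s
  have hdiff : ∀ p ∈ C, ∀ q ∈ C, NormedSpace.exp (α • linC K (x₀ + (p - q))) ∈ M := by
    intro p hp q hq
    -- For s in [0, 1] the exponent is x₀ + (1 - s)q + (s/2)p, which stays in the translated cone;
    -- continuation to s = 2 gives x₀ + p - q.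
    have h1 := hline (x₀ + q) ((1 / 2 : ℝ) • p - q) (fun s hs => ?_) 2
    · convert h1 using 4; module
    · have h2 := hCM _ (hCadd _ (hCsmul q hq (1 - s) (sub_nonneg.2 hs.2)) _
        (hCsmul p hp (s * (1 / 2)) (mul_nonneg hs.1 (by norm_num))))
      convert h2 using 4; module
  set S : Set C(K, ℝ) := {f | ∃ p ∈ C, ∃ q ∈ C, f = NormedSpace.exp (α • linC K (p - q))} with hS
  have h0C : (0 : E) ∈ C := ⟨0, le_rfl, x₀, hx₀, by simp⟩
  have hmul : ∀ f ∈ Submonoid.closure S, f ∈ S := by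
    intro f hf
    induction hf using Submonoid.closure_induction with
    | mem f hf => exact hf
    | one =>
      refine ⟨0, h0C, 0, h0C, ?_⟩
      ext x; simp [exp_continuousMap_apply, linC]
    | mul f g _ _ hf hg =>
      obtain ⟨p, hp, q, hq, rfl⟩ := hf
      obtain ⟨p', hp', q', hq', rfl⟩ := hg
      refine ⟨p + p', hCadd _ hp _ hp', q + q', hCadd _ hq _ hq', ?_⟩
      ext x
      simp only [ContinuousMap.mul_apply, exp_continuousMap_apply, ContinuousMap.smul_apply,
        ← Real.exp_add, linC, ContinuousMap.coe_mk, inner_add_left, inner_sub_left, smul_eq_mul]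
      congr 1; ring
  -- Dividing by this positive weight removes the shift by x₀, leaving the multiplicatively closed
  -- set `S`, whose generated algebra is its linear span.
  set w : C(K, ℝ) := NormedSpace.exp (α • linC K x₀) with hw
  set M' : Submodule ℝ C(K, ℝ) := M.comap (LinearMap.mulLeft ℝ w) with hM'
  have hM'c : IsClosed (M' : Set C(K, ℝ)) :=
    hM.preimage (show Continuous fun f : C(K, ℝ) => w * f by fun_prop)
  have hA : (Subalgebra.toSubmodule (Algebra.adjoin ℝ S)) ≤ M' := by
    rw [Algebra.adjoin_eq_span, Submodule.span_le]
    intro f hf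
    obtain ⟨p, hp, q, hq, rfl⟩ := hmul f hf
    change w * _ ∈ M
    convert hdiff p hp q hq using 1
    ext x
    simp only [hw, ContinuousMap.mul_apply, exp_continuousMap_apply, ContinuousMap.smul_apply,
      ← Real.exp_add, linC_add, ContinuousMap.add_apply, smul_add]
  have hsep : (Algebra.adjoin ℝ S).SeparatesPoints := by
    intro x y hxy
    refine ⟨_, ⟨NormedSpace.exp (α • linC K ((x : E) - y)), Algebra.subset_adjoin
      ⟨(x : E) - x₀, ⟨1, zero_le_one, x, x.2, by simp⟩, (y : E) - x₀,
        ⟨1, zero_le_one, y, y.2, by simp⟩, by simp⟩, rfl⟩, ?_⟩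
    simp only [exp_continuousMap_apply]
    intro he
    have he' := Real.exp_injective he
    simp only [ContinuousMap.smul_apply, linC, ContinuousMap.coe_mk, smul_eq_mul] at he'
    have he'' := mul_left_cancel₀ hα he'
    rw [← sub_eq_zero, ← inner_sub_right, inner_self_eq_zero, sub_eq_zero] at he''
    exact hxy (Subtype.ext he'')
  have htop := ContinuousMap.subalgebra_topologicalClosure_eq_top_of_separatesPoints _ hsep
  have hM'top : ∀ f : C(K, ℝ), f ∈ M' := by
    intro f
    have h1 : f ∈ (Algebra.adjoin ℝ S).topologicalClosure := by rw [htop]; trivial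
    exact closure_minimal (s := (Algebra.adjoin ℝ S : Set C(K, ℝ))) hA hM'c h1
  rw [eq_top_iff]
  intro f _
  have h1 := hM'top (NormedSpace.exp (-(α • linC K x₀)) * f)
  change w * (_ * f) ∈ M at h1
  convert h1 using 1
  ext x
  simp only [hw, ContinuousMap.mul_apply, exp_continuousMap_apply, ContinuousMap.neg_apply]
  rw [← mul_assoc, ← Real.exp_add, add_neg_cancel, Real.exp_zero, one_mul]

end Universality

/-! ### Weak convergence tested on Gaussian kernels -/

section WeakConvergence

variable {d : ℕ} {K : Set (EuclideanSpace ℝ (Fin d))} [CompactSpace K]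

/-- The set of continuous functions along which probability measures converge is closed. -/
theorem isClosed_tendsto_integral {X ι : Type*} [TopologicalSpace X] [CompactSpace X]
    [MeasurableSpace X] [BorelSpace X] [SecondCountableTopology X] (F : Filter ι)
    (μ : ι → ProbabilityMeasure X) (μ₀ : ProbabilityMeasure X) :
    IsClosed {f : C(X, ℝ) | Tendsto (fun s => ∫ x, f x ∂(μ s : Measure X)) F
      (𝓝 (∫ x, f x ∂(μ₀ : Measure X)))} := by
  have hb : ∀ (ν : ProbabilityMeasure X) (f g : C(X, ℝ)),
      |∫ x, f x ∂(ν : Measure X) - ∫ x, g x ∂(ν : Measure X)| ≤ ‖f - g‖ := by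
    intro ν f g
    rw [← integral_sub (integrable_of_continuous _ f.continuous)
      (integrable_of_continuous _ g.continuous)]
    have := norm_integral_le_of_norm_le_const (μ := (ν : Measure X)) (f := fun x => f x - g x)
      (C := ‖f - g‖) (ae_of_all _ fun x => ContinuousMap.norm_coe_le_norm (f - g) x)
    simpa using this
  refine isClosed_of_closure_subset fun f hf => ?_
  rw [mem_ofPred_eq, Metric.tendsto_nhds]
  intro δ hδ
  obtain ⟨g, hg, hfg⟩ := Metric.mem_closure_iff.1 hf (δ / 3) (by positivity)
  rw [dist_eq_norm] at hfg
  filter_upwards [Metric.tendsto_nhds.1 hg (δ / 3) (by positivity)] with s hs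
  rw [Real.dist_eq] at hs ⊢
  have h1 := hb (μ s) f g
  have h2 := hb μ₀ f g
  rw [abs_le] at h1 h2
  rw [abs_lt] at hs ⊢
  constructor <;> linarith

/-- Convergence of the integrals of the (weighted) kernel sections implies weak convergence. -/
theorem tendsto_integral_of_tendsto_integral_kc (hconv : Convex ℝ K) (hne : K.Nonempty) {ε : ℝ}
    (hε : 0 < ε) {ι : Type*} (F : Filter ι) (μ : ι → ProbabilityMeasure K)
    (μ₀ : ProbabilityMeasure K) (g : K → ℝ) (hg : Continuous g) (hg0 : ∀ x, g x ≠ 0)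
    (h : ∀ y, Tendsto (fun s => ∫ x, kc ε x y * g x ∂(μ s : Measure K)) F
      (𝓝 (∫ x, kc ε x y * g x ∂(μ₀ : Measure K)))) {f : K → ℝ} (hf : Continuous f) :
    Tendsto (fun s => ∫ x, f x ∂(μ s : Measure K)) F (𝓝 (∫ x, f x ∂(μ₀ : Measure K))) := by
  -- With this nonvanishing weight, w(x) exp((2/ε)⟨y, x⟩) is a constant multiple of k_c(x, y) g(x),
  -- so universality of exponentials applies.
  set w : C(K, ℝ) := ⟨fun x => g x * Real.exp (-‖(x : EuclideanSpace ℝ (Fin d))‖ ^ 2 / ε),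
    by fun_prop⟩ with hw
  let N : Submodule ℝ C(K, ℝ) :=
    { carrier := {f : C(K, ℝ) | Tendsto (fun s => ∫ x, f x ∂(μ s : Measure K)) F
        (𝓝 (∫ x, f x ∂(μ₀ : Measure K)))}
      add_mem' := fun {a b} ha hb => by
        simp only [mem_ofPred_eq, ContinuousMap.add_apply] at ha hb ⊢
        have e : ∀ ν : ProbabilityMeasure K, ∫ x, (a x + b x) ∂(ν : Measure K) =
            ∫ x, a x ∂(ν : Measure K) + ∫ x, b x ∂(ν : Measure K) := fun ν =>
          integral_add (integrable_of_continuous _ a.continuous)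
            (integrable_of_continuous _ b.continuous)
        simp_rw [e]
        exact ha.add hb
      zero_mem' := by simpa using tendsto_const_nhds
      smul_mem' := fun c a ha => by
        simp only [mem_ofPred_eq, ContinuousMap.smul_apply, smul_eq_mul,
          integral_const_mul] at ha ⊢
        exact ha.const_mul c }
  have hNc : IsClosed (N : Set C(K, ℝ)) := isClosed_tendsto_integral F μ μ₀
  set M : Submodule ℝ C(K, ℝ) := N.comap (LinearMap.mulLeft ℝ w) with hM
  have hMc : IsClosed (M : Set C(K, ℝ)) :=
    hNc.preimage (show Continuous fun f : C(K, ℝ) => w * f by fun_prop)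
  have hMtop := eq_top_of_exp_linC_mem hconv hne (α := 2 / ε) (by positivity) M hMc (fun y hy => by
    change Tendsto _ _ _
    have h1 := (h ⟨y, hy⟩).const_mul (Real.exp (‖y‖ ^ 2 / ε))
    have e : ∀ x : K, (w * NormedSpace.exp ((2 / ε) • linC K y)) x =
        Real.exp (‖y‖ ^ 2 / ε) * (kc ε x ⟨y, hy⟩ * g x) := by
      intro x
      simp only [hw, ContinuousMap.mul_apply, ContinuousMap.coe_mk, exp_continuousMap_apply,
        ContinuousMap.smul_apply, linC, kc, cost, smul_eq_mul]
      rw [mul_assoc, ← Real.exp_add, mul_comm, ← mul_assoc, ← Real.exp_add]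
      congr 2
      rw [norm_sub_sq_real, real_inner_comm]
      ring
    simp only [LinearMap.mulLeft_apply, e, integral_const_mul]
    exact h1)
  have h2 : (⟨fun x => (w x)⁻¹ * f x, (w.continuous.inv₀ fun x =>
      mul_ne_zero (hg0 x) (Real.exp_pos _).ne').mul hf⟩ : C(K, ℝ)) ∈ M := by
    rw [hMtop]; trivial
  change Tendsto _ _ _ at h2
  have e : ∀ x : K, w x * ((w x)⁻¹ * f x) = f x := fun x => by
    rw [← mul_assoc, mul_inv_cancel₀ (show w x ≠ 0 from
      mul_ne_zero (hg0 x) (Real.exp_pos _).ne'), one_mul]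
  simpa [e] using h2

end WeakConvergence

/-! ### Velocities and derivatives of the embedding -/

section Velocity

variable {d : ℕ} {K : Set (EuclideanSpace ℝ (Fin d))} [CompactSpace K] (ε : ℝ) [hε : Fact (0 < ε)]

/-- An element of `H_c` as a continuous function. -/
noncomputable def toC (h : Hc K ε) : C(K, ℝ) := ⟨fun y => h y, continuous_apply (continuous_kc ε) h⟩

omit [CompactSpace K] in
theorem toC_apply (h : Hc K ε) (y : K) : toC ε h y = h y := rfl

omit [CompactSpace K] in
theorem norm_sec_kc (x : K) : ‖sec (kc ε) x‖ = 1 := by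
  have h := norm_sec_sq (k := kc ε) x
  rw [kc_self] at h
  exact (pow_eq_one_iff_of_nonneg (norm_nonneg _) two_ne_zero).1 h

omit [CompactSpace K] in
theorem abs_Hc_apply_le (h : Hc K ε) (y : K) : |h y| ≤ ‖h‖ := by
  have := abs_apply_le h y
  rwa [norm_sec_kc, mul_one] at this

theorem norm_toC_le (h : Hc K ε) : ‖toC ε h‖ ≤ ‖h‖ :=
  (ContinuousMap.norm_le _ (norm_nonneg _)).2 fun y => abs_Hc_apply_le ε h y

omit [CompactSpace K] in
theorem toC_sub (h h' : Hc K ε) : toC ε (h - h') = toC ε h - toC ε h' := by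
  ext y; simp [toC]

-- The squared distance is 2(1 - exp(-c/ε)), at most 2c/ε. This gives both the Lipschitz embedding
-- of points and a common Lipschitz bound on balls of H_c.
omit [CompactSpace K] in
theorem norm_sec_kc_sub_le (x y : K) :
    ‖sec (kc ε) x - sec (kc ε) y‖ ≤ Real.sqrt (2 / ε) * dist x y := by
  have h : ‖sec (kc ε) x - sec (kc ε) y‖ ^ 2 ≤ (Real.sqrt (2 / ε) * dist x y) ^ 2 := by
    rw [norm_sec_sub_sq, kc_self, kc_self, mul_pow, Real.sq_sqrt (by have := hε.out; positivity), kc,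
      ← cost_eq_dist]
    have h1 := Real.add_one_le_exp (-cost x y / ε)
    have h2 : 2 / ε * cost x y = -2 * (-cost x y / ε) := by ring
    rw [h2]
    linarith
  exact le_of_sq_le_sq h (by positivity)

omit [CompactSpace K] in
theorem abs_Hc_apply_sub_le (h : Hc K ε) (x y : K) :
    |h x - h y| ≤ ‖h‖ * Real.sqrt (2 / ε) * dist x y := by
  rw [mul_assoc]
  exact (abs_apply_sub_le h x y).trans
    (mul_le_mul_of_nonneg_left (norm_sec_kc_sub_le ε x y) (norm_nonneg _))

theorem bfun_le_one (μ : ProbabilityMeasure K) (y : K) : bfun ε μ y ≤ 1 := by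
  rw [← embB_apply, ← norm_embB ε μ]
  exact (le_abs_self _).trans (abs_Hc_apply_le ε _ y)

/-- From b ≤ 1 follows b⁻¹ ≥ 1, and then b = H_c[b⁻¹μ] is at least the minimum of k_c. The bound is
uniform in μ, as needed when μ varies in time. -/
theorem exists_le_bfun : ∃ κ : ℝ, 0 < κ ∧ ∀ (μ : ProbabilityMeasure K) (y : K), κ ≤ bfun ε μ y := by
  refine ⟨Real.exp (-Metric.diam (univ : Set K) ^ 2 / ε), Real.exp_pos _, fun μ y => ?_⟩
  have hk : ∀ x, Real.exp (-Metric.diam (univ : Set K) ^ 2 / ε) ≤ kc ε x y * (bfun ε μ x)⁻¹ := by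
    intro x
    have h1 : Real.exp (-Metric.diam (univ : Set K) ^ 2 / ε) ≤ kc ε x y := by
      refine Real.exp_le_exp.2 (div_le_div_of_nonneg_right (neg_le_neg ?_) hε.out.le)
      rw [cost_eq_dist]
      exact pow_le_pow_left₀ dist_nonneg
        (Metric.dist_le_diam_of_mem isCompact_univ.isBounded trivial trivial) 2
    have h2 : 1 ≤ (bfun ε μ x)⁻¹ := (one_le_inv₀ (bfun_pos ε μ x)).2 (bfun_le_one ε μ x)
    calc _ ≤ kc ε x y * 1 := by rwa [mul_one]
      _ ≤ _ := mul_le_mul_of_nonneg_left h2 (kc_pos ε x y).le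
  rw [bfun_eq_integral]
  calc _ = ∫ _, Real.exp (-Metric.diam (univ : Set K) ^ 2 / ε) ∂(μ : Measure K) := by simp
    _ ≤ _ := integral_mono (integrable_const _) (integrable_of_continuous _
        ((continuous_kc_left ε y).mul (continuous_inv_bfun ε μ))) hk

variable {ε}

omit [CompactSpace K] in
theorem riesz_apply {μ : ProbabilityMeasure K} (σ : StrongDual ℝ (Hself ε μ)) (y : K) :
    riesz ε σ y = σ (sec (kself ε μ) y) := by
  rw [← inner_sec, riesz, InnerProductSpace.toDual_symm_apply]

/-- At a time at which the curve `μ` has a velocity `σ`, the curve is weakly continuous. -/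
theorem IsVelocity.tendsto_integral (hconv : Convex ℝ K) {I : Set ℝ}
    {μ : ℝ → ProbabilityMeasure K} {t : ℝ} {σ : StrongDual ℝ (Hself ε (μ t))}
    (hσ : IsVelocity ε I μ t σ) {f : K → ℝ} (hf : Continuous f) :
    Tendsto (fun s => ∫ x, f x ∂(μ s : Measure K)) (𝓝[I] t) (𝓝 (∫ x, f x ∂(μ t : Measure K))) := by
  have hne : K.Nonempty := nonempty_coe_sort.1 (μ t : Measure K).nonempty_of_neZero
  refine tendsto_integral_of_tendsto_integral_kc hconv hne hε.out _ μ (μ t)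
    (fun x => (bfun ε (μ t) x)⁻¹) (continuous_inv_bfun ε (μ t))
    (fun x => inv_ne_zero (bfun_pos ε (μ t) x).ne') (fun y => ?_) hf
  have h := (hσ.2 (sec (kself ε (μ t)) y)).continuousWithinAt.tendsto.const_mul (bfun ε (μ t) y)
  have e : ∀ x, kc ε x y * (bfun ε (μ t) x)⁻¹ = bfun ε (μ t) y * sec (kself ε (μ t)) y x := by
    intro x
    have := (bfun_pos ε (μ t) y).ne'
    rw [sec_apply, kself_eq]
    field_simp
  simpa only [e, integral_const_mul] using h

/-- Subtracting b_ν = H_c[b_ν⁻¹ν] from H_c[b_μ⁻¹ν] gives an exact finite-difference form of (Id +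
K_μ)[ḃ/b] = H_μ[μ̇]. No linearization error has to be estimated. -/
theorem integral_kself_sub_one (μ ν : ProbabilityMeasure K) (y : K) :
    ∫ x, kself ε μ x y ∂(ν : Measure K) - 1 = (embB ε ν y - embB ε μ y) / bfun ε μ y +
      (bfun ε μ y)⁻¹ * ∫ x, kc ε x y * ((embB ε ν x - embB ε μ x) * (bfun ε μ x)⁻¹ *
        (bfun ε ν x)⁻¹) ∂(ν : Measure K) := by
  have hkc : Continuous fun x => kc ε x y := continuous_kc_left ε y
  have e1 : ∀ x, kc ε x y * ((embB ε ν x - embB ε μ x) * (bfun ε μ x)⁻¹ * (bfun ε ν x)⁻¹) =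
      kc ε x y * (bfun ε μ x)⁻¹ - kc ε x y * (bfun ε ν x)⁻¹ := by
    intro x
    have h1 := (bfun_pos ε μ x).ne'
    have h2 := (bfun_pos ε ν x).ne'
    rw [embB_apply, embB_apply]
    field_simp
  simp_rw [e1]
  have c1 : Continuous fun x => kc ε x y * (bfun ε μ x)⁻¹ := hkc.mul (continuous_inv_bfun ε μ)
  have c2 : Continuous fun x => kc ε x y * (bfun ε ν x)⁻¹ := hkc.mul (continuous_inv_bfun ε ν)
  rw [integral_sub (integrable_of_continuous _ c1) (integrable_of_continuous _ c2),
    ← bfun_eq_integral]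
  simp_rw [kself_eq]
  rw [integral_mul_const, embB_apply, embB_apply]
  have h1 := (bfun_pos ε μ y).ne'
  field_simp
  ring

/-- If `w` is a limit of difference quotients of `B(μ)` at a time where `μ` has velocity
`σ`, then `(Id + K_μ)[w / b] = H_μ[σ]`. -/
theorem IsVelocity.add_Kop_eq_riesz (hconv : Convex ℝ K) {I : Set ℝ}
    {μ : ℝ → ProbabilityMeasure K} {t : ℝ} {σ : StrongDual ℝ (Hself ε (μ t))}
    (hσ : IsVelocity ε I μ t σ) {F : Filter ℝ} [NeBot F] (hF : F ≤ 𝓝[I \ {t}] t)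
    (hb : Tendsto (fun s => embB ε (μ s)) F (𝓝 (embB ε (μ t)))) (w : C(K, ℝ))
    (hw : Tendsto (fun s => toC ε ((s - t)⁻¹ • (embB ε (μ s) - embB ε (μ t)))) F (𝓝 w)) (y : K) :
    w y / bfun ε (μ t) y + Kop ε (μ t) (fun x => w x / bfun ε (μ t) x) y = riesz ε σ y := by
  set b := bfun ε (μ t) with hbdef
  have hbpos : ∀ x, 0 < b x := bfun_pos ε (μ t)
  obtain ⟨κ, hκ, hκb⟩ := exists_le_bfun (K := K) ε
  set D : ℝ → C(K, ℝ) := fun s => toC ε ((s - t)⁻¹ • (embB ε (μ s) - embB ε (μ t))) with hD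
  have hDx : ∀ s x, D s x = (s - t)⁻¹ * (embB ε (μ s) x - embB ε (μ t) x) := fun s x => by
    simp [hD, toC_apply]
  have hkc : Continuous fun x => kc ε x y := continuous_kc_left ε y
  have hbinv : Continuous fun x => (b x)⁻¹ := continuous_inv_bfun ε (μ t)
  have hkc1 : ∀ x, kc ε x y ≤ 1 := fun x =>
    Real.exp_le_one_iff.2 (div_nonpos_of_nonpos_of_nonneg (neg_nonpos.2 (cost_nonneg x y)) hε.out.le)
  have h1 : Tendsto (fun s => (s - t)⁻¹ * (∫ x, kself ε (μ t) x y ∂(μ s : Measure K) - 1)) F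
      (𝓝 (riesz ε σ y)) := by
    have h2 := (hasDerivWithinAt_iff_tendsto_slope.1 (hσ.2 (sec (kself ε (μ t)) y))).mono_left hF
    rw [riesz_apply]
    refine h2.congr fun s => ?_
    simp only [slope, vsub_eq_sub, smul_eq_mul, sec_apply, integral_kself]
  have h2 : Tendsto (fun s => ∫ x, kc ε x y * (D s x * (b x)⁻¹ * (bfun ε (μ s) x)⁻¹)
      ∂(μ s : Measure K)) F (𝓝 (∫ x, kc ε x y * (w x * (b x)⁻¹ * (b x)⁻¹) ∂(μ t : Measure K))) := by
    have c2 : Continuous fun x => kc ε x y * (w x * (b x)⁻¹ * (b x)⁻¹) :=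
      hkc.mul ((w.continuous.mul hbinv).mul hbinv)
    have hweak := (hσ.tendsto_integral hconv c2).mono_left
      (hF.trans (nhdsWithin_mono _ sdiff_subset))
    -- Both integrand and measure move. The integrand converges uniformly thanks to the lower bound
    -- κ, which leaves a fixed integrand handled by weak convergence.
    have herr : Tendsto (fun s => ∫ x, (kc ε x y * (D s x * (b x)⁻¹ * (bfun ε (μ s) x)⁻¹) -
        kc ε x y * (w x * (b x)⁻¹ * (b x)⁻¹)) ∂(μ s : Measure K)) F (𝓝 0) := by
      have hbd : Tendsto (fun s => κ⁻¹ * κ⁻¹ * ‖D s - w‖ +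
          ‖w‖ * (κ⁻¹ * κ⁻¹ * κ⁻¹) * ‖embB ε (μ s) - embB ε (μ t)‖) F (𝓝 0) := by
        have a1 := (tendsto_iff_norm_sub_tendsto_zero.1 hw).const_mul (κ⁻¹ * κ⁻¹)
        have a2 := (tendsto_iff_norm_sub_tendsto_zero.1 hb).const_mul (‖w‖ * (κ⁻¹ * κ⁻¹ * κ⁻¹))
        simpa using a1.add a2
      refine squeeze_zero_norm (fun s => ?_) hbd
      have hpt : ∀ x, ‖kc ε x y * (D s x * (b x)⁻¹ * (bfun ε (μ s) x)⁻¹) -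
          kc ε x y * (w x * (b x)⁻¹ * (b x)⁻¹)‖ ≤ κ⁻¹ * κ⁻¹ * ‖D s - w‖ +
          ‖w‖ * (κ⁻¹ * κ⁻¹ * κ⁻¹) * ‖embB ε (μ s) - embB ε (μ t)‖ := by
        intro x
        have i1 : (b x)⁻¹ ≤ κ⁻¹ := inv_anti₀ hκ (hκb _ x)
        have i2 : (bfun ε (μ s) x)⁻¹ ≤ κ⁻¹ := inv_anti₀ hκ (hκb _ x)
        have p1 : 0 ≤ (b x)⁻¹ := (inv_pos.2 (hbpos x)).le
        have p2 : 0 ≤ (bfun ε (μ s) x)⁻¹ := (inv_pos.2 (bfun_pos ε _ x)).le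
        have p3 : 0 ≤ κ⁻¹ := (inv_pos.2 hκ).le
        have n1 : |D s x - w x| ≤ ‖D s - w‖ := ContinuousMap.norm_coe_le_norm (D s - w) x
        have n2 : |w x| ≤ ‖w‖ := ContinuousMap.norm_coe_le_norm w x
        have n3 : |bfun ε (μ s) x - b x| ≤ ‖embB ε (μ s) - embB ε (μ t)‖ := by
          rw [hbdef, ← embB_apply, ← embB_apply]
          have := abs_Hc_apply_le ε (embB ε (μ s) - embB ε (μ t)) x
          simpa using this
        have e : kc ε x y * (D s x * (b x)⁻¹ * (bfun ε (μ s) x)⁻¹) -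
          kc ε x y * (w x * (b x)⁻¹ * (b x)⁻¹) = kc ε x y * ((b x)⁻¹ * (bfun ε (μ s) x)⁻¹ *
            (D s x - w x) - w x * ((b x)⁻¹ * (b x)⁻¹ * (bfun ε (μ s) x)⁻¹) *
              (bfun ε (μ s) x - b x)) := by
          have q1 := (hbpos x).ne'
          have q2 := (bfun_pos ε (μ s) x).ne'
          field_simp
          ring
        rw [e, Real.norm_eq_abs, abs_mul, abs_of_pos (kc_pos ε x y)]
        calc _ ≤ 1 * |(b x)⁻¹ * (bfun ε (μ s) x)⁻¹ *
            (D s x - w x) - w x * ((b x)⁻¹ * (b x)⁻¹ * (bfun ε (μ s) x)⁻¹) *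
              (bfun ε (μ s) x - b x)| := mul_le_mul_of_nonneg_right (hkc1 x) (abs_nonneg _)
          _ ≤ |(b x)⁻¹ * (bfun ε (μ s) x)⁻¹ * (D s x - w x)| +
              |w x * ((b x)⁻¹ * (b x)⁻¹ * (bfun ε (μ s) x)⁻¹) * (bfun ε (μ s) x - b x)| := by
            rw [one_mul]; exact abs_sub _ _
          _ ≤ _ := by
            simp only [abs_mul, abs_of_nonneg p1, abs_of_nonneg p2]
            gcongr
      have := norm_integral_le_of_norm_le_const (μ := (μ s : Measure K)) (ae_of_all _ hpt)
      simpa using this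
    have hsum := herr.add hweak
    rw [zero_add] at hsum
    refine hsum.congr fun s => ?_
    have c1 : Continuous fun x => kc ε x y * (D s x * (b x)⁻¹ * (bfun ε (μ s) x)⁻¹) :=
      hkc.mul (((D s).continuous.mul hbinv).mul (continuous_inv_bfun ε (μ s)))
    rw [integral_sub (integrable_of_continuous _ c1) (integrable_of_continuous _ c2),
      sub_add_cancel]
  have h3 : Tendsto (fun s => D s y) F (𝓝 (w y)) :=
    ((continuous_eval_const y).tendsto w).comp hw
  have h4 := (h3.div_const (b y)).add (h2.const_mul ((b y)⁻¹))
  have h5 := tendsto_nhds_unique h1 (h4.congr fun s => ?_)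
  · rw [h5]
    congr 1
    rw [Kop, ← integral_const_mul]
    refine integral_congr_ae (ae_of_all _ fun x => ?_)
    simp only [kself_eq, ← hbdef]
    ring
  · rw [integral_kself_sub_one, mul_add, mul_left_comm,
      ← integral_const_mul (s - t)⁻¹]
    congr 1
    · rw [hDx]; ring
    · congr 1
      refine integral_congr_ae (ae_of_all _ fun x => ?_)
      simp only [hDx]; ring

/-- Solving `(Id + K_μ) u = H_μ[σ]` when `(Id - K_μ²) φ = H_μ[σ]` modulo constants. -/
theorem eq_sub_Kop_of_add_Kop_eq_riesz {μ : ProbabilityMeasure K} {σ : StrongDual ℝ (Hself ε μ)}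
    (hσ : ∀ φ : Hself ε μ, (∀ y, φ y = 1) → σ φ = 0) {u φ : K → ℝ} (hu : Continuous u)
    (hφ : Continuous φ) (h : ∀ y, u y + Kop ε μ u y = riesz ε σ y) {a : ℝ}
    (hφσ : ∀ y, φ y - Kop ε μ (Kop ε μ φ) y = riesz ε σ y + a) :
    a = 0 ∧ ∀ y, u y = φ y - Kop ε μ φ y := by
  have hKφ := continuous_Kop ε μ hφ
  have hKu := continuous_Kop ε μ hu
  -- Since (Id + K)(Id - K) = Id - K² and K fixes constants, (Id + K) annihilates this function; the
  -- constant is a/2 because (Id + K) doubles it.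
  have h1 : ∀ y, φ y - Kop ε μ φ y - (u y + a / 2) = 0 := by
    refine eq_zero_of_add_Kop_eq_zero ε μ ((hφ.sub hKφ).sub (hu.add continuous_const)) fun y => ?_
    have e1 := Kop_sub ε μ (φ := fun y => φ y - Kop ε μ φ y) (ψ := fun y => u y + a / 2)
      (hφ.sub hKφ) (hu.add continuous_const) y
    have e2 := Kop_sub ε μ hφ hKφ y
    have e3 := Kop_add ε μ hu (continuous_const : Continuous fun _ : K => a / 2) y
    rw [Kop_const] at e3
    rw [e1, e2, e3]
    linarith [h y, hφσ y]
  -- Integration against μ is pairing with 1 in H_μ. The condition σ(1) = 0 gives u mean zero, φ -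
  -- Kφ has mean zero as well, and this determines a.
  have h2 : ∫ y, riesz ε σ y ∂(μ : Measure K) = 0 := by
    rw [← inner_oneSelf, riesz, InnerProductSpace.toDual_symm_apply]
    exact hσ _ (oneSelf_apply ε μ)
  have h3 : ∫ y, u y ∂(μ : Measure K) = 0 := by
    simp_rw [← h] at h2
    rw [integral_add (integrable_of_continuous _ hu) (integrable_of_continuous _ hKu),
      integral_Kop ε μ hu] at h2
    linarith
  have h4 : ∫ y, (φ y - Kop ε μ φ y) ∂(μ : Measure K) = 0 := by
    rw [integral_sub (integrable_of_continuous _ hφ) (integrable_of_continuous _ hKφ),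
      integral_Kop ε μ hφ, sub_self]
  have h5 : ∫ y, (u y + a / 2) ∂(μ : Measure K) = a / 2 := by
    rw [integral_add (integrable_of_continuous _ hu) (integrable_const _), h3]
    simp
  have h6 : ∀ y, φ y - Kop ε μ φ y = u y + a / 2 := fun y => by linarith [h1 y]
  simp_rw [h6] at h4
  have ha : a = 0 := by linarith
  exact ⟨ha, fun y => by rw [h6 y, ha]; ring⟩

end Velocity

/-! ### The embedding is Lipschitz for the distance `d_S` -/

section LowerBound

variable {d : ℕ} {K : Set (EuclideanSpace ℝ (Fin d))} [CompactSpace K] {ε : ℝ} [hε : Fact (0 < ε)]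

/-- The squared norm of `φ - K_μ φ` in `H_μ` is at most `⟨φ - K_μ² φ, φ⟩`. -/
theorem norm_sub_Kop_sq_le {μ : ProbabilityMeasure K} (φ : Hself ε μ) {ψ : Hself ε μ}
    (hψ : ∀ y, ψ y = φ y - Kop ε μ (Kop ε μ φ) y) :
    ‖φ - kernelMean (kself ε μ) (μ : Measure K) φ‖ ^ 2 ≤ inner ℝ ψ φ := by
  have hφ : Continuous φ := continuous_apply (continuous_kself ε μ) φ
  set κ := kernelMean (kself ε μ) (μ : Measure K) φ with hκ
  have hκy : ∀ y, κ y = Kop ε μ φ y := Kop_eq_kernelMean ε μ hφ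
  have hκc : Continuous κ := continuous_apply (continuous_kself ε μ) κ
  have hκf : (κ : K → ℝ) = Kop ε μ φ := funext hκy
  have e1 : ψ = φ - kernelMean (kself ε μ) (μ : Measure K) κ := by
    refine RKHS.ext fun y => ?_
    rw [hψ, RKHS.coe_sub, Pi.sub_apply, Kop_eq_kernelMean ε μ hκc, hκf]
  have e2 : inner ℝ φ κ = ∫ y, φ y ^ 2 ∂(μ : Measure K) := by
    rw [hκ, inner_kernelMean (continuous_kself ε μ) _ hφ]
    simp_rw [sq]
  have e3 : inner ℝ κ κ = ∫ y, φ y * Kop ε μ φ y ∂(μ : Measure K) := by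
    nth_rewrite 2 [hκ]
    rw [inner_kernelMean (continuous_kself ε μ) _ hφ]
    simp_rw [hκy]
  have e4 : inner ℝ φ (kernelMean (kself ε μ) (μ : Measure K) κ) = inner ℝ κ κ := by
    rw [inner_kernelMean (continuous_kself ε μ) _ hκc, e3]
    simp_rw [hκy, mul_comm]
  -- The left side is ‖φ‖² - 2∫φ² + ∫φ Kφ and the right side is ‖φ‖² - ∫φ Kφ; they differ by 2(∫φ² -
  -- ∫φ Kφ) ≥ 0.
  have h := integral_mul_Kop_le ε μ hφ
  rw [e1, inner_sub_left, real_inner_comm, real_inner_self_eq_norm_sq, norm_sub_sq_real, e2,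
    real_inner_comm, e4, ← real_inner_self_eq_norm_sq κ, e3]
  linarith

/-- The metric tensor controls the squared norm of the derivative of `B(μ)` in `H_c`. -/
theorem IsVelocity.enorm_sq_le_metricTensor (hconv : Convex ℝ K) {I : Set ℝ}
    {μ : ℝ → ProbabilityMeasure K} {t : ℝ} {σ : StrongDual ℝ (Hself ε (μ t))}
    (hσ : IsVelocity ε I μ t σ) [NeBot (𝓝[I \ {t}] t)] {v : Hc K ε}
    (hv : HasDerivWithinAt (fun s => embB ε (μ s)) v I t) :
    ‖v‖ₑ ^ 2 ≤ ENNReal.ofReal (2 / ε) * metricTensor ε (μ t) σ := by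
  have hε' := hε.out
  have hc0 : ENNReal.ofReal (2 / ε) ≠ 0 := by
    rw [ENNReal.ofReal_ne_zero_iff]; positivity
  rw [mul_comm, ← ENNReal.div_le_iff_le_mul (Or.inl hc0) (Or.inl ENNReal.ofReal_ne_top)]
  refine le_iInf₂ fun φ hφ => ?_
  rw [ENNReal.div_le_iff_le_mul (Or.inl hc0) (Or.inl ENNReal.ofReal_ne_top), mul_comm,
    ← ENNReal.ofReal_mul (by positivity), ← mul_assoc,
    show 2 / ε * (ε / 2) = 1 by field_simp, one_mul]
  obtain ⟨a, ha⟩ := hφ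
  have hφc : Continuous φ := continuous_apply (continuous_kself ε _) φ
  set w : C(K, ℝ) := toC ε v with hw
  have hb : Tendsto (fun s => embB ε (μ s)) (𝓝[I \ {t}] t) (𝓝 (embB ε (μ t))) :=
    hv.continuousWithinAt.tendsto.mono_left (nhdsWithin_mono _ sdiff_subset)
  have hlim : Tendsto (fun s => toC ε ((s - t)⁻¹ • (embB ε (μ s) - embB ε (μ t))))
      (𝓝[I \ {t}] t) (𝓝 w) := by
    have h1 := hasDerivWithinAt_iff_tendsto_slope.1 hv
    rw [tendsto_iff_norm_sub_tendsto_zero] at h1 ⊢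
    refine squeeze_zero (fun s => norm_nonneg _) (fun s => ?_) h1
    rw [hw, ← toC_sub]
    exact norm_toC_le ε _
  have h1 := hσ.add_Kop_eq_riesz hconv le_rfl hb w hlim
  have huc : Continuous fun x => w x / bfun ε (μ t) x :=
    w.continuous.div (continuous_bfun ε _) fun x => (bfun_pos ε _ x).ne'
  obtain ⟨ha0, hu⟩ := eq_sub_Kop_of_add_Kop_eq_riesz hσ.1 huc hφc h1 ha
  have h2 := norm_sub_Kop_sq_le φ (ψ := riesz ε σ) fun y => by rw [ha y, ha0, add_zero]
  rw [riesz, InnerProductSpace.toDual_symm_apply] at h2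
  -- The derivative is v = b(φ - K_μ φ), and multiplication by b carries norms of H_μ to norms of
  -- H_c.
  have h3 : ‖v‖ ≤ ‖φ - kernelMean (kself ε (μ t)) (μ t : Measure K) φ‖ := by
    refine norm_le_of_eq_mul (bfun ε (μ t)) (kc_eq ε (μ t)) v _ fun x => ?_
    rw [RKHS.coe_sub, Pi.sub_apply, Kop_eq_kernelMean ε _ hφc, ← hu x, hw, toC_apply,
      mul_div_cancel₀ _ (bfun_pos ε _ x).ne']
  rw [← ofReal_norm, ← ENNReal.ofReal_pow (norm_nonneg _)]
  exact ENNReal.ofReal_le_ofReal ((pow_le_pow_left₀ (norm_nonneg _) h3 2).trans h2)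

/-- The metric tensor dominates (ε/2)‖ḃ‖² along every admissible curve, so d_S² is at least (ε/2)
times the smallest energy of a curve in H_c joining the endpoints. -/
theorem edist_embB_le (hconv : Convex ℝ K) (μ₀ μ₁ : ProbabilityMeasure K) :
    edist (embB ε μ₀) (embB ε μ₁) ≤ ENNReal.ofReal (Real.sqrt (2 / ε)) * dS ε μ₀ μ₁ := by
  have hε' := hε.out
  have hc0 : ENNReal.ofReal (2 / ε) ≠ 0 := by
    rw [ENNReal.ofReal_ne_zero_iff]; positivity
  set S := {r : ℝ≥0∞ | ∃ (μ : ℝ → ProbabilityMeasure K) (σ : ∀ t, StrongDual ℝ (Hself ε (μ t))),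
    μ 0 = μ₀ ∧ μ 1 = μ₁ ∧ IsH1 (fun t => embB ε (μ t)) ∧
    (∀ᵐ t ∂(volume.restrict (Icc (0 : ℝ) 1)), IsVelocity ε (Icc 0 1) μ t (σ t)) ∧
    r = ∫⁻ t in Icc (0 : ℝ) 1, metricTensor ε (μ t) (σ t)} with hS
  have key : edist (embB ε μ₀) (embB ε μ₁) ^ 2 / ENNReal.ofReal (2 / ε) ≤ sInf S := by
    refine le_sInf ?_
    rintro r ⟨μ, σ, rfl, rfl, ⟨v, hv, hbv⟩, hσ, rfl⟩
    rw [ENNReal.div_le_iff_le_mul (Or.inl hc0) (Or.inl ENNReal.ofReal_ne_top), mul_comm,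
      ← lintegral_const_mul' _ _ ENNReal.ofReal_ne_top]
    have hvI : IntervalIntegrable v volume 0 1 := by
      rw [intervalIntegrable_iff_integrableOn_Icc_of_le zero_le_one]
      exact hv.integrable (by norm_num)
    have hder := hvI.ae_hasDerivAt_integral
    have hpt : ∀ᵐ t ∂(volume.restrict (Icc (0 : ℝ) 1)),
        ‖v t‖ₑ ^ 2 ≤ ENNReal.ofReal (2 / ε) * metricTensor ε (μ t) (σ t) := by
      have hder' := ae_restrict_of_ae (s := Icc (0 : ℝ) 1) hder
      filter_upwards [hder', hσ, ae_restrict_mem measurableSet_Icc] with t ht htσ htI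
      rw [uIcc_of_le zero_le_one] at ht
      have hd : HasDerivWithinAt (fun s => embB ε (μ s)) (v t) (Icc 0 1) t := by
        have h1 := ((ht htI 0 (left_mem_Icc.2 zero_le_one)).const_add
          (embB ε (μ 0))).hasDerivWithinAt (s := Icc 0 1)
        exact h1.congr (fun s hs => hbv s hs) (hbv t htI)
      have : NeBot (𝓝[Icc (0 : ℝ) 1 \ {t}] t) := by
        exact accPt_principal_iff_nhdsWithin.1 ((uniqueDiffOn_Icc zero_lt_one) t htI).accPt
      exact htσ.enorm_sq_le_metricTensor hconv hd
    refine le_trans ?_ (lintegral_mono_ae hpt)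
    have h1 : edist (embB ε (μ 0)) (embB ε (μ 1)) = ‖∫ s in Icc (0 : ℝ) 1, v s‖ₑ := by
      have h0 := hbv 1 (right_mem_Icc.2 zero_le_one)
      simp only at h0
      rw [h0, edist_comm, edist_eq_enorm_sub, add_sub_cancel_left,
        intervalIntegral.integral_of_le zero_le_one, integral_Icc_eq_integral_Ioc]
    have : IsProbabilityMeasure (volume.restrict (Icc (0 : ℝ) 1)) := ⟨by simp⟩
    -- Cauchy–Schwarz on the unit interval: the length is at most the square root of the energy.
    have h2 : eLpNorm v 1 (volume.restrict (Icc (0 : ℝ) 1)) ≤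
        eLpNorm v 2 (volume.restrict (Icc (0 : ℝ) 1)) :=
      eLpNorm_le_eLpNorm_of_exponent_le (by norm_num) hv.1
    rw [eLpNorm_one_eq_lintegral_enorm] at h2
    have h3 := eLpNorm_nnreal_pow_eq_lintegral (f := v) (μ := volume.restrict (Icc (0 : ℝ) 1))
      (p := 2) two_ne_zero
    simp only [NNReal.coe_ofNat, ENNReal.rpow_ofNat, ENNReal.coe_ofNat] at h3
    rw [← h3, h1]
    exact pow_le_pow_left' ((enorm_integral_le_lintegral_enorm _).trans h2) 2
  rw [ENNReal.div_le_iff_le_mul (Or.inl hc0) (Or.inl ENNReal.ofReal_ne_top)] at key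
  have h4 := ENNReal.rpow_le_rpow key (z := 1 / 2) (by norm_num)
  rw [mul_comm, ENNReal.mul_rpow_of_nonneg _ _ (by norm_num), ← ENNReal.rpow_natCast, ← ENNReal.rpow_mul,
    ENNReal.ofReal_rpow_of_nonneg (by positivity) (by norm_num), ← Real.sqrt_eq_rpow] at h4
  rw [show ((2 : ℕ) : ℝ) * (1 / 2) = 1 by norm_num, ENNReal.rpow_one] at h4
  exact h4

end LowerBound

/-! ### Dirac masses -/

section Dirac

variable {d : ℕ} {K : Set (EuclideanSpace ℝ (Fin d))}

theorem integral_diracProba {X F : Type*} [MeasurableSpace X] [MeasurableSingletonClass X]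
    [NormedAddCommGroup F] [NormedSpace ℝ F] [CompleteSpace F] (f : X → F) (x : X) :
    ∫ y, f y ∂(diracProba x : Measure X) = f x := integral_dirac f x

theorem support_dirac {X : Type*} [TopologicalSpace X] [T1Space X] [MeasurableSpace X]
    [OpensMeasurableSpace X] (x : X) : (Measure.dirac x).support = {x} := by
  refine Subset.antisymm (Measure.support_subset_of_isClosed isClosed_singleton ?_) ?_
  · rw [mem_ae_dirac_iff (measurableSet_singleton x)]; rfl
  · rintro _ rfl
    rw [Measure.mem_support_iff_forall]
    intro U hU
    rw [Measure.dirac_apply_of_mem (mem_of_mem_nhds hU)]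
    exact one_pos

/-- Expansion of the Gaussian kernel around a point. -/
theorem kc_eq_mul_exp {ε : ℝ} (x y z : K) : kc ε y z = kc ε x y * kc ε x z *
    Real.exp (2 / ε * inner ℝ ((y : EuclideanSpace ℝ (Fin d)) - x) (z - x)) := by
  rw [kc, kc, kc, ← Real.exp_add, ← Real.exp_add, cost, cost, cost,
    show (y : EuclideanSpace ℝ (Fin d)) - z = (y - x) - (z - x) by abel, norm_sub_sq_real,
    norm_sub_rev (x : EuclideanSpace ℝ (Fin d)) y, norm_sub_rev (x : EuclideanSpace ℝ (Fin d)) z]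
  congr 1; ring

/-- A finite measure with the same kernel mean as a Dirac mass is this Dirac mass. -/
theorem eq_dirac_of_integral_kc_eq [CompactSpace K] (hconv : Convex ℝ K) {ε : ℝ} (hε : 0 < ε)
    (ν : Measure K) [IsFiniteMeasure ν] (x : K) (h : ∀ y, ∫ z, kc ε z y ∂ν = kc ε x y) :
    ν = Measure.dirac x := by
  set ρ : K → ℝ := kc ε x with hρ
  have hρc : Continuous ρ := by
    rw [hρ]; unfold kc cost; fun_prop
  have hρ0 : ∀ z, 0 < ρ z := kc_pos ε x
  have hint : ∀ y : K, ∫ z, ρ z *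
      Real.exp (2 / ε * inner ℝ ((z : EuclideanSpace ℝ (Fin d)) - x) (y - x)) ∂ν = 1 := by
    intro y
    have h1 := h y
    have e : ∀ z, kc ε z y = ρ z *
      Real.exp (2 / ε * inner ℝ ((z : EuclideanSpace ℝ (Fin d)) - x) (y - x)) * kc ε x y :=
      fun z => by rw [kc_eq_mul_exp x z y]; ring
    rw [integral_congr_ae (ae_of_all _ e), integral_mul_const] at h1
    exact mul_right_cancel₀ (kc_pos ε x y).ne' (by rw [h1, one_mul])
  have horth : ∀ y : K, ∀ᵐ z : K ∂ν, inner ℝ ((z : EuclideanSpace ℝ (Fin d)) - x) (y - x) = 0 := by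
    intro y
    set L : K → ℝ := fun z => 1 / ε * inner ℝ ((z : EuclideanSpace ℝ (Fin d)) - x) (y - x) with hL
    have hLc : Continuous L := by rw [hL]; fun_prop
    have h0 := hint x
    have h1 := hint y
    have hmid : (1 / 2 : ℝ) • (x : EuclideanSpace ℝ (Fin d)) + (1 / 2 : ℝ) • (y : EuclideanSpace ℝ (Fin d)) ∈ K :=
      hconv x.2 y.2 (by norm_num) (by norm_num) (by norm_num)
    have h2 := hint ⟨_, hmid⟩
    have e2 : (1 / 2 : ℝ) • (x : EuclideanSpace ℝ (Fin d)) + (1 / 2 : ℝ) • (y : EuclideanSpace ℝ (Fin d)) - x =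
      (1 / 2 : ℝ) • ((y : EuclideanSpace ℝ (Fin d)) - x) := by module
    have f0 : ∀ z, ρ z * Real.exp (2 / ε * inner ℝ ((z : EuclideanSpace ℝ (Fin d)) - x) (x - x)) =
        ρ z := fun z => by simp
    have f1 : ∀ z, ρ z * Real.exp (2 / ε * inner ℝ ((z : EuclideanSpace ℝ (Fin d)) - x) (y - x)) =
        ρ z * Real.exp (L z) ^ 2 := fun z => by
      rw [← Real.exp_nat_mul, hL]; congr 2; push_cast; ring
    have f2 : ∀ z, ρ z * Real.exp (2 / ε * inner ℝ ((z : EuclideanSpace ℝ (Fin d)) - x)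
        ((1 / 2 : ℝ) • (x : EuclideanSpace ℝ (Fin d)) + (1 / 2 : ℝ) • (y : EuclideanSpace ℝ (Fin d)) - x)) =
        ρ z * Real.exp (L z) := fun z => by
      rw [e2, inner_smul_right, hL]; congr 2; ring
    simp only [f0] at h0
    simp only [f1] at h1
    simp only [f2] at h2
    have c1 : Continuous fun z => ρ z * Real.exp (L z) ^ 2 := by fun_prop
    have c2 : Continuous fun z => ρ z * Real.exp (L z) := by fun_prop
    have c3 : Continuous fun z => ρ z * (Real.exp (L z) - 1) ^ 2 := by fun_prop
    -- Testing at x, at the midpoint and at y shows that ρ, ρ e^L and ρ e^{2L} all integrate to 1,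
    -- so the square integrates to 1 - 2 + 1 = 0. Nonnegativity of `ν` then forces L = 0 a.e.
    have hz : ∫ z, ρ z * (Real.exp (L z) - 1) ^ 2 ∂ν = 0 := by
      have e3 : ∀ z, ρ z * (Real.exp (L z) - 1) ^ 2 =
          ρ z * Real.exp (L z) ^ 2 - 2 * (ρ z * Real.exp (L z)) + ρ z := fun z => by ring
      simp_rw [e3]
      have i1 : Integrable (fun z => ρ z * Real.exp (L z) ^ 2 - 2 * (ρ z * Real.exp (L z))) ν :=
        (integrable_of_continuous _ c1).sub ((integrable_of_continuous _ c2).const_mul 2)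
      rw [integral_add i1 (integrable_of_continuous _ hρc),
        integral_sub (integrable_of_continuous _ c1) ((integrable_of_continuous _ c2).const_mul 2),
        integral_const_mul, h0, h1, h2]
      norm_num
    have hz' := (integral_eq_zero_iff_of_nonneg (fun z => mul_nonneg (hρ0 z).le (sq_nonneg _))
      (integrable_of_continuous _ c3)).1 hz
    filter_upwards [hz'] with z hz
    have h3 : (Real.exp (L z) - 1) ^ 2 = 0 := (mul_eq_zero.1 hz).resolve_left (hρ0 z).ne'
    have h4 : L z = 0 := by
      rw [← Real.exp_eq_one_iff]; linarith [pow_eq_zero_iff (two_ne_zero) |>.1 h3]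
    exact (mul_eq_zero.1 h4).resolve_left (by positivity)
  have hae : ∀ᵐ z ∂ν, z = x := by
    obtain ⟨s, hs, hsd⟩ := TopologicalSpace.exists_countable_dense K
    have h1 : ∀ᵐ z : K ∂ν, ∀ y ∈ s, inner ℝ ((z : EuclideanSpace ℝ (Fin d)) - x) (y - x) = 0 :=
      (ae_ball_iff hs).2 fun y _ => horth y
    filter_upwards [h1] with z hz
    have h2 : (fun y : K => inner ℝ ((z : EuclideanSpace ℝ (Fin d)) - x) (y - x)) =
        fun _ => (0 : ℝ) :=
      Continuous.ext_on hsd (by fun_prop) (by fun_prop) fun y hy => hz y hy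
    -- Orthogonality to y - x for all y in `K` may be tested at y = z itself, giving ‖z - x‖² = 0.
    have h3 := congrFun h2 z
    simp only [inner_self_eq_zero, sub_eq_zero] at h3
    exact Subtype.ext h3
  have hmass : ν.real univ = 1 := by
    have h1 : ∫ z, kc ε z x ∂ν = 1 := by rw [h x, ← kc_self ε x]
    have h2 : ∫ z, kc ε z x ∂ν = ∫ _, (1 : ℝ) ∂ν := by
      refine integral_congr_ae ?_
      filter_upwards [hae] with z hz
      rw [hz, kc_self]
    rw [h2] at h1
    simpa using h1
  have hmass' : ν univ = 1 := by
    rw [Measure.real, ENNReal.toReal_eq_one_iff] at hmass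
    exact hmass
  ext s hs
  rw [Measure.dirac_apply' _ hs]
  by_cases hx : x ∈ s
  · rw [indicator_of_mem hx, Pi.one_apply, ← hmass']
    refine measure_congr ?_
    filter_upwards [hae] with z hz
    rw [hz]
    exact propext ⟨fun _ => trivial, fun _ => hx⟩
  · rw [indicator_of_notMem hx, ← measure_empty (μ := ν)]
    refine measure_congr ?_
    filter_upwards [hae] with z hz
    rw [hz]
    exact propext ⟨fun h => hx h, fun h => h.elim⟩

variable [CompactSpace K] (ε : ℝ) [hε : Fact (0 < ε)]

/-- The integral equation reads b(y) = k_c(x, y)/b(x); at y = x it gives b(x)² = 1. -/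
theorem bfun_diracProba (x y : K) : bfun ε (diracProba x) y = kc ε x y := by
  have h1 : ∀ y, bfun ε (diracProba x) y = kc ε x y * (bfun ε (diracProba x) x)⁻¹ := fun y => by
    rw [bfun_eq_integral, integral_diracProba]
  have hp := bfun_pos ε (diracProba x) x
  have h2 := h1 x
  rw [kc_self, one_mul] at h2
  replace h2 : bfun ε (diracProba x) x = 1 := by
    rw [← pow_eq_one_iff_of_nonneg hp.le two_ne_zero, sq]
    nth_rewrite 1 [h2]
    exact inv_mul_cancel₀ hp.ne'
  rw [h1 y, h2, inv_one, mul_one]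

theorem embB_diracProba (x : K) : embB ε (diracProba x) = sec (kc ε) x := by
  refine RKHS.ext fun y => ?_
  rw [embB_apply, bfun_diracProba, sec_apply, kc_comm]

theorem kself_diracProba (x y z : K) : kself ε (diracProba x) y z =
    Real.exp (2 / ε * inner ℝ ((y : EuclideanSpace ℝ (Fin d)) - x) (z - x)) := by
  have h1 := (kc_pos ε x y).ne'
  have h2 := (kc_pos ε x z).ne'
  rw [kself_eq, bfun_diracProba, bfun_diracProba, kc_eq_mul_exp x y z]
  generalize kc ε x y = a at *
  generalize kc ε x z = b at *
  field_simp

theorem Kop_diracProba (x : K) (φ : K → ℝ) (y : K) : Kop ε (diracProba x) φ y = φ x := by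
  rw [Kop, integral_diracProba, kself_diracProba]
  simp

/-- The Dirac mass witnesses that `HcInv` is a genuine choice, and injectivity of H_c at Dirac
masses identifies the chosen measure. -/
theorem HcInv_embB_diracProba (hconv : Convex ℝ K) (x : K) :
    (HcInv ε (embB ε (diracProba x)) : Measure K) = Measure.dirac x := by
  have h := Classical.epsilon_spec (p := fun ν : FiniteMeasure K =>
    ∀ y, embB ε (diracProba x) y = ∫ z, kc ε z y ∂(ν : Measure K))
    ⟨(diracProba x).toFiniteMeasure, fun y => by
      change _ = ∫ z, kc ε z y ∂(diracProba x : Measure K)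
      rw [integral_diracProba, embB_diracProba, sec_apply, kc_comm]⟩
  refine eq_dirac_of_integral_kc_eq hconv hε.out _ x fun y => ?_
  refine (h y).symm.trans ?_
  rw [embB_diracProba, sec_apply, kc_comm]

theorem edist_embB_diracProba_le (x y : K) : edist (embB ε (diracProba x)) (embB ε (diracProba y)) ≤
    ENNReal.ofReal (Real.sqrt (2 / ε)) * edist x y := by
  rw [embB_diracProba, embB_diracProba, edist_dist, edist_dist,
    ← ENNReal.ofReal_mul (Real.sqrt_nonneg _), dist_eq_norm]
  exact ENNReal.ofReal_le_ofReal (norm_sec_kc_sub_le ε x y)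

/-- Lipschitz images of absolutely continuous curves. -/
theorem IsAC.of_le {Y Z : Type*} {p : ℝ≥0∞} {δ : Y → Y → ℝ≥0∞} {δ' : Z → Z → ℝ≥0∞} {y : ℝ → Y}
    {z : ℝ → Z} {I : Set ℝ} {L : ℝ} (hL : 0 ≤ L)
    (h : ∀ s ∈ I, ∀ t ∈ I, δ' (z s) (z t) ≤ ENNReal.ofReal L * δ (y s) (y t)) (hy : IsAC p δ y I) :
    IsAC p δ' z I := by
  obtain ⟨m, hm, hym⟩ := hy
  refine ⟨fun r => L * m r, hm.const_mul L, fun s hs t ht hst => ?_⟩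
  rw [intervalIntegral.integral_const_mul, ENNReal.ofReal_mul hL]
  exact (h s hs t ht).trans (mul_le_mul_right (hym s hs t ht hst) _)

theorem IsAC.embB_diracProba {p : ℝ≥0∞} {x : ℝ → K} {I : Set ℝ} (h : IsAC p edist x I) :
    IsAC p edist (fun t => embB ε (diracProba (x t))) I :=
  h.of_le (Real.sqrt_nonneg (2 / ε)) fun _ _ _ _ => edist_embB_diracProba_le ε _ _

omit [CompactSpace K] hε in
theorem hasDerivWithinAt_kc {I : Set ℝ} {x : ℝ → K} {t : ℝ} {v : EuclideanSpace ℝ (Fin d)}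
    (hv : HasDerivWithinAt (fun s => (x s : EuclideanSpace ℝ (Fin d))) v I t) (y : K) :
    HasDerivWithinAt (fun s => kc ε (x s) y)
      (2 / ε * kc ε (x t) y * inner ℝ v ((y : EuclideanSpace ℝ (Fin d)) - x t)) I t := by
  have h0 : HasDerivWithinAt (fun s => -cost (x s) y / ε) _ I t :=
    (hv.sub_const (y : EuclideanSpace ℝ (Fin d))).norm_sq.neg.div_const ε
  refine h0.exp.congr_deriv ?_
  rw [real_inner_comm, ← neg_sub (y : EuclideanSpace ℝ (Fin d)) (x t), inner_neg_right, kc]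
  ring

/-- Pointwise, ḃ + Wb equals (2/ε) k_c(x_t, y) times ⟨v, y - x_t⟩ + V(y) - V(x_t), and p must be its
negative. This p vanishes at x_t automatically, so only p ≤ 0 is a condition. -/
theorem inclusion_iff (hconv : Convex ℝ K) (V : C(K, ℝ)) (x : ℝ → K) {t : ℝ} (ht : 0 ≤ t)
    {v : EuclideanSpace ℝ (Fin d)} {w : Hc K ε}
    (hv : HasDerivWithinAt (fun s => (x s : EuclideanSpace ℝ (Fin d))) v (Ici 0) t)
    (hw : HasDerivWithinAt (fun s => embB ε (diracProba (x s))) w (Ici 0) t) :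
    (∃ p ∈ Ptilde ε (embB ε (diracProba (x t))),
      ∀ y, w y + Wop ε V (embB ε (diracProba (x t))) y + p y = 0) ↔
        -v ∈ subdifferential V (x t) := by
  have hε' := hε.out
  have hwy : ∀ y, w y = 2 / ε * kc ε (x t) y *
      inner ℝ v ((y : EuclideanSpace ℝ (Fin d)) - x t) := by
    intro y
    have h1 : HasDerivWithinAt (fun s => kc ε (x s) y) (w y) (Ici 0) t := by
      have h2 := (innerSL ℝ (sec (kc ε) y)).hasFDerivAt.comp_hasDerivWithinAt t hw
      simp only [innerSL_apply_apply, sec_inner] at h2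
      refine h2.congr (fun s _ => ?_) ?_ <;>
      simp [embB_diracProba, sec_apply, sec_inner, kc_comm ε y]
    exact (uniqueDiffOn_Ici (0 : ℝ) t ht).eq_deriv _ h1 (hasDerivWithinAt_kc ε hv y)
  have hW : ∀ y, Wop ε V (embB ε (diracProba (x t))) y =
      2 / ε * kc ε (x t) y * (V y - V (x t)) := by
    intro y
    rw [Wop, Vstar, HcInv_embB_diracProba ε hconv, integral_dirac, embB_diracProba, sec_apply,
      kc_comm ε y]
    ring
  have hP : Ptilde ε (embB ε (diracProba (x t))) = {p | (∀ y, p y ≤ 0) ∧ p (x t) = 0} := by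
    rw [Ptilde, pressures, HcInv_embB_diracProba ε hconv, support_dirac]
    simp
  rw [hP]
  simp only [hwy, hW, subdifferential, mem_ofPred_eq, inner_neg_left]
  have hpos : ∀ y, 0 < 2 / ε * kc ε (x t) y := fun y => mul_pos (by positivity) (kc_pos _ _ _)
  constructor
  · rintro ⟨p, ⟨hp, -⟩, h⟩ y
    have h1 := h y
    have h2 := hp y
    have h3 : 0 ≤ 2 / ε * kc ε (x t) y *
        (inner ℝ v ((y : EuclideanSpace ℝ (Fin d)) - x t) + (V y - V (x t))) := by linarith
    linarith [nonneg_of_mul_nonneg_right h3 (hpos y)]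
  · intro h
    refine ⟨⟨fun y => -(2 / ε * kc ε (x t) y *
        (inner ℝ v ((y : EuclideanSpace ℝ (Fin d)) - x t) + (V y - V (x t)))), ?_⟩,
      ⟨fun y => ?_, ?_⟩, fun y => ?_⟩
    · unfold kc cost; fun_prop
    · simp only [ContinuousMap.coe_mk]
      have := mul_nonneg (hpos y).le (show 0 ≤ inner ℝ v
        ((y : EuclideanSpace ℝ (Fin d)) - x t) + (V y - V (x t)) by linarith [h y])
      linarith
    · simp
    · simp only [ContinuousMap.coe_mk]; ring

end Dirac

/-! ### Curves of Dirac masses -/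

/-- A curve in a Hilbert space whose Gram matrix is `exp (α ⟨γ s - γ t, γ r - γ t⟩)` is
differentiable at `t` when `γ` is. -/
theorem exists_hasDerivWithinAt_of_inner_eq_exp {E H : Type*} [NormedAddCommGroup E]
    [InnerProductSpace ℝ E] [NormedAddCommGroup H] [InnerProductSpace ℝ H] [CompleteSpace H]
    {γ : ℝ → E} {v : E} {I : Set ℝ} {t α : ℝ} [NeBot (𝓝[I \ {t}] t)]
    (hγ : HasDerivWithinAt γ v I t) (Ψ : ℝ → H)
    (hΨ : ∀ s r, inner ℝ (Ψ s) (Ψ r) = Real.exp (α * inner ℝ (γ s - γ t) (γ r - γ t))) :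
    ∃ w : H, HasDerivWithinAt Ψ w I t ∧ ‖w‖ ^ 2 = α * ‖v‖ ^ 2 := by
  set F := 𝓝[I \ {t}] t with hF
  set G : ℝ → H := slope Ψ t with hG
  have hs : Tendsto (slope γ t) F (𝓝 v) := hasDerivWithinAt_iff_tendsto_slope.1 hγ
  have hc : Tendsto γ F (𝓝 (γ t)) :=
    hγ.continuousWithinAt.tendsto.mono_left (nhdsWithin_mono _ sdiff_subset)
  set h : ℝ → ℝ := dslope Real.exp 0 with hh
  have hexp : ∀ u, Real.exp u - 1 = u * h u := fun u => by
    have := sub_smul_dslope Real.exp 0 u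
    simp only [sub_zero, smul_eq_mul, Real.exp_zero] at this
    exact this.symm
  have hh0 : Tendsto h (𝓝 0) (𝓝 1) := by
    have h1 : ContinuousAt h 0 := continuousAt_dslope_same.2 Real.differentiableAt_exp
    have h2 : h 0 = 1 := by rw [hh, dslope_same]; simp
    rw [← h2]
    exact h1
  have hGram : ∀ s r, inner ℝ (G s) (G r) = α * inner ℝ (slope γ t s) (slope γ t r) *
      h (α * inner ℝ (γ s - γ t) (γ r - γ t)) := by
    intro s r
    simp only [hG, slope, vsub_eq_sub, inner_smul_left, inner_smul_right, inner_sub_left,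
      inner_sub_right (𝕜 := ℝ) (E := H), hΨ, sub_self, inner_zero_left, inner_zero_right, mul_zero,
      Real.exp_zero, RCLike.conj_to_real]
    rw [← inner_sub_left]
    have := hexp (α * inner ℝ (γ s - γ t) (γ r - γ t))
    linear_combination (s - t)⁻¹ * (r - t)⁻¹ * this
  -- Convergence of all mixed inner products of difference quotients to one value makes ‖G s - G r‖²
  -- tend to 0, so the quotients are Cauchy in norm.
  have hlim : Tendsto (fun p : ℝ × ℝ => inner ℝ (G p.1) (G p.2)) (F ×ˢ F)
      (𝓝 (α * ‖v‖ ^ 2)) := by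
    simp_rw [hGram]
    have a1 : Tendsto (fun p : ℝ × ℝ => inner ℝ (slope γ t p.1) (slope γ t p.2)) (F ×ˢ F)
        (𝓝 (inner ℝ v v)) := (hs.comp tendsto_fst).inner (hs.comp tendsto_snd)
    have a2 : Tendsto (fun p : ℝ × ℝ => α * inner ℝ (γ p.1 - γ t) (γ p.2 - γ t)) (F ×ˢ F)
        (𝓝 0) := by
      have := (((hc.comp (tendsto_fst (f := F) (g := F))).sub_const (γ t)).inner (𝕜 := ℝ)
        ((hc.comp (tendsto_snd (f := F) (g := F))).sub_const (γ t))).const_mul α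
      simpa using this
    have := (a1.const_mul α).mul (hh0.comp a2)
    rwa [mul_one, real_inner_self_eq_norm_sq] at this
  have hdiag : Tendsto (fun s => inner ℝ (G s) (G s)) F (𝓝 (α * ‖v‖ ^ 2)) :=
    hlim.comp (tendsto_id.prodMk tendsto_id)
  have hcauchy : Cauchy (map G F) := by
    rw [cauchy_map_iff', Metric.uniformity_eq_comap_nhds_zero, tendsto_comap_iff]
    have b1 : Tendsto (fun p : ℝ × ℝ => ‖G p.1 - G p.2‖ ^ 2) (F ×ˢ F) (𝓝 0) := by
      have e : ∀ p : ℝ × ℝ, ‖G p.1 - G p.2‖ ^ 2 = inner ℝ (G p.1) (G p.1) -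
          2 * inner ℝ (G p.1) (G p.2) + inner ℝ (G p.2) (G p.2) := fun p => by
        rw [norm_sub_sq_real, real_inner_self_eq_norm_sq, real_inner_self_eq_norm_sq]
      simp_rw [e]
      have := ((hdiag.comp (tendsto_fst (f := F) (g := F))).sub (hlim.const_mul 2)).add
        (hdiag.comp (tendsto_snd (f := F) (g := F)))
      simp only [Function.comp_def] at this
      convert this using 2
      ring
    have b2 := b1.sqrt
    rw [Real.sqrt_zero] at b2
    refine b2.congr fun p => ?_
    rw [Real.sqrt_sq (norm_nonneg _), Function.comp, dist_eq_norm]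
  obtain ⟨w, hw⟩ := CompleteSpace.complete hcauchy
  refine ⟨w, hasDerivWithinAt_iff_tendsto_slope.2 hw, ?_⟩
  rw [← real_inner_self_eq_norm_sq]
  exact tendsto_nhds_unique ((show Tendsto G F (𝓝 w) from hw).inner hw) hdiag

section DiracCurve

variable {d : ℕ} {K : Set (EuclideanSpace ℝ (Fin d))} [CompactSpace K] (ε : ℝ)
  [hε : Fact (0 < ε)]

theorem _root_.UniqueDiffWithinAt.neBot_nhdsWithin_sdiff {I : Set ℝ} {t : ℝ}
    (h : UniqueDiffWithinAt ℝ I t) : NeBot (𝓝[I \ {t}] t) :=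
  accPt_principal_iff_nhdsWithin.1 h.accPt

/-- The velocity of a differentiable curve of Dirac masses. -/
theorem exists_isVelocity_diracProba {I : Set ℝ} {x : ℝ → K} {t : ℝ}
    {v : EuclideanSpace ℝ (Fin d)} (hI : UniqueDiffWithinAt ℝ I t)
    (hv : HasDerivWithinAt (fun s => (x s : EuclideanSpace ℝ (Fin d))) v I t) :
    ∃ σ : StrongDual ℝ (Hself ε (diracProba (x t))),
      IsVelocity ε I (fun s => diracProba (x s)) t σ ∧
      (∀ y, riesz ε σ y = 2 / ε * inner ℝ v ((y : EuclideanSpace ℝ (Fin d)) - x t)) ∧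
      IsInvIdSubKSq ε (diracProba (x t)) (riesz ε σ) (riesz ε σ) ∧
      ε / 2 * σ (riesz ε σ) = ‖v‖ ^ 2 := by
  have := hI.neBot_nhdsWithin_sdiff
  have hε' := hε.out
  set k := kself ε (diracProba (x t)) with hk
  obtain ⟨w, hw, hwn⟩ := exists_hasDerivWithinAt_of_inner_eq_exp (α := 2 / ε) hv
    (fun s => sec k (x s)) fun s r => by
      rw [inner_sec_sec, hk, kself_diracProba, real_inner_comm]
  have hev : ∀ φ : Hself ε (diracProba (x t)),
      HasDerivWithinAt (fun s => φ (x s)) (inner ℝ w φ) I t := by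
    intro φ
    have h1 := (innerSL ℝ φ).hasFDerivAt.comp_hasDerivWithinAt t hw
    rw [real_inner_comm]
    exact h1.congr (fun s _ => (inner_sec φ (x s)).symm) (inner_sec φ (x t)).symm
  have hwy : ∀ y, w y = 2 / ε * inner ℝ v ((y : EuclideanSpace ℝ (Fin d)) - x t) := by
    intro y
    have h1 := hev (sec k y)
    rw [inner_sec] at h1
    have h2 : HasDerivWithinAt (fun s => Real.exp (2 / ε * inner ℝ
        ((x s : EuclideanSpace ℝ (Fin d)) - x t) (y - x t)))
        (2 / ε * inner ℝ v ((y : EuclideanSpace ℝ (Fin d)) - x t)) I t := by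
      have h3 := (((hv.sub_const (x t : EuclideanSpace ℝ (Fin d))).inner ℝ
        (hasDerivWithinAt_const t I ((y : EuclideanSpace ℝ (Fin d)) - x t))).const_mul
          (2 / ε)).exp
      simpa using h3
    refine hI.eq_deriv _ h1 (h2.congr (fun s _ => ?_) ?_) <;>
    rw [sec_apply, hk, kself_diracProba]
  have hr : riesz ε (InnerProductSpace.toDual ℝ (Hself ε (diracProba (x t))) w) = w := by
    rw [riesz, LinearIsometryEquiv.symm_apply_apply]
  refine ⟨InnerProductSpace.toDual ℝ _ w, ⟨fun φ hφ => ?_, fun φ => ?_⟩, ?_, ?_, ?_⟩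
  · rw [InnerProductSpace.toDual_apply_apply]
    have h1 := hev φ
    simp only [hφ] at h1
    exact hI.eq_deriv _ h1 (hasDerivWithinAt_const _ _ _)
  · rw [InnerProductSpace.toDual_apply_apply]
    simp_rw [integral_diracProba]
    exact hev φ
  · rw [hr]; exact hwy
  · rw [hr]
    refine ⟨0, fun y => ?_⟩
    rw [Kop_diracProba, Kop_diracProba, hwy (x t), sub_self, inner_zero_right, mul_zero, sub_zero,
      add_zero]
  · rw [hr, InnerProductSpace.toDual_apply_apply, real_inner_self_eq_norm_sq, hwn, ← mul_assoc]
    field_simp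

-- Dividing the section at x_s by k_c(x_t, x_s) yields the exponential Gram matrix of
-- `exists_hasDerivWithinAt_of_inner_eq_exp`; the scalar factor is restored by the product rule.
omit [CompactSpace K] in
theorem differentiableWithinAt_sec_kc {I : Set ℝ} {x : ℝ → K} {t : ℝ}
    {v : EuclideanSpace ℝ (Fin d)} (hI : UniqueDiffWithinAt ℝ I t)
    (hv : HasDerivWithinAt (fun s => (x s : EuclideanSpace ℝ (Fin d))) v I t) :
    DifferentiableWithinAt ℝ (fun s => sec (kc ε) (x s)) I t := by
  have := hI.neBot_nhdsWithin_sdiff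
  obtain ⟨w, hw, -⟩ := exists_hasDerivWithinAt_of_inner_eq_exp (α := 2 / ε) hv
    (fun s => (kc ε (x t) (x s))⁻¹ • sec (kc ε) (x s)) fun s r => by
      have h1 := (kc_pos ε (x t) (x s)).ne'
      have h2 := (kc_pos ε (x t) (x r)).ne'
      rw [inner_smul_left, inner_smul_right, inner_sec_sec, kc_eq_mul_exp (x t) (x r) (x s),
        real_inner_comm, RCLike.conj_to_real]
      generalize kc ε (x t) (x s) = a at *
      generalize kc ε (x t) (x r) = b at *
      field_simp
  have h1 : HasDerivWithinAt (fun s => kc ε (x t) (x s)) _ I t :=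
    (hasDerivWithinAt_kc ε hv (x t)).congr (fun s _ => kc_comm _ _ _) (kc_comm _ _ _)
  refine (h1.smul hw).differentiableWithinAt.congr (fun s _ => ?_) ?_ <;>
  rw [Pi.smul_apply', smul_smul, mul_inv_cancel₀ (kc_pos _ _ _).ne', one_smul]

/-- The segment from `x` to `y`, stopped at its ends. -/
noncomputable def seg (hconv : Convex ℝ K) (x y : K) (r : ℝ) : K :=
  ⟨AffineMap.lineMap (x : EuclideanSpace ℝ (Fin d)) (y : EuclideanSpace ℝ (Fin d))
    (projIcc (0 : ℝ) 1 zero_le_one r : ℝ),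
    hconv.lineMap_mem x.2 y.2 (projIcc (0 : ℝ) 1 zero_le_one r).2⟩

omit [CompactSpace K] in
theorem coe_seg (hconv : Convex ℝ K) (x y : K) {r : ℝ} (hr : r ∈ Icc (0 : ℝ) 1) :
    (seg hconv x y r : EuclideanSpace ℝ (Fin d)) = AffineMap.lineMap (x : EuclideanSpace ℝ (Fin d))
      (y : EuclideanSpace ℝ (Fin d)) r := by
  change AffineMap.lineMap _ _ ((projIcc (0 : ℝ) 1 zero_le_one r : Icc (0 : ℝ) 1) : ℝ) = _
  rw [projIcc_of_mem zero_le_one hr]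

omit [CompactSpace K] in
theorem dist_seg_le (hconv : Convex ℝ K) (x y : K) (r s : ℝ) :
    dist (seg hconv x y r) (seg hconv x y s) ≤ dist x y * |r - s| := by
  rw [Subtype.dist_eq, seg, seg, dist_lineMap_lineMap, mul_comm, ← Subtype.dist_eq]
  refine mul_le_mul_of_nonneg_left ?_ dist_nonneg
  rw [Real.dist_eq]
  exact abs_projIcc_sub_projIcc zero_le_one

omit [CompactSpace K] in
theorem hasDerivWithinAt_seg (hconv : Convex ℝ K) (x y : K) {r : ℝ} (hr : r ∈ Icc (0 : ℝ) 1) :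
    HasDerivWithinAt (fun s => (seg hconv x y s : EuclideanSpace ℝ (Fin d)))
      ((y : EuclideanSpace ℝ (Fin d)) - x) (Icc 0 1) r := by
  refine AffineMap.hasDerivWithinAt_lineMap.congr (fun s hs => coe_seg hconv x y hs)
    (coe_seg hconv x y hr)

/-- The curve is Lipschitz in H_c and differentiable inside the interval, hence a primitive of its
bounded derivative. -/
theorem isH1_embB_seg (hconv : Convex ℝ K) (x y : K) :
    IsH1 (fun r => embB ε (diracProba (seg hconv x y r))) := by
  simp_rw [embB_diracProba]
  set b : ℝ → Hc K ε := fun r => sec (kc ε) (seg hconv x y r) with hb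
  have hlip : LipschitzWith (Real.sqrt (2 / ε) * dist x y).toNNReal b := by
    refine LipschitzWith.of_dist_le_mul fun r s => ?_
    rw [Real.coe_toNNReal _ (by positivity), dist_eq_norm, Real.dist_eq, mul_assoc]
    exact (norm_sec_kc_sub_le ε _ _).trans
      (mul_le_mul_of_nonneg_left (dist_seg_le hconv x y r s) (Real.sqrt_nonneg _))
  have hbd : ∀ r, ‖deriv b r‖ ≤ (Real.sqrt (2 / ε) * dist x y).toNNReal := fun r =>
    norm_deriv_le_of_lipschitz hlip
  have hmeas : StronglyMeasurable (deriv b) := stronglyMeasurable_deriv b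
  refine ⟨deriv b, MemLp.of_bound hmeas.aestronglyMeasurable _ (ae_of_all _ hbd), fun t ht => ?_⟩
  rw [intervalIntegral.integral_eq_sub_of_hasDeriv_right_of_le ht.1 hlip.continuous.continuousOn]
  · abel
  · intro r hr
    have hr1 : r ∈ Ioo (0 : ℝ) 1 := ⟨hr.1, hr.2.trans_le ht.2⟩
    have h1 := differentiableWithinAt_sec_kc ε (uniqueDiffOn_Icc zero_lt_one r
      (Ioo_subset_Icc_self hr1)) (hasDerivWithinAt_seg hconv x y (Ioo_subset_Icc_self hr1))
    exact (h1.differentiableAt (Icc_mem_nhds hr1.1 hr1.2)).hasDerivAt.hasDerivWithinAt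
  · exact (intervalIntegrable_const (c := ((Real.sqrt (2 / ε) * dist x y).toNNReal : ℝ))).mono_fun'
      hmeas.aestronglyMeasurable (ae_of_all _ hbd)

/-- The Riemannian distance between Dirac masses is at most the distance of the points. -/
theorem dS_diracProba_le (hconv : Convex ℝ K) (x y : K) :
    dS ε (diracProba x) (diracProba y) ≤ edist x y := by
  have hvel : ∀ r, ∃ σ : StrongDual ℝ (Hself ε (diracProba (seg hconv x y r))),
      r ∈ Icc (0 : ℝ) 1 → IsVelocity ε (Icc 0 1) (fun s => diracProba (seg hconv x y s)) r σ ∧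
        metricTensor ε (diracProba (seg hconv x y r)) σ ≤ edist x y ^ 2 := by
    intro r
    by_cases hr : r ∈ Icc (0 : ℝ) 1
    · obtain ⟨σ, h1, -, h2, h3⟩ := exists_isVelocity_diracProba ε
        (uniqueDiffOn_Icc zero_lt_one r hr) (hasDerivWithinAt_seg hconv x y hr)
      refine ⟨σ, fun _ => ⟨h1, ?_⟩⟩
      -- At a Dirac mass H_μ[σ] is its own preimage under Id - K_μ², so the tensor is at most the
      -- squared speed of the segment.
      refine (iInf₂_le (riesz ε σ) h2).trans ?_
      rw [h3, edist_comm, edist_dist, ← ENNReal.ofReal_pow dist_nonneg, Subtype.dist_eq,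
        dist_eq_norm]
    · exact ⟨0, fun h => (hr h).elim⟩
  choose σ hσ using hvel
  have h0 : seg hconv x y 0 = x := Subtype.ext (by
    rw [coe_seg hconv x y (left_mem_Icc.2 zero_le_one), AffineMap.lineMap_apply_zero])
  have h1 : seg hconv x y 1 = y := Subtype.ext (by
    rw [coe_seg hconv x y (right_mem_Icc.2 zero_le_one), AffineMap.lineMap_apply_one])
  have hle : ∫⁻ t in Icc (0 : ℝ) 1, metricTensor ε (diracProba (seg hconv x y t)) (σ t) ≤
      edist x y ^ 2 := by
    calc _ ≤ ∫⁻ _ in Icc (0 : ℝ) 1, edist x y ^ 2 := by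
          refine lintegral_mono_ae ?_
          filter_upwards [ae_restrict_mem measurableSet_Icc] with t ht
          exact (hσ t ht).2
      _ = _ := by simp
  rw [dS]
  have h2 : edist x y = (edist x y ^ 2) ^ (1 / 2 : ℝ) := by
    rw [← ENNReal.rpow_natCast, ← ENNReal.rpow_mul, show ((2 : ℕ) : ℝ) * (1 / 2) = 1 by norm_num,
      ENNReal.rpow_one]
  rw [h2]
  refine ENNReal.rpow_le_rpow (le_trans (sInf_le ?_) hle) (by norm_num)
  refine ⟨fun t => diracProba (seg hconv x y t), σ, ?_, ?_, isH1_embB_seg ε hconv x y, ?_, rfl⟩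
  · simp only [h0]
  · simp only [h1]
  · filter_upwards [ae_restrict_mem measurableSet_Icc] with t ht
    exact (hσ t ht).1

end DiracCurve

/-! ### Absolutely continuous functions of a real variable -/

/-- Increments of `f` are dominated by those of the primitive of `M`, which is absolutely
continuous. -/
theorem absolutelyContinuousOnInterval_of_dist_le {X : Type*} [PseudoMetricSpace X] {f : ℝ → X}
    {M : ℝ → ℝ} {a b : ℝ} (hab : a ≤ b) (hM : IntegrableOn M (Icc a b))
    (h : ∀ s ∈ Icc a b, ∀ t ∈ Icc a b, s ≤ t → dist (f s) (f t) ≤ ∫ r in s..t, M r) :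
    AbsolutelyContinuousOnInterval f a b := by
  have hM' : IntervalIntegrable M volume a b := (intervalIntegrable_iff_integrableOn_Icc_of_le hab).2 hM
  have hF := hM'.absolutelyContinuousOnInterval_intervalIntegral (c := a) left_mem_uIcc
  have hsub : ∀ s ∈ Icc a b, ∀ t ∈ Icc a b,
      (∫ r in a..t, M r) - ∫ r in a..s, M r = ∫ r in s..t, M r := fun s hs t ht =>
    intervalIntegral.integral_interval_sub_left
      (hM'.mono_set (by rw [uIcc_of_le hab, uIcc_of_le ht.1]; exact Icc_subset_Icc_right ht.2))
      (hM'.mono_set (by rw [uIcc_of_le hab, uIcc_of_le hs.1]; exact Icc_subset_Icc_right hs.2))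
  have key : ∀ s ∈ Icc a b, ∀ t ∈ Icc a b,
      dist (f s) (f t) ≤ dist (∫ r in a..s, M r) (∫ r in a..t, M r) := by
    have h1 : ∀ s ∈ Icc a b, ∀ t ∈ Icc a b, s ≤ t →
        dist (f s) (f t) ≤ dist (∫ r in a..s, M r) (∫ r in a..t, M r) := fun s hs t ht hst => by
      rw [dist_comm (∫ r in a..s, M r), Real.dist_eq, hsub s hs t ht]
      exact (h s hs t ht hst).trans (le_abs_self _)
    intro s hs t ht
    rcases le_total s t with hst | hst
    · exact h1 s hs t ht hst
    · rw [dist_comm, dist_comm (∫ r in a..s, M r)]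
      exact h1 t ht s hs hst
  rw [absolutelyContinuousOnInterval_iff] at hF ⊢
  intro ε hε
  obtain ⟨δ, hδ, H⟩ := hF ε hε
  refine ⟨δ, hδ, fun E hE hlt => lt_of_le_of_lt (Finset.sum_le_sum fun i hi => ?_) (H E hE hlt)⟩
  have := hE.1 i hi
  rw [uIcc_of_le hab] at this
  exact key _ this.1 _ this.2

/-- An absolutely continuous function with a.e. nonnegative derivative does not decrease. -/
theorem _root_.AbsolutelyContinuousOnInterval.le_of_ae_deriv_nonneg {f : ℝ → ℝ} {a b : ℝ}
    (hab : a ≤ b) (hf : AbsolutelyContinuousOnInterval f a b)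
    (h : ∀ᵐ t, t ∈ Ioo a b → ∀ e, HasDerivAt f e t → 0 ≤ e) : f a ≤ f b := by
  rw [← sub_nonneg, ← hf.integral_deriv_eq_sub]
  refine intervalIntegral.integral_nonneg_of_ae_restrict hab ?_
  rw [Filter.EventuallyLE, ← Measure.restrict_congr_set Ioo_ae_eq_Icc,
    ae_restrict_iff' measurableSet_Ioo]
  filter_upwards [h, hf.ae_differentiableAt] with t h1 h2 ht
  exact h1 ht _ (h2 (by rw [uIcc_of_le hab]; exact Ioo_subset_Icc_self ht)).hasDerivAt

/-- The density in `IsAC` may be negative; its absolute value is also a bound, and it is integrable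
on a bounded interval. -/
theorem IsAC.exists_integrableOn {Y : Type*} {p : ℝ≥0∞} {δ : Y → Y → ℝ≥0∞} {y : ℝ → Y} {a b : ℝ}
    (hp : 1 ≤ p) (h : IsAC p δ y (Icc a b)) :
    ∃ M : ℝ → ℝ, IntegrableOn M (Icc a b) ∧ (∀ r, 0 ≤ M r) ∧
      ∀ s ∈ Icc a b, ∀ t ∈ Icc a b, s ≤ t → δ (y s) (y t) ≤ ENNReal.ofReal (∫ r in s..t, M r) := by
  obtain ⟨m, hm, H⟩ := h
  have hi : IntegrableOn m (Icc a b) := hm.integrable hp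
  refine ⟨fun r => |m r|, hi.abs, fun r => abs_nonneg _, fun s hs t ht hst =>
    (H s hs t ht hst).trans (ENNReal.ofReal_le_ofReal ?_)⟩
  exact (le_abs_self _).trans (intervalIntegral.abs_integral_le_integral_abs hst)

theorem dist_le_of_edist_le_ofReal {X : Type*} [PseudoMetricSpace X] {x y : X} {r : ℝ}
    (hr : 0 ≤ r) (h : edist x y ≤ ENNReal.ofReal r) : dist x y ≤ r := by
  rwa [edist_dist, ENNReal.ofReal_le_ofReal_iff hr] at h

theorem IsAC.exists_dist_le {X : Type*} [PseudoMetricSpace X] {p : ℝ≥0∞} {y : ℝ → X} {a b : ℝ}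
    (hp : 1 ≤ p) (h : IsAC p edist y (Icc a b)) :
    ∃ M : ℝ → ℝ, IntegrableOn M (Icc a b) ∧ (∀ r, 0 ≤ M r) ∧
      ∀ s ∈ Icc a b, ∀ t ∈ Icc a b, s ≤ t → dist (y s) (y t) ≤ ∫ r in s..t, M r := by
  obtain ⟨M, h1, h2, h3⟩ := h.exists_integrableOn hp
  exact ⟨M, h1, h2, fun s hs t ht hst => dist_le_of_edist_le_ofReal
    (intervalIntegral.integral_nonneg hst fun _ _ => h2 _) (h3 s hs t ht hst)⟩

/-! ### Curves controlled by a dissipation inequality -/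

/-- A monotone function, possibly with jumps, sends disjoint intervals to disjoint intervals between
h(a) and h(b); their lengths add up. -/
theorem sum_abs_sub_le_of_mem_disjWithin {h : ℝ → ℝ} {a b : ℝ} (hab : a ≤ b)
    (hh : MonotoneOn h (Icc a b)) {E : ℕ × (ℕ → ℝ × ℝ)}
    (hE : E ∈ AbsolutelyContinuousOnInterval.disjWithin a b) :
    ∑ i ∈ Finset.range E.1, |h (E.2 i).1 - h (E.2 i).2| ≤ h b - h a := by
  obtain ⟨h1, h2⟩ := hE
  simp only [uIcc_of_le hab] at h1
  have hmin : ∀ s ∈ Icc a b, ∀ t ∈ Icc a b, min s t ∈ Icc a b := fun s hs t ht => by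
    rcases min_choice s t with h | h <;> rw [h] <;> assumption
  have hmax : ∀ s ∈ Icc a b, ∀ t ∈ Icc a b, max s t ∈ Icc a b := fun s hs t ht => by
    rcases max_choice s t with h | h <;> rw [h] <;> assumption
  have hdisj : Set.PairwiseDisjoint (Finset.range E.1 : Set ℕ)
      (fun i => uIoc (h (E.2 i).1) (h (E.2 i).2)) := by
    intro i hi j hj hij
    have h3 := h2 hi hj hij
    have ⟨i1, i2⟩ := h1 i hi
    have ⟨j1, j2⟩ := h1 j hj
    simp only [Function.onFun, uIoc, Ioc_disjoint_Ioc] at h3 ⊢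
    rw [← hh.map_min i1 i2, ← hh.map_min j1 j2, ← hh.map_max i1 i2, ← hh.map_max j1 j2,
      ← hh.map_min (hmax _ i1 _ i2) (hmax _ j1 _ j2), ← hh.map_max (hmin _ i1 _ i2) (hmin _ j1 _ j2)]
    exact hh (hmin _ (hmax _ i1 _ i2) _ (hmax _ j1 _ j2)) (hmax _ (hmin _ i1 _ i2) _ (hmin _ j1 _ j2)) h3
  have h4 := measure_biUnion_finset (μ := volume) hdisj (fun i _ => measurableSet_uIoc)
  have h5 : (⋃ i ∈ Finset.range E.1, uIoc (h (E.2 i).1) (h (E.2 i).2)) ⊆ Ioc (h a) (h b) := by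
    refine iUnion₂_subset fun i hi => ?_
    have ⟨i1, i2⟩ := h1 i hi
    rw [uIoc, ← hh.map_min i1 i2, ← hh.map_max i1 i2]
    exact Ioc_subset_Ioc (hh (left_mem_Icc.2 hab) (hmin _ i1 _ i2) (hmin _ i1 _ i2).1)
      (hh (hmax _ i1 _ i2) (right_mem_Icc.2 hab) (hmax _ i1 _ i2).2)
  have h6 := measure_mono (μ := volume) h5
  rw [h4] at h6
  simp only [Real.volume_uIoc, Real.volume_Ioc] at h6
  rw [← ENNReal.ofReal_sum_of_nonneg (fun _ _ => abs_nonneg _),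
    ENNReal.ofReal_le_ofReal_iff (sub_nonneg.2 (hh (left_mem_Icc.2 hab) (right_mem_Icc.2 hab) hab))]
    at h6
  simpa only [abs_sub_comm] using h6

/-- `|Δg|² ≤ 2 Δt Δh` with `h` monotone implies that `g` is absolutely continuous. -/
theorem absolutelyContinuousOnInterval_of_sq_le {g h : ℝ → ℝ} {a b : ℝ} (hab : a ≤ b)
    (hh : MonotoneOn h (Icc a b))
    (hg : ∀ s ∈ Icc a b, ∀ t ∈ Icc a b, s ≤ t → (g t - g s) ^ 2 ≤ 2 * (t - s) * (h t - h s)) :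
    AbsolutelyContinuousOnInterval g a b := by
  have hnn : 0 ≤ h b - h a := sub_nonneg.2 (hh (left_mem_Icc.2 hab) (right_mem_Icc.2 hab) hab)
  -- Young's inequality with a free weight. The total variation of `h` is finite, so a small `l`
  -- controls the second term, and then short intervals control the first.
  have key : ∀ l > 0, ∀ s ∈ Icc a b, ∀ t ∈ Icc a b,
      dist (g s) (g t) ≤ l⁻¹ * dist s t + l * |h s - h t| := by
    have h1 : ∀ l > 0, ∀ s ∈ Icc a b, ∀ t ∈ Icc a b, s ≤ t →
        dist (g s) (g t) ≤ l⁻¹ * dist s t + l * |h s - h t| := by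
      intro l hl s hs t ht hst
      have h2 := hg s hs t ht hst
      have h3 := hh hs ht hst
      rw [dist_comm, dist_comm s, abs_sub_comm, Real.dist_eq, Real.dist_eq,
        abs_of_nonneg (sub_nonneg.2 hst), abs_of_nonneg (sub_nonneg.2 h3)]
      have hA : 0 ≤ l⁻¹ * (t - s) := mul_nonneg (inv_nonneg.2 hl.le) (sub_nonneg.2 hst)
      have hB : 0 ≤ l * (h t - h s) := mul_nonneg hl.le (sub_nonneg.2 h3)
      have hAB : l⁻¹ * (t - s) * (l * (h t - h s)) = (t - s) * (h t - h s) := by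
        field_simp
      refine abs_le_of_sq_le_sq ?_ (add_nonneg hA hB)
      nlinarith [sq_nonneg (l⁻¹ * (t - s)), sq_nonneg (l * (h t - h s))]
    intro l hl s hs t ht
    rcases le_total s t with hst | hst
    · exact h1 l hl s hs t ht hst
    · rw [dist_comm, dist_comm s, abs_sub_comm]
      exact h1 l hl t ht s hs hst
  rw [absolutelyContinuousOnInterval_iff]
  intro η hη
  set l : ℝ := η / (2 * (h b - h a + 1)) with hl
  have hlpos : 0 < l := by positivity
  refine ⟨l * (η / 2), by positivity, fun E hE hlt => ?_⟩
  have h1 := hE.1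
  rw [uIcc_of_le hab] at h1
  calc ∑ i ∈ Finset.range E.1, dist (g (E.2 i).1) (g (E.2 i).2)
      ≤ ∑ i ∈ Finset.range E.1,
        (l⁻¹ * dist (E.2 i).1 (E.2 i).2 + l * |h (E.2 i).1 - h (E.2 i).2|) :=
        Finset.sum_le_sum fun i hi => key l hlpos _ (h1 i hi).1 _ (h1 i hi).2
    _ = l⁻¹ * ∑ i ∈ Finset.range E.1, dist (E.2 i).1 (E.2 i).2 +
        l * ∑ i ∈ Finset.range E.1, |h (E.2 i).1 - h (E.2 i).2| := by
        rw [Finset.sum_add_distrib, Finset.mul_sum, Finset.mul_sum]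
    _ < η / 2 + l * (h b - h a) := by
        refine add_lt_add_of_lt_of_le ?_ (mul_le_mul_of_nonneg_left
          (sum_abs_sub_le_of_mem_disjWithin hab hh hE) hlpos.le)
        rwa [inv_mul_lt_iff₀ hlpos]
    _ ≤ η / 2 + l * (h b - h a + 1) := by gcongr; linarith
    _ = η := by rw [hl]; field_simp; norm_num

theorem ae_differentiableAt_of_monotoneOn {h : ℝ → ℝ} {a b : ℝ} (hh : MonotoneOn h (Icc a b)) :
    ∀ᵐ t, t ∈ Ioo a b → DifferentiableAt ℝ h t := by
  filter_upwards [hh.ae_differentiableWithinAt_of_mem] with t h1 ht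
  exact (h1 (Ioo_subset_Icc_self ht)).differentiableAt (Icc_mem_nhds ht.1 ht.2)

theorem sq_deriv_le_of_sq_le {g h : ℝ → ℝ} {g' h' a b t : ℝ}
    (hg : ∀ s ∈ Icc a b, ∀ t ∈ Icc a b, s ≤ t → (g t - g s) ^ 2 ≤ 2 * (t - s) * (h t - h s))
    (ht : t ∈ Ioo a b) (h1 : HasDerivAt g g' t) (h2 : HasDerivAt h h' t) : g' ^ 2 ≤ 2 * h' := by
  have a1 : Tendsto (slope g t) (𝓝[>] t) (𝓝 g') :=
    (hasDerivAt_iff_tendsto_slope.1 h1).mono_left (nhdsWithin_mono _ fun s hs => (ne_of_gt hs))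
  have a2 : Tendsto (slope h t) (𝓝[>] t) (𝓝 h') :=
    (hasDerivAt_iff_tendsto_slope.1 h2).mono_left (nhdsWithin_mono _ fun s hs => (ne_of_gt hs))
  refine le_of_tendsto_of_tendsto (a1.pow 2) (a2.const_mul 2) ?_
  filter_upwards [Ioo_mem_nhdsGT ht.2] with s hs
  have hpos : 0 < s - t := sub_pos.2 hs.1
  have := hg t (Ioo_subset_Icc_self ht) s ⟨ht.1.le.trans hs.1.le, hs.2.le⟩ hs.1.le
  rw [slope_def_field, slope_def_field, div_pow, div_le_iff₀ (by positivity)]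
  calc _ ≤ _ := this
    _ = _ := by field_simp

/-- The density is √(2|h'|), square integrable because a monotone function has an integrable
derivative. A singular part of `h` is harmless: scalar projections of `y` are absolutely continuous,
so only a.e. derivatives count. -/
theorem exists_memLp_two_of_norm_sq_le {E : Type*} [NormedAddCommGroup E] [InnerProductSpace ℝ E]
    {y : ℝ → E} {h : ℝ → ℝ} {a b : ℝ} (hab : a ≤ b) (hh : MonotoneOn h (Icc a b))
    (hy : ∀ s ∈ Icc a b, ∀ t ∈ Icc a b, s ≤ t → ‖y t - y s‖ ^ 2 ≤ 2 * (t - s) * (h t - h s)) :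
    ∃ m : ℝ → ℝ, MemLp m 2 (volume.restrict (Icc a b)) ∧
      ∀ s ∈ Icc a b, ∀ t ∈ Icc a b, s ≤ t → ‖y t - y s‖ ≤ ∫ r in s..t, m r := by
  have hint : IntegrableOn (deriv h) (Icc a b) := by
    have := MonotoneOn.intervalIntegrable_deriv (f := h) (a := a) (b := b)
      (by rwa [uIcc_of_le hab])
    rwa [intervalIntegrable_iff_integrableOn_Icc_of_le hab] at this
  set m : ℝ → ℝ := fun r => Real.sqrt (2 * |deriv h r|) with hm
  have hmL : MemLp m 2 (volume.restrict (Icc a b)) := by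
    refine (memLp_two_iff_integrable_sq ?_).2 ?_
    · exact (((measurable_deriv h).abs.const_mul 2).sqrt).aestronglyMeasurable
    · refine (hint.abs.const_mul 2).congr (ae_of_all _ fun r => ?_)
      exact (Real.sq_sqrt (by positivity)).symm
  refine ⟨m, hmL, fun s hs t ht hst => ?_⟩
  have hmi : IntegrableOn m (Icc a b) := hmL.integrable (by norm_num)
  by_cases h0 : y t - y s = 0
  · rw [h0, norm_zero]
    exact intervalIntegral.integral_nonneg hst fun _ _ => Real.sqrt_nonneg _
  -- Projecting on the direction of this increment recovers its full norm from a real-valued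
  -- function.
  set e : E := ‖y t - y s‖⁻¹ • (y t - y s) with he
  have hne : ‖y t - y s‖ ≠ 0 := norm_ne_zero_iff.2 h0
  have hen : ‖e‖ = 1 := by
    rw [he, norm_smul, norm_inv, norm_norm, inv_mul_cancel₀ hne]
  set g : ℝ → ℝ := fun r => inner ℝ e (y r) with hg
  have hgy : ∀ r ∈ Icc a b, ∀ r' ∈ Icc a b, r ≤ r' →
      (g r' - g r) ^ 2 ≤ 2 * (r' - r) * (h r' - h r) := fun r hr r' hr' hrr => by
    refine le_trans ?_ (hy r hr r' hr' hrr)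
    rw [hg, ← inner_sub_right, ← sq_abs]
    have := abs_real_inner_le_norm e (y r' - y r)
    rw [hen, one_mul] at this
    gcongr
  have hac := absolutelyContinuousOnInterval_of_sq_le hab hh hgy
  have hac' : AbsolutelyContinuousOnInterval g s t := hac.mono (by
    rw [uIcc_of_le hab, uIcc_of_le hst]; exact Icc_subset_Icc hs.1 ht.2)
  have e1 : ‖y t - y s‖ = ∫ r in s..t, deriv g r := by
    rw [hac'.integral_deriv_eq_sub, hg, ← inner_sub_right, he, real_inner_smul_left,
      real_inner_self_eq_norm_sq]
    field_simp
  rw [e1]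
  refine intervalIntegral.integral_mono_ae_restrict hst hac'.intervalIntegrable_deriv
    ((intervalIntegrable_iff_integrableOn_Icc_of_le hst).2
      (hmi.mono_set (Icc_subset_Icc hs.1 ht.2))) ?_
  rw [Filter.EventuallyLE, ← Measure.restrict_congr_set Ioo_ae_eq_Icc,
    ae_restrict_iff' measurableSet_Ioo]
  filter_upwards [hac.ae_differentiableAt, ae_differentiableAt_of_monotoneOn hh] with r h1 h2 hr
  have hr' : r ∈ Ioo a b := ⟨hs.1.trans_lt hr.1, hr.2.trans_le ht.2⟩
  have h3 := h1 (by rw [uIcc_of_le hab]; exact Ioo_subset_Icc_self hr')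
  have h4 := sq_deriv_le_of_sq_le hgy hr' h3.hasDerivAt (h2 hr').hasDerivAt
  exact Real.le_sqrt_of_sq_le (h4.trans (by gcongr; exact le_abs_self _))

/-! ### Gradient flows of convex potentials -/

section GradientFlow

variable {d : ℕ} {K : Set (EuclideanSpace ℝ (Fin d))} [CompactSpace K]

omit [CompactSpace K] in
/-- The resolvent inequality of the implicit Euler scheme. -/
theorem IsConvexFun.resolvent_le (hconv : Convex ℝ K) {V : C(K, ℝ)} (hV : IsConvexFun V)
    {τ : ℝ} (hτ : 0 < τ) {x z : K}
    (hz : ∀ y : K, V z + dist x z ^ 2 / (2 * τ) ≤ V y + dist x y ^ 2 / (2 * τ)) (y : K) :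
    dist z y ^ 2 ≤ dist x y ^ 2 + 2 * τ * (V y - V z) := by
  set X : EuclideanSpace ℝ (Fin d) := x.1
  set Z : EuclideanSpace ℝ (Fin d) := z.1
  set Y : EuclideanSpace ℝ (Fin d) := y.1
  set q : ℝ := inner ℝ (X - Z) (Y - Z) with hq
  -- First-order optimality of `z`: compare it with (1 - l)z + ly, use convexity, divide by l, and
  -- later let l tend to 0.
  have key : ∀ l ∈ Ioc (0 : ℝ) 1, 2 * q ≤ 2 * τ * (V y - V z) + l * ‖Y - Z‖ ^ 2 := by
    intro l hl
    have hw : (1 - l) • Z + l • Y ∈ K :=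
      hconv z.2 y.2 (sub_nonneg.2 hl.2) hl.1.le (by ring)
    have h1 := hz ⟨_, hw⟩
    have h2 := hV z y ⟨_, hw⟩ (1 - l) l (sub_nonneg.2 hl.2) hl.1.le (by ring) rfl
    have h3 : dist x ⟨_, hw⟩ ^ 2 = dist x z ^ 2 - 2 * l * q + l ^ 2 * ‖Y - Z‖ ^ 2 := by
      rw [Subtype.dist_eq, Subtype.dist_eq, dist_eq_norm, dist_eq_norm]
      change ‖X - ((1 - l) • Z + l • Y)‖ ^ 2 = ‖X - Z‖ ^ 2 - _ + _
      rw [show X - ((1 - l) • Z + l • Y) = (X - Z) - l • (Y - Z) by module, norm_sub_sq_real,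
        norm_smul, real_inner_smul_right, mul_pow, Real.norm_eq_abs, sq_abs]
      ring
    rw [h3] at h1
    have h4 : dist x z ^ 2 / (2 * τ) ≤ l * (V y - V z) +
        (dist x z ^ 2 - 2 * l * q + l ^ 2 * ‖Y - Z‖ ^ 2) / (2 * τ) := by linarith
    rw [← sub_nonneg] at h4
    have h5 : l * (V y - V z) + (dist x z ^ 2 - 2 * l * q + l ^ 2 * ‖Y - Z‖ ^ 2) / (2 * τ) -
        dist x z ^ 2 / (2 * τ) =
        l / (2 * τ) * (2 * τ * (V y - V z) + l * ‖Y - Z‖ ^ 2 - 2 * q) := by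
      field_simp; ring
    rw [h5] at h4
    have := nonneg_of_mul_nonneg_right h4 (div_pos hl.1 (by positivity))
    linarith
  have h0 : 2 * q ≤ 2 * τ * (V y - V z) := by
    have h1 : Tendsto (fun l : ℝ => 2 * τ * (V y - V z) + l * ‖Y - Z‖ ^ 2) (𝓝[>] 0)
        (𝓝 (2 * τ * (V y - V z) + 0 * ‖Y - Z‖ ^ 2)) :=
      ((continuous_const.add (continuous_id.mul continuous_const)).tendsto' 0 _ rfl).mono_left
        nhdsWithin_le_nhds
    rw [zero_mul, add_zero] at h1
    exact ge_of_tendsto h1 (by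
      filter_upwards [Ioc_mem_nhdsGT zero_lt_one] with l hl using key l hl)
  have h1 : dist x y ^ 2 = dist x z ^ 2 - 2 * q + dist z y ^ 2 := by
    rw [Subtype.dist_eq, Subtype.dist_eq, Subtype.dist_eq, dist_eq_norm, dist_eq_norm,
      dist_eq_norm]
    change ‖X - Y‖ ^ 2 = ‖X - Z‖ ^ 2 - _ + ‖Z - Y‖ ^ 2
    rw [show X - Y = (X - Z) - (Y - Z) by abel, norm_sub_sq_real, norm_sub_rev Z]
  nlinarith [sq_nonneg (dist x z)]

theorem exists_isMinOn_implicit_euler (V : C(K, ℝ)) (τ : ℝ) (x : K) :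
    ∃ z : K, ∀ y : K, V z + dist x z ^ 2 / (2 * τ) ≤ V y + dist x y ^ 2 / (2 * τ) := by
  have hc : Continuous fun y : K => V y + dist x y ^ 2 / (2 * τ) := by fun_prop
  obtain ⟨z, -, hz⟩ := isCompact_univ.exists_isMinOn ⟨x, mem_univ x⟩ hc.continuousOn
  exact ⟨z, fun y => hz (mem_univ y)⟩

/-- The implicit Euler scheme satisfies a discrete evolution variational inequality. -/
theorem exists_discrete_evi (hconv : Convex ℝ K) {V : C(K, ℝ)} (hV : IsConvexFun V) {τ : ℝ}
    (hτ : 0 < τ) (x₀ : K) :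
    ∃ X : ℕ → K, X 0 = x₀ ∧ ∀ j n y, dist (X (j + n)) y ^ 2 ≤
      dist (X j) y ^ 2 + 2 * (τ * n) * (V y - V (X (j + n))) := by
  choose J hJ using exists_isMinOn_implicit_euler V τ
  set X : ℕ → K := fun n => J^[n] x₀ with hX
  have hsucc : ∀ n, X (n + 1) = J (X n) := fun n => Function.iterate_succ_apply' J n x₀
  have hdec : ∀ n, V (X (n + 1)) ≤ V (X n) := by
    intro n
    have := hJ (X n) (X n)
    rw [dist_self, ← hsucc] at this
    have h2 : 0 ≤ dist (X n) (X (n + 1)) ^ 2 / (2 * τ) := by positivity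
    simp only [ne_eq, OfNat.ofNat_ne_zero, not_false_eq_true, zero_pow, zero_div, add_zero] at this
    linarith
  refine ⟨X, rfl, fun j n y => ?_⟩
  induction n with
  | zero => simp
  | succ n ih =>
    have h1 := hV.resolvent_le hconv hτ (hJ (X (j + n))) y
    rw [← hsucc] at h1
    have h2 := mul_le_mul_of_nonneg_left (hdec (j + n)) (by positivity : 0 ≤ 2 * (τ * n))
    rw [← add_assoc]
    push_cast
    nlinarith

/-- A convex potential has, from every starting point, a curve satisfying the evolution variational
inequality. -/
theorem exists_evi (hconv : Convex ℝ K) {V : C(K, ℝ)} (hV : IsConvexFun V) (x₀ : K) :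
    ∃ x : ℝ → K, x 0 = x₀ ∧ ∀ s t, 0 ≤ s → s ≤ t → ∀ y,
      dist (x t) y ^ 2 ≤ dist (x s) y ^ 2 + 2 * (t - s) * (V y - V (x t)) := by
  have hτ : ∀ n : ℕ, (0 : ℝ) < 1 / ((n : ℝ) + 1) := fun n => by positivity
  choose X hX0 hX using fun n : ℕ => exists_discrete_evi hconv hV (hτ n) x₀
  set N : ℝ → ℕ → ℕ := fun t n => ⌊t * ((n : ℝ) + 1)⌋₊ with hN
  -- One ultrafilter serves all times at once, so neither a common subsequence nor equicontinuity is
  -- needed; the closed inequality passes to the limit.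
  have hlim : ∀ t, ∃ z : K, Tendsto (fun n => X n (N t n)) (hyperfilter ℕ : Filter ℕ) (𝓝 z) := by
    intro t
    obtain ⟨z, -, hz⟩ := isCompact_univ.ultrafilter_le_nhds
      ((hyperfilter ℕ).map fun n => X n (N t n)) (by simp)
    exact ⟨z, hz⟩
  choose x hx using hlim
  have hN' : ∀ t, 0 ≤ t → Tendsto (fun n : ℕ => 1 / ((n : ℝ) + 1) * N t n)
      (hyperfilter ℕ : Filter ℕ) (𝓝 t) := by
    intro t ht
    have h1 : Tendsto (fun n : ℕ => (n : ℝ) + 1) atTop atTop :=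
      tendsto_atTop_add_const_right _ _ tendsto_natCast_atTop_atTop
    have h2 := (tendsto_nat_floor_mul_div_atTop ht).comp h1
    refine (h2.congr fun n => ?_).mono_left (Nat.cofinite_eq_atTop ▸ hyperfilter_le_cofinite)
    simp only [Function.comp, hN]
    ring
  refine ⟨x, ?_, fun s t hs hst y => ?_⟩
  · refine tendsto_nhds_unique (hx 0) (tendsto_const_nhds.congr fun n => ?_)
    simp [hN, hX0]
  · have hle : ∀ n, N s n ≤ N t n := fun n => Nat.floor_le_floor (by gcongr)
    have hstep : ∀ n, dist (X n (N t n)) y ^ 2 ≤ dist (X n (N s n)) y ^ 2 +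
        2 * (1 / ((n : ℝ) + 1) * N t n - 1 / ((n : ℝ) + 1) * N s n) * (V y - V (X n (N t n))) := by
      intro n
      have := hX n (N s n) (N t n - N s n) y
      rw [Nat.add_sub_cancel' (hle n), Nat.cast_sub (hle n)] at this
      rwa [← mul_sub]
    refine le_of_tendsto_of_tendsto' (((hx t).dist tendsto_const_nhds).pow 2)
      ((((hx s).dist tendsto_const_nhds).pow 2).add
        ((((hN' t (hs.trans hst)).sub (hN' s hs)).const_mul 2).mul
          (tendsto_const_nhds.sub ((V.continuous.tendsto _).comp (hx t))))) hstep

omit [CompactSpace K] in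
theorem ae_differentiableAt_of_isACLoc {x : ℝ → K} (h : IsACLoc 1 edist x (Ici 0)) :
    ∀ᵐ t ∂(volume.restrict (Ici (0 : ℝ))),
      DifferentiableAt ℝ (fun s => (x s : EuclideanSpace ℝ (Fin d))) t := by
  have h1 : ∀ n : ℕ, ∀ᵐ t, t ∈ Icc (0 : ℝ) n →
      DifferentiableAt ℝ (fun s => (x s : EuclideanSpace ℝ (Fin d))) t := by
    intro n
    obtain ⟨M, hM, -, hx⟩ := (h 0 n Icc_subset_Ici_self).exists_dist_le le_rfl
    have hi : ∀ i : Fin d, ∀ᵐ t, t ∈ Icc (0 : ℝ) n →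
        DifferentiableAt ℝ (fun s => (x s : EuclideanSpace ℝ (Fin d)) i) t := by
      intro i
      have hac := absolutelyContinuousOnInterval_of_dist_le
        (f := fun s => (x s : EuclideanSpace ℝ (Fin d)) i) n.cast_nonneg hM
        fun s hs t ht hst => (le_trans (by
          rw [Subtype.dist_eq, dist_eq_norm, dist_eq_norm]
          exact PiLp.norm_apply_le ((x s : EuclideanSpace ℝ (Fin d)) - (x t : EuclideanSpace ℝ (Fin d))) i)
          (hx s hs t ht hst))
      have := hac.ae_differentiableAt
      rwa [uIcc_of_le n.cast_nonneg] at this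
    filter_upwards [ae_all_iff.2 hi] with t ht htn
    exact differentiableAt_euclidean.2 fun i => ht i htn
  rw [ae_restrict_iff' measurableSet_Ici]
  filter_upwards [ae_all_iff.2 h1] with t ht ht0
  exact ht _ ⟨ht0, Nat.le_ceil t⟩

theorem ae_restrict_Ici_pos : ∀ᵐ t ∂(volume.restrict (Ici (0 : ℝ))), 0 < t := by
  rw [← Measure.restrict_congr_set Ioi_ae_eq_Ici]
  exact ae_restrict_mem measurableSet_Ioi

/-- Taking y = x_s in the variational inequality bounds |x_t - x_s|² by 2(t - s)(V(x_s) - V(x_t)),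
which yields monotonicity of V and an L² density. Dividing the inequality by the time step yields
the subgradient inclusion. -/
theorem exists_isGradientFlow (hconv : Convex ℝ K) {V : C(K, ℝ)} (hV : IsConvexFun V) (x₀ : K) :
    ∃ x : ℝ → K, IsGradientFlow V x₀ x ∧ IsACLoc 2 edist x (Ici 0) := by
  obtain ⟨x, hx0, hx⟩ := exists_evi hconv hV x₀
  have hsq : ∀ s t, 0 ≤ s → s ≤ t → dist (x t) (x s) ^ 2 ≤ 2 * (t - s) * (V (x s) - V (x t)) :=
    fun s t hs hst => by simpa using hx s t hs hst (x s)
  have hanti : ∀ s t, 0 ≤ s → s ≤ t → V (x t) ≤ V (x s) := by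
    intro s t hs hst
    rcases hst.eq_or_lt with rfl | h
    · exact le_rfl
    · have h1 := (sq_nonneg _).trans (hsq s t hs hst)
      have := nonneg_of_mul_nonneg_right h1 (by linarith)
      linarith
  have hac2 : IsACLoc 2 edist x (Ici 0) := by
    intro a b hab
    rcases lt_or_ge b a with h | h
    · refine ⟨0, MemLp.zero, fun s hs => ?_⟩
      rw [Icc_eq_empty (not_le.2 h)] at hs
      exact hs.elim
    have hnn : ∀ s ∈ Icc a b, 0 ≤ s := fun s hs => hab hs
    obtain ⟨m, hm, H⟩ := exists_memLp_two_of_norm_sq_le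
      (y := fun t => (x t : EuclideanSpace ℝ (Fin d))) (h := fun t => -V (x t)) h
      (fun s hs t ht hst => neg_le_neg (hanti s t (hnn s hs) hst)) fun s hs t ht hst => by
        have := hsq s t (hnn s hs) hst
        rw [Subtype.dist_eq, dist_eq_norm] at this
        linarith
    refine ⟨m, hm, fun s hs t ht hst => ?_⟩
    rw [edist_comm, edist_dist, Subtype.dist_eq, dist_eq_norm]
    exact ENNReal.ofReal_le_ofReal (H s hs t ht hst)
  have hac1 : IsACLoc 1 edist x (Ici 0) := fun a b hab => by
    obtain ⟨m, hm, H⟩ := hac2 a b hab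
    exact ⟨m, hm.mono_exponent (by norm_num), H⟩
  refine ⟨x, ⟨hac1, hx0, ?_⟩, hac2⟩
  filter_upwards [ae_differentiableAt_of_isACLoc hac1, ae_restrict_Ici_pos] with t ht htpos
  refine ⟨_, ht.hasDerivAt.hasDerivWithinAt, fun y => ?_⟩
  set v := deriv (fun s => (x s : EuclideanSpace ℝ (Fin d))) t
  have hcx : ContinuousAt x t := by
    rw [Topology.IsInducing.subtypeVal.continuousAt_iff]; exact ht.continuousAt
  have hd : HasDerivAt (fun s => ‖(x s : EuclideanSpace ℝ (Fin d)) - y‖ ^ 2)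
      (2 * inner ℝ ((x t : EuclideanSpace ℝ (Fin d)) - y) v) t :=
    (ht.hasDerivAt.sub_const (y : EuclideanSpace ℝ (Fin d))).norm_sq
  have h1 : Tendsto (slope (fun s => ‖(x s : EuclideanSpace ℝ (Fin d)) - y‖ ^ 2) t) (𝓝[>] t)
      (𝓝 (2 * inner ℝ ((x t : EuclideanSpace ℝ (Fin d)) - y) v)) :=
    (hasDerivAt_iff_tendsto_slope.1 hd).mono_left (nhdsWithin_mono _ fun s hs => (ne_of_gt hs))
  have h2 : Tendsto (fun r => 2 * (V y - V (x r))) (𝓝[>] t) (𝓝 (2 * (V y - V (x t)))) :=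
    ((tendsto_const_nhds.sub ((V.continuous.tendsto _).comp hcx.tendsto)).const_mul 2).mono_left
      nhdsWithin_le_nhds
  have h3 := le_of_tendsto_of_tendsto h1 h2 (by
    filter_upwards [self_mem_nhdsWithin] with r hr
    have hr' : t < r := hr
    have h4 := hx t r htpos.le hr'.le y
    rw [slope_def_field, div_le_iff₀ (sub_pos.2 hr')]
    rw [Subtype.dist_eq, Subtype.dist_eq, dist_eq_norm, dist_eq_norm] at h4
    linarith)
  rw [inner_neg_left, real_inner_comm, ← neg_sub (x t : EuclideanSpace ℝ (Fin d)), inner_neg_left]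
  linarith

/-- Gradient flows contract. -/
theorem IsGradientFlow.eqOn {V : C(K, ℝ)} {x₀ : K} {x x' : ℝ → K} (h : IsGradientFlow V x₀ x)
    (h' : IsGradientFlow V x₀ x') : EqOn x' x (Ici 0) := by
  intro T hT
  have hT : 0 ≤ T := hT
  obtain ⟨M, hM, -, hx⟩ := (h.ac 0 T Icc_subset_Ici_self).exists_dist_le le_rfl
  obtain ⟨M', hM', -, hx'⟩ := (h'.ac 0 T Icc_subset_Ici_self).exists_dist_le le_rfl
  set z : ℝ → EuclideanSpace ℝ (Fin d) := fun t => (x t).1 - (x' t).1 with hz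
  set D : ℝ := Metric.diam (univ : Set K) with hD
  have hzD : ∀ t, ‖z t‖ ≤ D := fun t => by
    rw [hz, ← dist_eq_norm, ← Subtype.dist_eq]
    exact Metric.dist_le_diam_of_mem isCompact_univ.isBounded (mem_univ _) (mem_univ _)
  have hD0 : 0 ≤ D := Metric.diam_nonneg
  -- Adding the two subgradient inequalities, each tested at the other curve, shows that this
  -- function has nonnegative derivative a.e.
  have hac : AbsolutelyContinuousOnInterval (fun t => -‖z t‖ ^ 2) 0 T := by
    refine absolutelyContinuousOnInterval_of_dist_le hT
      (M := fun r => 2 * D * (M r + M' r)) ((hM.add hM').const_mul _) fun s hs t ht hst => ?_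
    have i1 : IntervalIntegrable M volume s t :=
      (intervalIntegrable_iff_integrableOn_Icc_of_le hst).2
        (hM.mono_set (Icc_subset_Icc hs.1 ht.2))
    have i2 : IntervalIntegrable M' volume s t :=
      (intervalIntegrable_iff_integrableOn_Icc_of_le hst).2
        (hM'.mono_set (Icc_subset_Icc hs.1 ht.2))
    rw [intervalIntegral.integral_const_mul, intervalIntegral.integral_add i1 i2]
    have e1 : ‖z s - z t‖ ≤ dist (x s) (x t) + dist (x' s) (x' t) := by
      have : z s - z t = ((x s).1 - (x t).1) - ((x' s).1 - (x' t).1) := sub_sub_sub_comm _ _ _ _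
      rw [Subtype.dist_eq, Subtype.dist_eq, dist_eq_norm, dist_eq_norm, this]
      exact norm_sub_le _ _
    have e2 : dist (-‖z s‖ ^ 2) (-‖z t‖ ^ 2) ≤ 2 * D * ‖z s - z t‖ := by
      rw [Real.dist_eq, show -‖z s‖ ^ 2 - -‖z t‖ ^ 2 = (‖z t‖ + ‖z s‖) * (‖z t‖ - ‖z s‖) by ring,
        abs_mul, abs_of_nonneg (by positivity)]
      refine mul_le_mul (by linarith [hzD s, hzD t]) ?_ (abs_nonneg _) (by positivity)
      rw [norm_sub_rev (z s)]
      exact abs_norm_sub_norm_le (z t) (z s)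
    exact e2.trans (mul_le_mul_of_nonneg_left (e1.trans
      (add_le_add (hx s hs t ht hst) (hx' s hs t ht hst))) (by positivity))
  have hle := hac.le_of_ae_deriv_nonneg hT (by
    have h1 := (ae_restrict_iff' measurableSet_Ici).1 h.inclusion
    have h2 := (ae_restrict_iff' measurableSet_Ici).1 h'.inclusion
    filter_upwards [h1, h2] with t h1 h2 ht e he
    obtain ⟨v, hv, hv'⟩ := h1 ht.1.le
    obtain ⟨w, hw, hw'⟩ := h2 ht.1.le
    have hzd : HasDerivAt z (v - w) t :=
      (hv.hasDerivAt (Ici_mem_nhds ht.1)).sub (hw.hasDerivAt (Ici_mem_nhds ht.1))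
    have hd : HasDerivAt (fun t => -‖z t‖ ^ 2) (-(2 * inner ℝ (z t) (v - w))) t := hzd.norm_sq.neg
    rw [he.unique hd]
    have e1 := hv' (x' t)
    have e2 := hw' (x t)
    rw [inner_neg_left] at e1 e2
    rw [inner_sub_right, real_inner_comm, real_inner_comm w]
    rw [← neg_sub (x t : EuclideanSpace ℝ (Fin d)), inner_neg_right] at e1
    linarith)
  have h0 : z 0 = 0 := by simp only [hz, h.init, h'.init, sub_self]
  rw [h0] at hle
  have : ‖z T‖ = 0 := by
    have : ‖z T‖ ^ 2 ≤ 0 := by simpa using hle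
    exact pow_eq_zero_iff two_ne_zero |>.1 (le_antisymm this (sq_nonneg _))
  exact Subtype.ext (sub_eq_zero.1 (norm_eq_zero.1 this)).symm

end GradientFlow

/-! ### The Sinkhorn potential flow of a Dirac mass -/

section DiracFlow

variable {d : ℕ} {K : Set (EuclideanSpace ℝ (Fin d))} [CompactSpace K] {ε : ℝ}
  [hε : Fact (0 < ε)]

theorem isSinkhornPotentialFlow_diracProba (hconv : Convex ℝ K) {V : C(K, ℝ)} {x₀ : K} {x : ℝ → K}
    (hx : IsGradientFlow V x₀ x) (hx2 : IsACLoc 2 edist x (Ici 0)) :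
    IsSinkhornPotentialFlow ε V (diracProba x₀) (fun t => diracProba (x t)) := by
  have hε' := hε.out
  refine ⟨fun a b hab => (hx2 a b hab).of_le zero_le_one fun s _ t _ => ?_, by rw [hx.init], ?_⟩
  · rw [ENNReal.ofReal_one, one_mul]
    exact dS_diracProba_le ε hconv _ _
  · filter_upwards [hx.inclusion, ae_restrict_mem measurableSet_Ici] with t ht ht0
    obtain ⟨v, hv, hv'⟩ := ht
    obtain ⟨σ, h1, h2, h3, -⟩ := exists_isVelocity_diracProba ε (uniqueDiffOn_Ici 0 t ht0) hv
    refine ⟨σ, h1, ⟨riesz ε σ, continuous_apply (continuous_kself ε _) _⟩, h3,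
      -- The pressure is minus the gap in the subgradient inequality; it is nonpositive and vanishes
      -- at x_t.
      ⟨fun y => V (x t) - V y - inner ℝ v ((y : EuclideanSpace ℝ (Fin d)) - x t), by fun_prop⟩,
      ⟨fun y => ?_, fun y hy => ?_⟩, V (x t), fun y => ?_⟩
    · have := hv' y
      rw [inner_neg_left] at this
      simp only [ContinuousMap.coe_mk]
      linarith
    · change y ∈ (Measure.dirac (x t)).support at hy
      rw [support_dirac, mem_singleton_iff] at hy
      simp [hy]
    · simp only [ContinuousMap.coe_mk, h2]
      field_simp
      ring

/-- The measure b⁻¹μ has kernel mean b = k_c(x, ·), so it is δ_x. Its density is positive, hence μ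
is concentrated at x too. -/
theorem eq_diracProba_of_bfun_eq (hconv : Convex ℝ K) {μ : ProbabilityMeasure K} {x : K}
    (h : ∀ y, bfun ε μ y = kc ε x y) : μ = diracProba x := by
  have hpos := bfun_pos ε μ
  have hc : Continuous fun y => (bfun ε μ y)⁻¹ := continuous_inv_bfun ε μ
  have hi : Integrable (fun y => (bfun ε μ y)⁻¹) (μ : Measure K) := integrable_of_continuous _ hc
  set ν : Measure K := (μ : Measure K).withDensity fun y => ENNReal.ofReal (bfun ε μ y)⁻¹ with hν
  have : IsFiniteMeasure ν := isFiniteMeasure_withDensity_ofReal hi.2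
  have hνx : ν = Measure.dirac x := by
    refine eq_dirac_of_integral_kc_eq hconv hε.out ν x fun y => ?_
    rw [hν, integral_withDensity_eq_integral_toReal_smul hc.measurable.ennreal_ofReal
      (ae_of_all _ fun _ => ENNReal.ofReal_lt_top), ← h y, bfun_eq_integral]
    refine integral_congr_ae (ae_of_all _ fun z => ?_)
    simp only [smul_eq_mul]
    rw [ENNReal.toReal_ofReal (inv_nonneg.2 (hpos z).le), mul_comm]
  have hac : (μ : Measure K) ≪ ν := withDensity_absolutelyContinuous'
    hc.measurable.ennreal_ofReal.aemeasurable
    (ae_of_all _ fun z => (ENNReal.ofReal_pos.2 (inv_pos.2 (hpos z))).ne')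
  have hae : ∀ᵐ z ∂(μ : Measure K), z = x := hac.ae_le (by rw [hνx, ae_dirac_eq]; simp)
  refine Subtype.ext ?_
  change (μ : Measure K) = Measure.dirac x
  calc (μ : Measure K) = (μ : Measure K).map id := Measure.map_id.symm
    _ = (μ : Measure K).map fun _ => x := Measure.map_congr hae
    _ = Measure.dirac x := by rw [Measure.map_const, measure_univ, one_smul]

/-- First variation of `embB μ` at the potential of a solution of the inclusion. -/
theorem le_limit_of_inclusion {V : C(K, ℝ)} {μ : ProbabilityMeasure K}
    {σ : StrongDual ℝ (Hself ε μ)} (hσ : ∀ φ : Hself ε μ, (∀ y, φ y = 1) → σ φ = 0)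
    {φ p : C(K, ℝ)} (hφ : IsInvIdSubKSq ε μ φ (riesz ε σ)) (hp : p ∈ pressures (μ : Measure K))
    {a : ℝ} (hVp : ∀ y, ε / 2 * φ y + V y + p y = a) {w : C(K, ℝ)}
    (hw : ∀ y, w y / bfun ε μ y + Kop ε μ (fun x => w x / bfun ε μ x) y = riesz ε σ y) (x : K) :
    2 / ε * ∫ y, kc ε y x * (bfun ε μ y)⁻¹ * (V y - V x) ∂(μ : Measure K) ≤ w x := by
  have hε' := hε.out
  have hb := bfun_pos ε μ
  obtain ⟨a', ha'⟩ := hφ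
  have hwc : Continuous fun y => w y / bfun ε μ y := by
    simp_rw [div_eq_mul_inv]
    exact w.continuous.mul (continuous_inv_bfun ε μ)
  have hu := (eq_sub_Kop_of_add_Kop_eq_riesz hσ hwc φ.continuous hw ha').2 x
  have hφe : ∀ y, φ y = 2 / ε * a - 2 / ε * (V y + p y) := fun y => by
    have := hVp y
    field_simp
    linarith
  -- The pressure vanishes on the support, so it disappears under K_μ and survives only as -p(x) ≥
  -- 0.
  have hKp : Kop ε μ (fun y => V y + p y) x = Kop ε μ V x := by
    rw [Kop, Kop]
    refine integral_congr_ae ?_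
    filter_upwards [Measure.support_mem_ae (μ := (μ : Measure K))] with y hy
    rw [hp.2 y hy, add_zero]
  have hKφ : Kop ε μ φ x = 2 / ε * a - 2 / ε * Kop ε μ V x := by
    have e : (φ : K → ℝ) = fun y => 2 / ε * a - 2 / ε * (V y + p y) := funext hφe
    have c1 : Continuous fun y => 2 / ε * (V y + p y) := by fun_prop
    rw [e, Kop_sub ε μ continuous_const c1, Kop_const, Kop_const_mul, hKp]
  have hw' : w x = bfun ε μ x * (2 / ε) * (Kop ε μ V x - V x - p x) := by
    rw [hKφ, hφe, div_eq_iff (hb x).ne'] at hu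
    rw [hu]; ring
  have hKV : bfun ε μ x * Kop ε μ V x = ∫ y, kc ε y x * (bfun ε μ y)⁻¹ * V y ∂(μ : Measure K) := by
    rw [Kop, ← integral_const_mul]
    refine integral_congr_ae (ae_of_all _ fun y => ?_)
    simp only [kself_eq]
    have := (hb x).ne'
    generalize kc ε y x = k at *
    field_simp
  have c0 : Continuous fun y => kc ε y x * (bfun ε μ y)⁻¹ :=
    (continuous_kc_left ε x).mul (continuous_inv_bfun ε μ)
  have hsplit : ∫ y, kc ε y x * (bfun ε μ y)⁻¹ * (V y - V x) ∂(μ : Measure K) =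
      bfun ε μ x * Kop ε μ V x - bfun ε μ x * V x := by
    have c1 : Continuous fun y => kc ε y x * (bfun ε μ y)⁻¹ * V y := c0.mul V.continuous
    have c2 : Continuous fun y => kc ε y x * (bfun ε μ y)⁻¹ * V x := c0.mul continuous_const
    simp_rw [mul_sub]
    rw [integral_sub (integrable_of_continuous _ c1) (integrable_of_continuous _ c2), hKV, integral_mul_const,
      ← bfun_eq_integral]
  rw [hsplit, hw']
  have h1 : 0 ≤ bfun ε μ x * (2 / ε) * (-p x) :=
    mul_nonneg (mul_nonneg (hb x).le (by positivity)) (neg_nonneg.2 (hp.1 x))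
  nlinarith

/-- The tangent line of `embB μ` at `x` is a lower bound, up to a quadratic error. -/
theorem embB_sub_ge (μ : ProbabilityMeasure K) (x z : K) :
    2 / ε * ∫ y, kc ε y x * (bfun ε μ y)⁻¹ *
        inner ℝ ((z : EuclideanSpace ℝ (Fin d)) - x) ((y : EuclideanSpace ℝ (Fin d)) - x)
          ∂(μ : Measure K) - dist z x ^ 2 / ε ≤ bfun ε μ z - bfun ε μ x := by
  have hε' := hε.out
  have c0 : Continuous fun y => kc ε y x * (bfun ε μ y)⁻¹ :=
    (continuous_kc_left ε x).mul (continuous_inv_bfun ε μ)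
  have cz : Continuous fun y => kc ε y z * (bfun ε μ y)⁻¹ :=
    (continuous_kc_left ε z).mul (continuous_inv_bfun ε μ)
  have ci : Continuous fun y : K => inner ℝ ((z : EuclideanSpace ℝ (Fin d)) - x)
      ((y : EuclideanSpace ℝ (Fin d)) - x) := by fun_prop
  have c1 : Continuous fun y : K => 2 / ε * (kc ε y x * (bfun ε μ y)⁻¹ *
    inner ℝ ((z : EuclideanSpace ℝ (Fin d)) - x) ((y : EuclideanSpace ℝ (Fin d)) - x)) :=
    continuous_const.mul (c0.mul ci)
  have c2 : Continuous fun y : K => kc ε y x * (bfun ε μ y)⁻¹ * (dist z x ^ 2 / ε) :=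
    c0.mul continuous_const
  have key : ∀ y, 2 / ε * (kc ε y x * (bfun ε μ y)⁻¹ *
      inner ℝ ((z : EuclideanSpace ℝ (Fin d)) - x) ((y : EuclideanSpace ℝ (Fin d)) - x)) -
      kc ε y x * (bfun ε μ y)⁻¹ * (dist z x ^ 2 / ε) ≤
      kc ε y z * (bfun ε μ y)⁻¹ - kc ε y x * (bfun ε μ y)⁻¹ := by
    intro y
    set q : ℝ := inner ℝ ((z : EuclideanSpace ℝ (Fin d)) - x) ((y : EuclideanSpace ℝ (Fin d)) - x)
      with hq
    have h1 : kc ε y z = kc ε y x * Real.exp (2 / ε * q - dist z x ^ 2 / ε) := by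
      rw [kc, kc, ← Real.exp_add, cost, cost, Subtype.dist_eq, dist_eq_norm,
        show (y : EuclideanSpace ℝ (Fin d)) - z = (y - x : EuclideanSpace ℝ (Fin d)) - (z - x) by
          abel, norm_sub_sq_real, real_inner_comm, ← hq]
      congr 1
      ring
    have h2 : 0 ≤ kc ε y x * (bfun ε μ y)⁻¹ :=
      mul_nonneg (kc_pos _ _ _).le (inv_nonneg.2 (bfun_pos ε μ y).le)
    have h3 := mul_le_mul_of_nonneg_left (Real.add_one_le_exp (2 / ε * q - dist z x ^ 2 / ε)) h2
    rw [h1]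
    linarith
  have h1 := integral_mono (integrable_of_continuous (μ : Measure K) (c1.sub c2))
    (integrable_of_continuous (μ : Measure K) (cz.sub c0)) key
  simp only [Pi.sub_apply] at h1
  rw [integral_sub (integrable_of_continuous _ c1) (integrable_of_continuous _ c2),
    integral_sub (integrable_of_continuous _ cz) (integrable_of_continuous _ c0),
    integral_const_mul, integral_mul_const, ← bfun_eq_integral, ← bfun_eq_integral] at h1
  have h2 : bfun ε μ x * (dist z x ^ 2 / ε) ≤ dist z x ^ 2 / ε :=
    mul_le_of_le_one_left (by positivity) (bfun_le_one ε μ x)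
  linarith

/-- Along a solution `μ` of the Sinkhorn inclusion and a gradient flow `x`, the value
`embB (μ t) (x t)` does not decrease. -/
theorem deriv_embB_apply_nonneg (hconv : Convex ℝ K) {V : C(K, ℝ)}
    {μ : ℝ → ProbabilityMeasure K} {t : ℝ} (ht : 0 < t) {σ : StrongDual ℝ (Hself ε (μ t))}
    (hσ : IsVelocity ε (Ici 0) μ t σ)
    {φ p : C(K, ℝ)} (hφ : IsInvIdSubKSq ε (μ t) φ (riesz ε σ))
    (hp : p ∈ pressures (μ t : Measure K))
    {a : ℝ} (hVp : ∀ y, ε / 2 * φ y + V y + p y = a)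
    {C : ℝ} (hC : ∀ᶠ s in 𝓝[>] t, ‖(s - t)⁻¹ • (embB ε (μ s) - embB ε (μ t))‖ ≤ C)
    {x : ℝ → K} {v : EuclideanSpace ℝ (Fin d)}
    (hv : HasDerivAt (fun s => (x s : EuclideanSpace ℝ (Fin d))) v t)
    (hv' : -v ∈ subdifferential V (x t)) {e : ℝ}
    (he : HasDerivAt (fun s => embB ε (μ s) (x s)) e t) : 0 ≤ e := by
  have hε' := hε.out
  set q : ℝ → Hc K ε := fun s => (s - t)⁻¹ • (embB ε (μ s) - embB ε (μ t)) with hq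
  set F : Ultrafilter ℝ := Ultrafilter.of (𝓝[>] t) with hF
  have hFle : (F : Filter ℝ) ≤ 𝓝[>] t := Ultrafilter.of_le _
  have hcx : Tendsto x F (𝓝 (x t)) := by
    have : ContinuousAt x t := by
      rw [Topology.IsInducing.subtypeVal.continuousAt_iff]; exact hv.continuousAt
    exact this.tendsto.mono_left (hFle.trans nhdsWithin_le_nhds)
  have hsub : Tendsto (fun s => s - t) F (𝓝 0) :=
    ((continuous_id.sub continuous_const).tendsto' t 0 (sub_self t)).mono_left
      (hFle.trans nhdsWithin_le_nhds)
  -- Differentiability of B(μ) in H_c is not assumed: bounded difference quotients have a uniform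
  -- limit along an ultrafilter, which suffices to compute `e`.
  obtain ⟨w, -, hw⟩ := (isCompact_lipschitzBall (X := K) C (C * Real.sqrt (2 / ε))).ultrafilter_le_nhds
    (F.map fun s => toC ε (q s)) (by
      rw [le_principal_iff]
      change ∀ᶠ s in (F : Filter ℝ), _
      filter_upwards [hFle hC] with s hs
      refine ⟨fun y => ?_, fun y z => ?_⟩
      · rw [toC_apply]
        exact (abs_Hc_apply_le ε _ y).trans hs
      · rw [toC_apply, toC_apply]
        refine (abs_Hc_apply_sub_le ε _ y z).trans ?_
        gcongr)
  have hw : Tendsto (fun s => toC ε (q s)) F (𝓝 w) := hw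
  have hb : Tendsto (fun s => embB ε (μ s)) F (𝓝 (embB ε (μ t))) := by
    rw [tendsto_iff_norm_sub_tendsto_zero]
    have h1 : Tendsto (fun s => C * (s - t)) F (𝓝 0) := by simpa using hsub.const_mul C
    refine squeeze_zero' (Eventually.of_forall fun _ => norm_nonneg _) ?_ h1
    filter_upwards [hFle hC, hFle self_mem_nhdsWithin] with s hs hst
    have hst' : 0 < s - t := sub_pos.2 hst
    have hs' : ‖(s - t)⁻¹ • (embB ε (μ s) - embB ε (μ t))‖ ≤ C := hs
    rw [norm_smul, norm_inv, Real.norm_of_nonneg hst'.le, inv_mul_le_iff₀ hst'] at hs'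
    linarith
  have hFI : (F : Filter ℝ) ≤ 𝓝[Ici 0 \ {t}] t :=
    hFle.trans (nhdsWithin_mono _ fun s hs => ⟨ht.le.trans (le_of_lt hs), ne_of_gt hs⟩)
  have hlow := le_limit_of_inclusion hσ.1 hφ hp hVp (hσ.add_Kop_eq_riesz hconv hFI hb w hw) (x t)
  set ρ : K → ℝ := fun y => kc ε y (x t) * (bfun ε (μ t) y)⁻¹ with hρ
  have hρc : Continuous ρ := (continuous_kc_left ε (x t)).mul (continuous_inv_bfun ε (μ t))
  have hρ0 : ∀ y, 0 ≤ ρ y := fun y =>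
    mul_nonneg (kc_pos _ _ _).le (inv_nonneg.2 (bfun_pos ε (μ t) y).le)
  set G : EuclideanSpace ℝ (Fin d) :=
    ∫ y : K, ρ y • ((y : EuclideanSpace ℝ (Fin d)) - x t) ∂(μ t : Measure K) with hG
  have hGi : Integrable (fun y : K => ρ y • ((y : EuclideanSpace ℝ (Fin d)) - x t))
      (μ t : Measure K) := integrable_of_continuous _ (by fun_prop)
  have hinner : ∀ z : EuclideanSpace ℝ (Fin d),
      ∫ y : K, ρ y * inner ℝ z ((y : EuclideanSpace ℝ (Fin d)) - x t) ∂(μ t : Measure K) =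
        inner ℝ z G := fun z => by
    rw [hG, ← integral_inner hGi]
    simp_rw [real_inner_smul_right]
  have hV : -inner ℝ v G ≤ ∫ y, ρ y * (V y - V (x t)) ∂(μ t : Measure K) := by
    rw [← inner_neg_left, ← hinner]
    refine integral_mono (integrable_of_continuous _ (by fun_prop))
      (integrable_of_continuous _ (by fun_prop)) fun y => ?_
    refine mul_le_mul_of_nonneg_left ?_ (hρ0 y)
    linarith [hv' y]
  have hwx : Tendsto (fun s => toC ε (q s) (x s)) F (𝓝 (w (x t))) :=
    (ContinuousEval.continuous_eval.tendsto (w, x t)).comp (hw.prodMk_nhds hcx)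
  have hvs : Tendsto (fun s => (s - t)⁻¹ • ((x s : EuclideanSpace ℝ (Fin d)) - x t)) F (𝓝 v) :=
    (hasDerivAt_iff_tendsto_slope.1 hv).mono_left
      (hFle.trans (nhdsWithin_mono _ fun s hs => ne_of_gt hs))
  have hes : Tendsto (fun s => (s - t)⁻¹ * (embB ε (μ s) (x s) - embB ε (μ t) (x t))) F (𝓝 e) :=
    (hasDerivAt_iff_tendsto_slope.1 he).mono_left
      (hFle.trans (nhdsWithin_mono _ fun s hs => ne_of_gt hs))
  -- The increment of B(μ_s)(x_s) splits into a change of μ at the fixed point x_s and a change of x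
  -- at fixed μ_t; the latter is bounded below with a quadratic error that vanishes.
  have hlim : Tendsto (fun s => toC ε (q s) (x s) + (2 / ε *
      inner ℝ ((s - t)⁻¹ • ((x s : EuclideanSpace ℝ (Fin d)) - x t)) G -
      (s - t) * ‖(s - t)⁻¹ • ((x s : EuclideanSpace ℝ (Fin d)) - x t)‖ ^ 2 / ε)) F
      (𝓝 (w (x t) + (2 / ε * inner ℝ v G - 0 * ‖v‖ ^ 2 / ε))) :=
    hwx.add (((hvs.inner tendsto_const_nhds).const_mul _).sub
      ((hsub.mul (hvs.norm.pow 2)).div_const ε))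
  have hle := le_of_tendsto_of_tendsto hlim hes (by
    filter_upwards [hFle self_mem_nhdsWithin] with s hst
    have hst' : 0 < s - t := sub_pos.2 hst
    have h1 := embB_sub_ge (ε := ε) (μ t) (x t) (x s)
    have h2 := hinner ((x s : EuclideanSpace ℝ (Fin d)) - x t)
    simp only [hρ] at h2
    rw [h2, Subtype.dist_eq, dist_eq_norm] at h1
    have h3 : toC ε (q s) (x s) = (s - t)⁻¹ * (embB ε (μ s) (x s) - embB ε (μ t) (x s)) := by
      simp [hq, toC_apply]
    rw [h3, norm_smul, norm_inv, Real.norm_of_nonneg hst'.le, real_inner_smul_left]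
    simp only [embB_apply]
    have h4 := mul_le_mul_of_nonneg_left h1 (inv_nonneg.2 hst'.le)
    have h5 : (s - t) * ((s - t)⁻¹ * ‖(x s : EuclideanSpace ℝ (Fin d)) - x t‖) ^ 2 / ε =
        (s - t)⁻¹ * (‖(x s : EuclideanSpace ℝ (Fin d)) - x t‖ ^ 2 / ε) := by
      field_simp
    rw [h5]
    linarith)
  have h6 := mul_le_mul_of_nonneg_left hV (by positivity : 0 ≤ 2 / ε)
  simp only [zero_mul, zero_div, sub_zero] at hle
  linarith

/-- The Sinkhorn potential flow of a Dirac mass is unique. -/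
theorem IsSinkhornPotentialFlow.eq_diracProba (hconv : Convex ℝ K) {V : C(K, ℝ)} {x₀ : K}
    {x : ℝ → K} (hx : IsGradientFlow V x₀ x) {μ : ℝ → ProbabilityMeasure K}
    (hμ : IsSinkhornPotentialFlow ε V (diracProba x₀) μ) {T : ℝ} (hT : 0 ≤ T) :
    μ T = diracProba (x T) := by
  obtain ⟨M, hM, -, hxM⟩ := (hx.ac 0 T Icc_subset_Ici_self).exists_dist_le le_rfl
  have hbac : IsAC 2 edist (fun t => embB ε (μ t)) (Icc 0 T) :=
    (hμ.ac 0 T Icc_subset_Ici_self).of_le (Real.sqrt_nonneg (2 / ε))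
      fun _ _ _ _ => edist_embB_le hconv _ _
  obtain ⟨M', hM', -, hbM⟩ := hbac.exists_dist_le (by norm_num)
  set E : ℝ → ℝ := fun s => embB ε (μ s) (x s) with hE
  have hac : AbsolutelyContinuousOnInterval E 0 T := by
    refine absolutelyContinuousOnInterval_of_dist_le hT
      (M := fun r => M' r + Real.sqrt (2 / ε) * M r) (hM'.add (hM.const_mul _))
      fun s hs t ht hst => ?_
    have i1 : IntervalIntegrable M volume s t :=
      (intervalIntegrable_iff_integrableOn_Icc_of_le hst).2
        (hM.mono_set (Icc_subset_Icc hs.1 ht.2))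
    have i2 : IntervalIntegrable M' volume s t :=
      (intervalIntegrable_iff_integrableOn_Icc_of_le hst).2
        (hM'.mono_set (Icc_subset_Icc hs.1 ht.2))
    rw [intervalIntegral.integral_add i2 (i1.const_mul _), intervalIntegral.integral_const_mul]
    have e1 : E s - E t = (embB ε (μ s) - embB ε (μ t)) (x s) +
        (embB ε (μ t) (x s) - embB ε (μ t) (x t)) := by
      simp [hE]
    rw [Real.dist_eq, e1]
    refine (abs_add_le _ _).trans (add_le_add ?_ ?_)
    · refine (abs_Hc_apply_le ε _ _).trans ?_
      rw [← dist_eq_norm]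
      exact hbM s hs t ht hst
    · refine (abs_Hc_apply_sub_le ε _ _ _).trans ?_
      rw [norm_embB, one_mul]
      exact mul_le_mul_of_nonneg_left (hxM s hs t ht hst) (Real.sqrt_nonneg _)
  have hM'i : IntervalIntegrable M' volume 0 T :=
    (intervalIntegrable_iff_integrableOn_Icc_of_le hT).2 hM'
  have hle := hac.le_of_ae_deriv_nonneg hT (by
    filter_upwards [(ae_restrict_iff' measurableSet_Ici).1 hx.inclusion,
      (ae_restrict_iff' measurableSet_Ici).1 hμ.inclusion,
      hM'i.ae_hasDerivAt_integral] with t h1 h2 h3 ht e he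
    obtain ⟨v, hv, hv'⟩ := h1 ht.1.le
    obtain ⟨σ, hσ, φ, hφ, p, hp, a, hVp⟩ := h2 ht.1.le
    rw [uIcc_of_le hT] at h3
    have htI := Ioo_subset_Icc_self ht
    have h4 : Tendsto (slope (fun r => ∫ u in t..r, M' u) t) (𝓝[>] t) (𝓝 (M' t)) :=
      (hasDerivAt_iff_tendsto_slope.1 (h3 htI t htI)).mono_left
        (nhdsWithin_mono _ fun s hs => ne_of_gt hs)
    refine deriv_embB_apply_nonneg hconv ht.1 hσ hφ hp hVp (C := M' t + 1) ?_
      (hv.hasDerivAt (Ici_mem_nhds ht.1)) hv' he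
    -- At a Lebesgue point of M' the mean of M' over [t, s] is eventually below M'(t) + 1, which
    -- bounds the difference quotients of B(μ).
    filter_upwards [h4.eventually (gt_mem_nhds (lt_add_one (M' t))), Ioo_mem_nhdsGT ht.2]
      with s hs hst
    have hpos : 0 < s - t := sub_pos.2 hst.1
    rw [slope_def_field, intervalIntegral.integral_same, sub_zero] at hs
    have h5 := hbM t htI s ⟨ht.1.le.trans hst.1.le, hst.2.le⟩ hst.1.le
    rw [dist_comm, dist_eq_norm] at h5
    rw [norm_smul, norm_inv, Real.norm_of_nonneg hpos.le, inv_mul_eq_div]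
    exact (div_le_div_of_nonneg_right h5 hpos.le).trans hs.le)
  have h0 : E 0 = 1 := by
    simp only [hE, hμ.init, hx.init, embB_apply, bfun_diracProba, kc_self]
  have hET : 1 ≤ E T := h0 ▸ hle
  -- For unit vectors ‖B(μ_T) - k_c(x_T, ·)‖² = 2 - 2E(T), and this is at most 0.
  have hzero : embB ε (μ T) = sec (kc ε) (x T) := by
    rw [← sub_eq_zero, ← norm_eq_zero, ← sq_eq_zero_iff]
    refine le_antisymm ?_ (sq_nonneg _)
    rw [norm_sub_sq_real, norm_embB, norm_sec_kc, inner_sec]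
    change 1 ^ 2 - 2 * E T + 1 ^ 2 ≤ 0
    linarith
  refine eq_diracProba_of_bfun_eq hconv (ε := ε) fun y => ?_
  rw [← embB_apply, hzero, sec_apply, kc_comm]

end DiracFlow

end SinkhornFlow

/-! ### Flow of a Dirac mass: conclusion -/

theorem mainTheorem4 {d : ℕ} (K : Set (EuclideanSpace ℝ (Fin d))) (hK : IsCompact K)
    (hconv : Convex ℝ K) (ε : ℝ) [Fact (0 < ε)] (V : C(K, ℝ)) :
    (∀ x : ℝ → K,
      (∀ p : ℝ≥0∞, 1 ≤ p →
        (IsAC p edist x (Ici 0) → IsAC p edist (fun t => embB ε (diracProba (x t))) (Ici 0)) ∧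
        (IsACLoc p edist x (Ici 0) →
          IsACLoc p edist (fun t => embB ε (diracProba (x t))) (Ici 0))) ∧
      ∀ t : ℝ, 0 ≤ t → ∀ (v : EuclideanSpace ℝ (Fin d)) (w : Hc K ε),
        HasDerivWithinAt (fun s => (x s : EuclideanSpace ℝ (Fin d))) v (Ici 0) t →
        HasDerivWithinAt (fun s => embB ε (diracProba (x s))) w (Ici 0) t →
        ((∃ p ∈ Ptilde ε (embB ε (diracProba (x t))),
            ∀ y, w y + Wop ε V (embB ε (diracProba (x t))) y + p y = 0) ↔
          -v ∈ subdifferential V (x t))) ∧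
    (IsConvexFun V → ∀ x₀ : K, ∃ x : ℝ → K,
      IsGradientFlow V x₀ x ∧
      (∀ x' : ℝ → K, IsGradientFlow V x₀ x' → EqOn x' x (Ici 0)) ∧
      IsSinkhornPotentialFlow ε V (diracProba x₀) (fun t => diracProba (x t)) ∧
      ∀ μ : ℝ → ProbabilityMeasure K, IsSinkhornPotentialFlow ε V (diracProba x₀) μ →
        ∀ t : ℝ, 0 ≤ t → μ t = diracProba (x t)) := by
  have : CompactSpace K := isCompact_iff_compactSpace.1 hK
  refine ⟨fun x => ⟨fun p _ => ⟨IsAC.embB_diracProba ε,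
      fun h a b hab => (h a b hab).embB_diracProba ε⟩,
    fun t ht v w hv hw => inclusion_iff ε hconv V x ht hv hw⟩, fun hV x₀ => ?_⟩
  obtain ⟨x, hx, hx2⟩ := exists_isGradientFlow hconv hV x₀
  exact ⟨x, hx, fun x' hx' => hx.eqOn hx', isSinkhornPotentialFlow_diracProba hconv hx hx2,
    fun μ hμ t ht => hμ.eq_diracProba hconv hx ht⟩
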